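/- Let $\Bbbk$ be a field of characteristic $0$, let $Q$ be the quiver $1\xrightarrow{\alpha}2\xrightarrow{\beta}3$, and let $\mathbf d=(d_1,d_2,d_3)\in\mathbb N^3$. Let $\operatorname{Rep}(Q,\mathbf d)=\operatorname{Hom}(\Bbbk^{d_1},\Bbbk^{d_2})\oplus\operatorname{Hom}(\Bbbk^{d_2},\Bbbk^{d_3})$, regarded as an affine space, on which $\operatorname{GL}(\mathbf d)=\operatorname{GL}(d_1)\times\operatorname{GL}(d_2)\times\operatorname{GL}(d_3)$ acts by conjugation. Let $V\in\operatorname{Rep}(Q,\mathbf d)$ with $$V\cong S_1^{a_1}\oplus S_2^{a_2}\oplus S_3^{a_3}\oplus I_2^{b_1}\oplus P_2^{b_2}\oplus I_3^{c},$$ where $S_1,S_2,S_3,I_2,P_2,I_3$ are the indecomposable representations of $Q$ of dimension vectors $(1,0,0)$, $(0,1,0)$, $(0,0,1)$, $(1,1,0)$, $(0,1,1)$, $(1,1,1)$, respectively, and let $\overline O_V\subseteq\operatorname{Rep}(Q,\mathbf d)$ be the Zariski closure of the $\operatorname{GL}(\mathbf d)$-orbit of $V$, with its reduced structure. Let $\operatorname{Flag}(b_1+c,d_2-b_2,d_2)$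 be the variety of flags $R_1\subseteq R_2\subseteq\Bbbk^{d_2}$ with $\dim R_1=b_1+c$ and $\dim R_2=d_2-b_2$, let $\operatorname{Gr}(c,d_3)$ be the variety of $c$-dimensional subspaces $R\subseteq\Bbbk^{d_3}$, and let $$Z\subseteq\operatorname{Rep}(Q,\mathbf d)\times\operatorname{Flag}(b_1+c,d_2-b_2,d_2)\times\operatorname{Gr}(c,d_3)$$ be the incidence variety of all $(W,R_1\subseteq R_2,R)$ with $\operatorname{Im}W(\alpha)\subseteq R_1$ and $W(\beta)(R_2)\subseteq R$; that is, $Z$ is the $\Bbbk$-scheme whose points over a $\Bbbk$-algebra $A$ are, naturally in $A$, the tuples $(W,R_1\subseteq R_2,R)$ of this kind in which $W$ is a pair of matrices over $A$ and $R_1,R_2\subseteq A^{d_2}$, $R\subseteq A^{d_3}$ are locally direct summands of the given ranks (such a scheme exists, and it is unique up to a unique isomorphism). Then the projection $(W,R_1\subseteq R_2,R)\mapsto W$ defines a morphism $q:Z\to\overline O_V$ over $\Bbbk$, and $q$ is a resolution of singularities: $Z$ is integral and smooth over $\Bbbk$, and $q$ is proper and birational (an isomorphism over a dense open subset of $\overline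 O_V$ whose preimage is dense in $Z$). -/

import Mathlib

open CategoryTheory AlgebraicGeometry

universe u

noncomputable section

namespace EquiA3

/-! ### Representations of the equioriented quiver `1 --α--> 2 --β--> 3` -/

/-- A representation of the quiver `1 → 2 → 3` over `k`. -/
structure QRep (k : Type u) [Field k] where
  V₁ : ModuleCat.{u} k
  V₂ : ModuleCat.{u} k
  V₃ : ModuleCat.{u} k
  α : V₁ →ₗ[k] V₂
  β : V₂ →ₗ[k] V₃

namespace QRep

variable {k : Type u} [Field k]

/-- Two representations are isomorphic. -/
def Isomorphic (V W : QRep k) : Prop :=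
  ∃ (e₁ : V.V₁ ≃ₗ[k] W.V₁) (e₂ : V.V₂ ≃ₗ[k] W.V₂) (e₃ : V.V₃ ≃ₗ[k] W.V₃),
    (∀ x, e₂ (V.α x) = W.α (e₁ x)) ∧ (∀ y, e₃ (V.β y) = W.β (e₂ y))

/-- Direct sum of two representations. -/
def directSum (V W : QRep k) : QRep k where
  V₁ := ModuleCat.of k (V.V₁ × W.V₁)
  V₂ := ModuleCat.of k (V.V₂ × W.V₂)
  V₃ := ModuleCat.of k (V.V₃ × W.V₃)
  α := LinearMap.prodMap V.α W.α
  β := LinearMap.prodMap V.β W.β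

/-- Direct sum of `n` copies of a representation. -/
def power (V : QRep k) (n : ℕ) : QRep k where
  V₁ := ModuleCat.of k (Fin n → V.V₁)
  V₂ := ModuleCat.of k (Fin n → V.V₂)
  V₃ := ModuleCat.of k (Fin n → V.V₃)
  α := LinearMap.pi fun i => V.α ∘ₗ LinearMap.proj i
  β := LinearMap.pi fun i => V.β ∘ₗ LinearMap.proj i

variable (k)

/-- The simple representation of dimension vector `(1,0,0)`. -/
def S₁ : QRep k where
  V₁ := ModuleCat.of k k
  V₂ := ModuleCat.of k PUnit.{u + 1}
  V₃ := ModuleCat.of k PUnit.{u + 1}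
  α := 0
  β := 0

/-- The simple representation of dimension vector `(0,1,0)`. -/
def S₂ : QRep k where
  V₁ := ModuleCat.of k PUnit.{u + 1}
  V₂ := ModuleCat.of k k
  V₃ := ModuleCat.of k PUnit.{u + 1}
  α := 0
  β := 0

/-- The simple representation of dimension vector `(0,0,1)`. -/
def S₃ : QRep k where
  V₁ := ModuleCat.of k PUnit.{u + 1}
  V₂ := ModuleCat.of k PUnit.{u + 1}
  V₃ := ModuleCat.of k k
  α := 0
  β := 0

/-- The indecomposable representation `k = k → 0` of dimension vector `(1,1,0)`. -/
def I₂ : QRep k where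
  V₁ := ModuleCat.of k k
  V₂ := ModuleCat.of k k
  V₃ := ModuleCat.of k PUnit.{u + 1}
  α := LinearMap.id
  β := 0

/-- The indecomposable representation `0 → k = k` of dimension vector `(0,1,1)`. -/
def P₂ : QRep k where
  V₁ := ModuleCat.of k PUnit.{u + 1}
  V₂ := ModuleCat.of k k
  V₃ := ModuleCat.of k k
  α := 0
  β := LinearMap.id

/-- The indecomposable representation `k = k = k` of dimension vector `(1,1,1)`. -/
def I₃ : QRep k where
  V₁ := ModuleCat.of k k
  V₂ := ModuleCat.of k k
  V₃ := ModuleCat.of k k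
  α := LinearMap.id
  β := LinearMap.id

/-- `S₁^a₁ ⊕ S₂^a₂ ⊕ S₃^a₃ ⊕ I₂^b₁ ⊕ P₂^b₂ ⊕ I₃^c`. -/
def ofMultiplicities (a₁ a₂ a₃ b₁ b₂ c : ℕ) : QRep k :=
  ((S₁ k).power a₁).directSum <| ((S₂ k).power a₂).directSum <| ((S₃ k).power a₃).directSum <|
    ((I₂ k).power b₁).directSum <| ((P₂ k).power b₂).directSum ((I₃ k).power c)

end QRep

/-! ### The representation space, its group action and orbit closures -/

/-- The set `Rep(Q, (d₁, d₂, d₃))(A) = Hom(A^d₁, A^d₂) ⊕ Hom(A^d₂, A^d₃)`, in matrices. -/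
@[ext]
structure RepSpace (A : Type u) [CommRing A] (d₁ d₂ d₃ : ℕ) where
  α : Matrix (Fin d₂) (Fin d₁) A
  β : Matrix (Fin d₃) (Fin d₂) A

/-- Index set of the coordinates on the affine space `Rep(Q, (d₁, d₂, d₃))`. -/
abbrev Coord (d₁ d₂ d₃ : ℕ) : Type := (Fin d₂ × Fin d₁) ⊕ (Fin d₃ × Fin d₂)

namespace RepSpace

variable {d₁ d₂ d₃ : ℕ}

/-- The vector of coordinates (matrix entries). -/
def coords {A : Type u} [CommRing A] (V : RepSpace A d₁ d₂ d₃) : Coord d₁ d₂ d₃ → A :=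
  Sum.elim (fun p => V.α p.1 p.2) (fun p => V.β p.1 p.2)

/-- The action of `GL(d₁) × GL(d₂) × GL(d₃)` by conjugation. -/
def act {k : Type u} [Field k] (g₁ : GL (Fin d₁) k) (g₂ : GL (Fin d₂) k) (g₃ : GL (Fin d₃) k)
    (V : RepSpace k d₁ d₂ d₃) : RepSpace k d₁ d₂ d₃ where
  α := g₂.val * V.α * (g₁⁻¹).val
  β := g₃.val * V.β * (g₂⁻¹).val

/-- The orbit `O_V`. -/
def orbit {k : Type u} [Field k] (V : RepSpace k d₁ d₂ d₃) : Set (RepSpace k d₁ d₂ d₃) :=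
  {W | ∃ g₁ g₂ g₃, W = act g₁ g₂ g₃ V}

/-- An element of `Rep(Q, d)` as a representation of the quiver. -/
def toQRep {k : Type u} [Field k] (V : RepSpace k d₁ d₂ d₃) : QRep k where
  V₁ := ModuleCat.of k (Fin d₁ → k)
  V₂ := ModuleCat.of k (Fin d₂ → k)
  V₃ := ModuleCat.of k (Fin d₃ → k)
  α := Matrix.toLin' V.α
  β := Matrix.toLin' V.β

end RepSpace

/-- The affine space `Rep(Q, (d₁, d₂, d₃))` as a scheme. -/
def repScheme (k : Type u) [Field k] (d₁ d₂ d₃ : ℕ) : Scheme.{u} :=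
  Spec (CommRingCat.of (MvPolynomial (Coord d₁ d₂ d₃) k))

/-- The `A`-point of the scheme `Rep(Q, d)` given by a pair of matrices over `A`. -/
def repPoint (k : Type u) [Field k] {A : Type u} [CommRing A] [Algebra k A] {d₁ d₂ d₃ : ℕ}
    (W : RepSpace A d₁ d₂ d₃) : Spec (CommRingCat.of A) ⟶ repScheme k d₁ d₂ d₃ :=
  Spec.map (CommRingCat.ofHom
    (MvPolynomial.aeval W.coords : MvPolynomial (Coord d₁ d₂ d₃) k →ₐ[k] A).toRingHom)

section OrbitClosure

variable {k : Type u} [Field k] {d₁ d₂ d₃ : ℕ} (V : RepSpace k d₁ d₂ d₃)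

/-- The ideal of all polynomial functions on `Rep(Q, d)` that vanish on the orbit of `V`. -/
def orbitIdeal : Ideal (MvPolynomial (Coord d₁ d₂ d₃) k) :=
  MvPolynomial.vanishingIdeal k (RepSpace.coords '' V.orbit)

/-- The Zariski closure of the orbit of `V`, as a closed (reduced) subscheme of `Rep(Q, d)`. -/
def orbitClosure : Scheme.{u} :=
  Spec (CommRingCat.of (MvPolynomial (Coord d₁ d₂ d₃) k ⧸ orbitIdeal V))

/-- The inclusion of the orbit closure into `Rep(Q, d)`. -/
def orbitClosureι : orbitClosure V ⟶ repScheme k d₁ d₂ d₃ :=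
  Spec.map (CommRingCat.ofHom (Ideal.Quotient.mk (orbitIdeal V)))

/-- The structure morphism of the orbit closure. -/
def orbitClosureStr : orbitClosure V ⟶ Spec (CommRingCat.of k) :=
  Spec.map (CommRingCat.ofHom
    (algebraMap k (MvPolynomial (Coord d₁ d₂ d₃) k ⧸ orbitIdeal V)))

end OrbitClosure

/-! ### Grassmannians, flags and the incidence variety, through their points -/

/-- The `A`-points of `Gr(r, n)`: the submodules `N` of `A ^ n` that are locally direct summands
(i.e. `A ^ n ⧸ N` is projective) of rank `r`. Over a field: the `r`-dimensional subspaces. -/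
@[ext]
structure Gr (A : Type u) [CommRing A] (r n : ℕ) where
  sub : Submodule A (Fin n → A)
  projective_quotient : Module.Projective A ((Fin n → A) ⧸ sub)
  rank_eq : ∀ p : PrimeSpectrum A, Module.rankAtStalk sub p = r

/-- The `A`-points `R₁ ⊆ R₂ ⊆ A ^ n` of the two-step flag variety `Flag(r₁, r₂, n)`. -/
@[ext]
structure Flag (A : Type u) [CommRing A] (r₁ r₂ n : ℕ) where
  R₁ : Gr A r₁ n
  R₂ : Gr A r₂ n
  le : R₁.sub ≤ R₂.sub

/-- The `A`-points of the incidence variety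
`Z ⊆ Rep(Q, (d₁, d₂, d₃)) × Flag(r₁, r₂, d₂) × Gr(c, d₃)`:
those `(V, R₁ ⊆ R₂, R)` with `Im V(α) ⊆ R₁` and `V(β)(R₂) ⊆ R`. -/
@[ext]
structure IncidencePoint (A : Type u) [CommRing A] (d₁ d₂ d₃ r₁ r₂ c : ℕ) where
  V : RepSpace A d₁ d₂ d₃
  F : Flag A r₁ r₂ d₂
  R : Gr A c d₃
  range_le : LinearMap.range (Matrix.toLin' V.α) ≤ F.R₁.sub
  map_le : F.R₂.sub.map (Matrix.toLin' V.β) ≤ R.sub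

/-- Extension of scalars of a submodule of `A ^ n` along `f : A → B`: the submodule of `B ^ n`
generated by its image. -/
def extendSub {A B : Type u} [CommRing A] [CommRing B] (f : A →+* B) {n : ℕ}
    (N : Submodule A (Fin n → A)) : Submodule B (Fin n → B) :=
  Submodule.span B ((fun v i => f (v i)) '' (N : Set (Fin n → A)))

/-- `Q` is the image of the `A`-point `P` under the map on points induced by `f : A → B`. -/
structure IncidencePoint.IsBaseChange {A B : Type u} [CommRing A] [CommRing B] (f : A →+* B)
    {d₁ d₂ d₃ r₁ r₂ c : ℕ} (P : IncidencePoint A d₁ d₂ d₃ r₁ r₂ c)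
    (Q : IncidencePoint B d₁ d₂ d₃ r₁ r₂ c) : Prop where
  α : Q.V.α = P.V.α.map f
  β : Q.V.β = P.V.β.map f
  R₁ : Q.F.R₁.sub = extendSub f P.F.R₁.sub
  R₂ : Q.F.R₂.sub = extendSub f P.F.R₂.sub
  R : Q.R.sub = extendSub f P.R.sub

/-- The `A`-points, over `k`, of a `k`-scheme `Z` with structure morphism `s`. -/
def Points {k : Type u} [Field k] {Z : Scheme.{u}} (s : Z ⟶ Spec (CommRingCat.of k))
    (A : Type u) [CommRing A] [Algebra k A] : Type u :=
  {x : Spec (CommRingCat.of A) ⟶ Z // x ≫ s = Spec.map (CommRingCat.ofHom (algebraMap k A))}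

/-- An identification of the `k`-scheme `Z` with the incidence variety: bijections between the
`A`-points of `Z` and the incidence points over `A`, natural in the `k`-algebra `A`.
By the Yoneda lemma this determines `Z` up to a unique isomorphism over `k`. -/
structure IncidenceVarietyStr {k : Type u} [Field k] {Z : Scheme.{u}}
    (s : Z ⟶ Spec (CommRingCat.of k)) (d₁ d₂ d₃ r₁ r₂ c : ℕ) where
  equiv : ∀ (A : Type u) [CommRing A] [Algebra k A],
    Points s A ≃ IncidencePoint A d₁ d₂ d₃ r₁ r₂ c
  natural : ∀ (A B : Type u) [CommRing A] [Algebra k A] [CommRing B] [Algebra k B]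
    (f : A →ₐ[k] B) (x : Points s A) (y : Points s B),
    y.1 = Spec.map (CommRingCat.ofHom f.toRingHom) ≫ x.1 →
      (equiv A x).IsBaseChange f.toRingHom (equiv B y)

/-- `q : Z → closure of O_V` is the projection `(W, R₁ ⊆ R₂, R) ↦ W`, on points over all
`k`-algebras. -/
def IsFirstProjection {k : Type u} [Field k] {Z : Scheme.{u}} {s : Z ⟶ Spec (CommRingCat.of k)}
    {d₁ d₂ d₃ r₁ r₂ c : ℕ} (e : IncidenceVarietyStr s d₁ d₂ d₃ r₁ r₂ c)
    {V : RepSpace k d₁ d₂ d₃} (q : Z ⟶ orbitClosure V) : Prop :=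
  ∀ (A : Type u) [CommRing A] [Algebra k A] (x : Points s A),
    x.1 ≫ q ≫ orbitClosureι V = repPoint k (e.equiv A x).V

/-! ### Resolutions of singularities -/

/-- A morphism `q : Z → X` of schemes over a field `k` of characteristic zero (where smooth over
`k` is the same as nonsingular) is a resolution of singularities of `X`: the scheme `Z` is
integral and smooth over `k`, and `q` is proper and birational, i.e. an isomorphism over a dense
open subset of `X` with dense preimage in `Z`. -/
structure IsResolutionOfSingularities {k : Type u} [Field k] {Z X : Scheme.{u}}
    (s : Z ⟶ Spec (CommRingCat.of k)) (t : X ⟶ Spec (CommRingCat.of k)) (q : Z ⟶ X) : Prop where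
  comp_eq : q ≫ t = s
  integral : IsIntegral Z
  smooth : Smooth s
  proper : IsProper q
  birational : ∃ U : X.Opens, Dense (U : Set X) ∧ Dense ((q ⁻¹ᵁ U : Z.Opens) : Set Z) ∧
    IsIso (q ∣_ U)

end EquiA3

end

noncomputable section

namespace EquiA3

open Limits

/-!
The functor of points of the incidence variety is a Zariski sheaf, and it is covered by charts that
are affine spaces: choosing which coordinates of `k ^ d₂` and `k ^ d₃` serve as complements of
`R₁`, `R₂` and `R` puts the frames of these submodules and the matrices `W(α)`, `W(β)` into a normal
form with free entries. Gluing the charts represents the functor by a smooth scheme. Over the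
algebraic closure, the spans of the first columns of a Vandermonde matrix are transverse to all
coordinate complements at once, so the charts have a point in common and `Z` is integral.

The projection to `Rep(Q, d)` satisfies the valuative criterion, since a direct summand of `K ^ n`
extends over a valuation ring `R` of `K` by intersecting it with `R ^ n`. The orbit of `V` consists
of the representations with the same ranks of `α`, `β` and `β ∘ α`. Over the open set where minors
of these three sizes are invertible, `R₁ = Im α`, `R = Im (β ∘ α)` and `R₂ = β⁻¹(R)`: incidence
points there lie over the orbit and are determined by `W`. Hence `Z`, being integral, maps to the
orbit closure; this map is proper and dominant, so surjective, and over the open set it is a proper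
monomorphism, i.e. a closed immersion, onto a reduced scheme, hence an isomorphism.
-/

/-! ### Zariski sheaves on affine schemes and their atlases -/

/-- The localization homomorphism `A → A_f`, as a morphism of commutative rings. -/
abbrev awayHom {A : CommRingCat.{u}} (f : A) : A ⟶ CommRingCat.of (Localization.Away f) :=
  CommRingCat.ofHom (algebraMap A (Localization.Away f))

theorem exists_awayHom_comp_eq {A B : CommRingCat.{u}} (g : A ⟶ B) (f : A) :
    ∃ φ : CommRingCat.of (Localization.Away f) ⟶ CommRingCat.of (Localization.Away (g f)),
      awayHom f ≫ φ = g ≫ awayHom (g f) :=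
  ⟨CommRingCat.ofHom (Localization.awayMap g.hom f),
    CommRingCat.hom_ext <| IsLocalization.map_comp (T := .powers (g f)) <|
      Submonoid.powers_le.2 (Submonoid.mem_powers (g f))⟩

theorem range_specMap_awayHom {A : CommRingCat.{u}} (f : A) :
    Set.range (Spec.map (awayHom f)) = (PrimeSpectrum.basicOpen f : Set (PrimeSpectrum A)) :=
  PrimeSpectrum.localization_away_comap_range (Localization.Away f) f

theorem span_range_eq_top_of_forall_notMem {A : Type u} [CommRing A] (f : PrimeSpectrum A → A)
    (hf : ∀ p, f p ∉ p.asIdeal) : Ideal.span (Set.range f) = ⊤ := by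
  by_contra h
  obtain ⟨m, hm, hle⟩ := Ideal.exists_le_maximal _ h
  exact hf ⟨m, hm.isPrime⟩ (hle (Ideal.subset_span ⟨_, rfl⟩))

theorem span_range_comp_eq_top {A B : CommRingCat.{u}} {ι : Type u} {f : ι → A} (g : A ⟶ B)
    (hf : Ideal.span (Set.range f) = ⊤) : Ideal.span (Set.range fun i => g (f i)) = ⊤ := by
  have h := Ideal.map_span g.hom (Set.range f)
  rw [hf, Ideal.map_top, ← Set.range_comp] at h
  exact h.symm

/-- A functor on commutative rings is a sheaf for the Zariski topology on affine schemes. -/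
structure IsZariskiSheaf (F : CommRingCat.{u} ⥤ Type u) : Prop where
  separated {A : CommRingCat.{u}} {ι : Type u} (f : ι → A) :
    Ideal.span (Set.range f) = ⊤ → ∀ P Q : F.obj A,
      (∀ i, F.map (awayHom (f i)) P = F.map (awayHom (f i)) Q) → P = Q
  glue {A : CommRingCat.{u}} {ι : Type u} (f : ι → A) :
    Ideal.span (Set.range f) = ⊤ → ∀ P : ∀ i, F.obj (CommRingCat.of (Localization.Away (f i))),
      (∀ (i j : ι) (B : CommRingCat.{u}) (g : CommRingCat.of (Localization.Away (f i)) ⟶ B)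
        (h : CommRingCat.of (Localization.Away (f j)) ⟶ B),
        awayHom (f i) ≫ g = awayHom (f j) ≫ h → F.map g (P i) = F.map h (P j)) →
      ∃ Q : F.obj A, ∀ i, F.map (awayHom (f i)) Q = P i

theorem IsZariskiSheaf.of_iso {F G : CommRingCat.{u} ⥤ Type u} (η : F ≅ G)
    (hG : IsZariskiSheaf G) : IsZariskiSheaf F where
  separated f hf P Q h := by
    apply (η.app _).toEquiv.injective
    refine hG.separated f hf _ _ fun i => ?_
    change G.map _ (η.hom.app _ P) = G.map _ (η.hom.app _ Q)
    rw [← NatTrans.naturality_apply, h, NatTrans.naturality_apply]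
  glue f hf P h := by
    obtain ⟨Q, hQ⟩ := hG.glue f hf (fun i => η.hom.app _ (P i)) fun i j B g g' hgg' => by
      rw [← NatTrans.naturality_apply, h i j B g g' hgg', NatTrans.naturality_apply]
    refine ⟨η.inv.app _ Q, fun i => ?_⟩
    rw [← NatTrans.naturality_apply, hQ]
    exact congrArg (fun φ => φ (P i)) (η.hom_inv_id_app _)

/-- The points `x i` of `F` over the rings `R i` generate `F` Zariski-locally. -/
def IsZariskiCovering (F : CommRingCat.{u} ⥤ Type u) {J : Type u} {R : J → CommRingCat.{u}}
    (x : ∀ i, F.obj (R i)) : Prop :=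
  ∀ (A : CommRingCat.{u}) (P : F.obj A) (p : PrimeSpectrum A), ∃ f ∉ p.asIdeal,
    ∃ (i : J) (h : R i ⟶ CommRingCat.of (Localization.Away f)),
      F.map (awayHom f) P = F.map h (x i)

namespace IsZariskiCovering

variable {F G : CommRingCat.{u} ⥤ Type u} {J : Type u} {R : J → CommRingCat.{u}}
  {x : ∀ i, F.obj (R i)} {y : ∀ i, G.obj (R i)}

/-- `Q` has the coordinates that `P` has: wherever `P` is a specialization of some `x i`, the
same specialization of `y i` is `Q`. -/
def Corresponds (x : ∀ i, F.obj (R i)) (y : ∀ i, G.obj (R i)) {A : CommRingCat.{u}} (P : F.obj A)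
    (Q : G.obj A) : Prop :=
  ∀ (B : CommRingCat.{u}) (g : A ⟶ B) (i : J) (h : R i ⟶ B),
    F.map g P = F.map h (x i) → G.map g Q = G.map h (y i)

theorem Corresponds.map {A B : CommRingCat.{u}} {P : F.obj A} {Q : G.obj A}
    (hPQ : Corresponds x y P Q) (g : A ⟶ B) : Corresponds x y (F.map g P) (G.map g Q) := by
  intro C g' i h hP
  rw [← Functor.map_comp_apply] at hP ⊢
  exact hPQ C _ i h hP

theorem Corresponds.unique (hx : IsZariskiCovering F x) (hG : IsZariskiSheaf G)
    {A : CommRingCat.{u}} {P : F.obj A} {Q Q' : G.obj A} (hQ : Corresponds x y P Q)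
    (hQ' : Corresponds x y P Q') : Q = Q' := by
  choose f hf i h hP using hx A P
  refine hG.separated f (span_range_eq_top_of_forall_notMem f hf) _ _ fun p => ?_
  rw [hQ _ _ _ _ (hP p), hQ' _ _ _ _ (hP p)]

theorem exists_corresponds (hx : IsZariskiCovering F x) (hG : IsZariskiSheaf G)
    (hxy : ∀ (i j : J) (A : CommRingCat.{u}) (g : R i ⟶ A) (h : R j ⟶ A),
      F.map g (x i) = F.map h (x j) → G.map g (y i) = G.map h (y j))
    {A : CommRingCat.{u}} (P : F.obj A) : ∃ Q : G.obj A, Corresponds x y P Q := by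
  choose f hf i h hP using hx A P
  have hspan := span_range_eq_top_of_forall_notMem f hf
  obtain ⟨Q, hQ⟩ := hG.glue f hspan (fun p => G.map (h p) (y (i p))) fun p q B g g' hg => by
    simp only [← Functor.map_comp_apply]
    apply hxy
    simp only [Functor.map_comp_apply, ← hP]
    simp only [← Functor.map_comp_apply, hg]
  refine ⟨Q, fun B g j h' hj => ?_⟩
  refine hG.separated _ (span_range_comp_eq_top g hspan) _ _ fun p => ?_
  obtain ⟨φ, hφ⟩ := exists_awayHom_comp_eq g (f p)
  rw [← Functor.map_comp_apply, ← hφ, Functor.map_comp_apply, hQ]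
  simp only [← Functor.map_comp_apply]
  apply hxy
  simp only [Functor.map_comp_apply, ← hP, ← hj]
  simp only [← Functor.map_comp_apply, hφ]

theorem natTrans_ext (hx : IsZariskiCovering F x) (hG : IsZariskiSheaf G) {η η' : F ⟶ G}
    (h : ∀ i, η.app _ (x i) = η'.app _ (x i)) : η = η' := by
  ext A P
  choose f hf i g hP using hx A P
  refine hG.separated f (span_range_eq_top_of_forall_notMem f hf) _ _ fun p => ?_
  change G.map _ (η.app A P) = G.map _ (η'.app A P)
  rw [← NatTrans.naturality_apply, ← NatTrans.naturality_apply, hP, NatTrans.naturality_apply,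
    NatTrans.naturality_apply, h]

theorem exists_natTrans (hx : IsZariskiCovering F x) (hG : IsZariskiSheaf G)
    (hxy : ∀ (i j : J) (A : CommRingCat.{u}) (g : R i ⟶ A) (h : R j ⟶ A),
      F.map g (x i) = F.map h (x j) → G.map g (y i) = G.map h (y j)) :
    ∃ η : F ⟶ G, ∀ i, η.app _ (x i) = y i := by
  choose η hη using fun A => exists_corresponds hx hG hxy (A := A)
  refine ⟨{ app := fun A => ↾(η A), naturality := fun A B g => ?_ }, fun i => ?_⟩
  · ext P
    exact Corresponds.unique hx hG (hη B _) ((hη A P).map g)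
  · simpa using hη _ (x i) _ (𝟙 _) i (𝟙 _) rfl

theorem exists_natIso (hx : IsZariskiCovering F x) (hy : IsZariskiCovering G y)
    (hF : IsZariskiSheaf F) (hG : IsZariskiSheaf G)
    (hxy : ∀ (i j : J) (A : CommRingCat.{u}) (g : R i ⟶ A) (h : R j ⟶ A),
      F.map g (x i) = F.map h (x j) ↔ G.map g (y i) = G.map h (y j)) :
    ∃ η : F ≅ G, ∀ i, η.hom.app _ (x i) = y i := by
  obtain ⟨η, hη⟩ := exists_natTrans hx hG fun i j A g h => (hxy i j A g h).1
  obtain ⟨θ, hθ⟩ := exists_natTrans hy hF fun i j A g h => (hxy i j A g h).2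
  exact ⟨⟨η, θ, natTrans_ext hx hF fun i => by simp [hη, hθ],
    natTrans_ext hy hG fun i => by simp [hη, hθ]⟩, hη⟩

end IsZariskiCovering

/-- An atlas of a functor on commutative rings: monomorphic affine charts `Spec (R i) → F` that
cover `F` and such that the chart `j` meets the chart `i` in the principal open subset of
`Spec (R i)` defined by `D i j`. -/
structure AffineAtlas (F : CommRingCat.{u} ⥤ Type u) where
  J : Type u
  R : J → CommRingCat.{u}
  pt : ∀ i, F.obj (R i)
  injective : ∀ (i : J) {A : CommRingCat.{u}} {g h : R i ⟶ A},
    F.map g (pt i) = F.map h (pt i) → g = h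
  D : ∀ i : J, J → R i
  isUnit_iff : ∀ (i j : J) {A : CommRingCat.{u}} (h : R i ⟶ A),
    IsUnit (h (D i j)) ↔ ∃ g : R j ⟶ A, F.map g (pt j) = F.map h (pt i)
  covering : IsZariskiCovering F pt

/-! ### The scheme glued from an atlas -/

/-- Morphisms to `Spec A` as homomorphisms from `A` to the ring of global functions. -/
def homSpecEquiv (Y : Scheme.{u}) (A : CommRingCat.{u}) : (Y ⟶ Spec A) ≃ (A ⟶ Γ(Y, ⊤)) where
  toFun a := (Scheme.ΓSpecIso A).inv ≫ a.appTop
  invFun f := Y.toSpecΓ ≫ Spec.map f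
  left_inv a := by
    dsimp only
    rw [Spec.map_comp, ← Scheme.toSpecΓ_naturality_assoc, toSpecΓ_SpecMap_ΓSpecIso_inv,
      Category.comp_id]
  right_inv f := by
    simp

theorem homSpecEquiv_apply {Y : Scheme.{u}} {A : CommRingCat.{u}} (a : Y ⟶ Spec A) :
    homSpecEquiv Y A a = (Scheme.ΓSpecIso A).inv ≫ a.appTop := rfl

theorem homSpecEquiv_comp {X Y : Scheme.{u}} {A : CommRingCat.{u}} (b : X ⟶ Y) (a : Y ⟶ Spec A) :
    homSpecEquiv X A (b ≫ a) = homSpecEquiv Y A a ≫ b.appTop := by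
  simp only [homSpecEquiv_apply, Scheme.Hom.comp_appTop, Category.assoc]

theorem homSpecEquiv_comp_specMap {Y : Scheme.{u}} {A B : CommRingCat.{u}} (a : Y ⟶ Spec B)
    (f : A ⟶ B) : homSpecEquiv Y A (a ≫ Spec.map f) = f ≫ homSpecEquiv Y B a := by
  simp only [homSpecEquiv_apply, Scheme.Hom.comp_appTop, Scheme.ΓSpecIso_inv_naturality_assoc]

theorem homSpecEquiv_specMap {A B : CommRingCat.{u}} (f : A ⟶ B) :
    homSpecEquiv (Spec B) A (Spec.map f) = f ≫ (Scheme.ΓSpecIso B).inv :=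
  (Scheme.ΓSpecIso_inv_naturality f).symm

/-- The functor of affine points `A ↦ Y(A)` of a scheme `Y`. -/
abbrev affinePoints (Y : Scheme.{u}) : CommRingCat.{u} ⥤ Type u :=
  Scheme.Spec.rightOp ⋙ yoneda.obj Y

theorem hom_ext_of_affinePoints {X Y : Scheme.{u}} {f g : X ⟶ Y}
    (h : ∀ (A : CommRingCat.{u}) (x : Spec A ⟶ X), x ≫ f = x ≫ g) : f = g :=
  X.affineCover.hom_ext _ _ fun i => h _ (X.affineCover.f i)

theorem exists_glue_of_affineOpenCover {X Y : Scheme.{u}} (𝒰 : Scheme.AffineOpenCover.{u} X)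
    (f : ∀ i, Spec (𝒰.X i) ⟶ Y)
    (hf : ∀ (i j : 𝒰.I₀) (B : CommRingCat.{u}) (a : 𝒰.X i ⟶ B) (b : 𝒰.X j ⟶ B),
      Spec.map a ≫ 𝒰.f i = Spec.map b ≫ 𝒰.f j → Spec.map a ≫ f i = Spec.map b ≫ f j) :
    ∃ q : X ⟶ Y, ∀ i, 𝒰.f i ≫ q = f i := by
  have h : ∀ i j : 𝒰.I₀,
      pullback.fst (𝒰.f i) (𝒰.f j) ≫ f i = pullback.snd (𝒰.f i) (𝒰.f j) ≫ f j := by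
    intro i j
    refine hom_ext_of_affinePoints fun B y => ?_
    obtain ⟨a, ha⟩ := Spec.map_surjective (y ≫ pullback.fst (𝒰.f i) (𝒰.f j))
    obtain ⟨b, hb⟩ := Spec.map_surjective (y ≫ pullback.snd (𝒰.f i) (𝒰.f j))
    rw [← Category.assoc, ← Category.assoc, ← ha, ← hb]
    apply hf
    rw [ha, hb, Category.assoc, Category.assoc, pullback.condition]
  exact ⟨𝒰.openCover.glueMorphisms f h, 𝒰.openCover.ι_glueMorphisms f h⟩

theorem isZariskiSheaf_affinePoints (Y : Scheme.{u}) : IsZariskiSheaf (affinePoints Y) where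
  separated f hf P Q h :=
    (Scheme.affineOpenCoverOfSpanRangeEqTop f hf).openCover.hom_ext P Q h
  glue f hf P h :=
    exists_glue_of_affineOpenCover (Scheme.affineOpenCoverOfSpanRangeEqTop f hf) P
      fun i j B g g' hg => h i j B g g' <|
        Spec.map_injective <| (Spec.map_comp _ _).trans (hg.trans (Spec.map_comp _ _).symm)

theorem exists_awayHom_comp_factors {X : Scheme.{u}} {A R : CommRingCat.{u}} (x : Spec A ⟶ X)
    (ι : Spec R ⟶ X) [IsOpenImmersion ι] {p : PrimeSpectrum A} (hp : x p ∈ Set.range ι) :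
    ∃ f ∉ p.asIdeal, ∃ h : R ⟶ CommRingCat.of (Localization.Away f),
      Spec.map (awayHom f) ≫ x = Spec.map h ≫ ι := by
  obtain ⟨_, ⟨_, ⟨f, rfl⟩, rfl⟩, hpf, hfU⟩ :=
    (PrimeSpectrum.isBasis_basic_opens (R := A)).exists_subset_of_mem_open
      (show p ∈ x ⁻¹ᵁ ι.opensRange from hp) (x ⁻¹ᵁ ι.opensRange).isOpen
  have hrange : Set.range (Spec.map (awayHom f) ≫ x) ⊆ Set.range ι := by
    rintro _ ⟨z, rfl⟩
    exact hfU (range_specMap_awayHom f ▸ ⟨z, rfl⟩)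
  obtain ⟨h, hh⟩ := Spec.map_surjective (IsOpenImmersion.lift ι _ hrange)
  exact ⟨f, hpf, h, by rw [hh, IsOpenImmersion.lift_fac]⟩

theorem isZariskiCovering_affineOpenCover {X : Scheme.{u}}
    (𝒰 : Scheme.AffineOpenCover.{u} X) : IsZariskiCovering (affinePoints X) 𝒰.f := by
  intro A (x : Spec A ⟶ _) p
  obtain ⟨f, hf, h, hh⟩ := exists_awayHom_comp_factors x (𝒰.f (𝒰.idx (x p))) (𝒰.covers (x p))
  exact ⟨f, hf, _, h, hh⟩

theorem exists_hom_of_natTrans {X Y : Scheme.{u}} (η : affinePoints X ⟶ affinePoints Y) :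
    ∃ q : X ⟶ Y, ∀ (A : CommRingCat.{u}) (x : Spec A ⟶ X), x ≫ q = η.app A x := by
  have hη {A B : CommRingCat.{u}} (g : A ⟶ B) (x : Spec A ⟶ X) :
      η.app B (Spec.map g ≫ x) = Spec.map g ≫ η.app A x :=
    NatTrans.naturality_apply η g x
  obtain ⟨q, hq⟩ := exists_glue_of_affineOpenCover X.affineOpenCover
    (fun i => η.app _ (X.affineOpenCover.f i))
    fun i j B a b hab => by rw [← hη, ← hη, hab]
  have hqη : Functor.whiskerLeft Scheme.Spec.rightOp (yoneda.map q) = η :=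
    (isZariskiCovering_affineOpenCover _).natTrans_ext (isZariskiSheaf_affinePoints Y) hq
  exact ⟨q, fun A x => by rw [← hqη]; rfl⟩

namespace AffineAtlas

variable {F : CommRingCat.{u} ⥤ Type u} (𝒜 : AffineAtlas F)

/-- The point of `F` over the global functions of `Y` given by a morphism from `Y` to a chart. -/
def chartPt (i : 𝒜.J) {Y : Scheme.{u}} (a : Y ⟶ Spec (𝒜.R i)) : F.obj Γ(Y, ⊤) :=
  F.map (homSpecEquiv Y _ a) (𝒜.pt i)

theorem chartPt_comp (i : 𝒜.J) {X Y : Scheme.{u}} (b : X ⟶ Y) (a : Y ⟶ Spec (𝒜.R i)) :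
    𝒜.chartPt i (b ≫ a) = F.map b.appTop (𝒜.chartPt i a) := by
  simp only [chartPt, homSpecEquiv_comp, Functor.map_comp_apply]

theorem chartPt_specMap (i : 𝒜.J) {A : CommRingCat.{u}} (f : 𝒜.R i ⟶ A) :
    𝒜.chartPt i (Spec.map f) = F.map (Scheme.ΓSpecIso A).inv (F.map f (𝒜.pt i)) := by
  simp only [chartPt, homSpecEquiv_specMap, Functor.map_comp_apply]

theorem chartPt_injective (i : 𝒜.J) {Y : Scheme.{u}} {a b : Y ⟶ Spec (𝒜.R i)}
    (h : 𝒜.chartPt i a = 𝒜.chartPt i b) : a = b :=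
  (homSpecEquiv Y _).injective (𝒜.injective i h)

theorem chartPt_specMap_eq_iff {i j : 𝒜.J} {A : CommRingCat.{u}} (g : 𝒜.R i ⟶ A)
    (h : 𝒜.R j ⟶ A) : 𝒜.chartPt i (Spec.map g) = 𝒜.chartPt j (Spec.map h) ↔
      F.map g (𝒜.pt i) = F.map h (𝒜.pt j) := by
  rw [chartPt_specMap, chartPt_specMap]
  refine ⟨fun H => ?_, congrArg _⟩
  simpa only [← Functor.map_comp_apply, Category.assoc, Iso.inv_hom_id,
    Category.comp_id] using
    congrArg (F.map (Scheme.ΓSpecIso A).hom) H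

/-- The inclusion of the overlap of the charts `i` and `j` into the chart `i`. -/
abbrev overlapι (i j : 𝒜.J) :
    Spec (CommRingCat.of (Localization.Away (𝒜.D i j))) ⟶ Spec (𝒜.R i) :=
  Spec.map (awayHom (𝒜.D i j))

theorem exists_lift_overlapι {i j : 𝒜.J} {Y : Scheme.{u}} {a : Y ⟶ Spec (𝒜.R i)}
    {b : Y ⟶ Spec (𝒜.R j)} (h : 𝒜.chartPt i a = 𝒜.chartPt j b) :
    ∃ l, l ≫ 𝒜.overlapι i j = a := by
  have hu : IsUnit (homSpecEquiv Y _ a (𝒜.D i j)) :=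
    (𝒜.isUnit_iff i j _).2 ⟨homSpecEquiv Y _ b, h.symm⟩
  let f : CommRingCat.of (Localization.Away (𝒜.D i j)) ⟶ Γ(Y, ⊤) :=
    CommRingCat.ofHom (IsLocalization.Away.lift (𝒜.D i j) hu)
  refine ⟨(homSpecEquiv Y _).symm f, (homSpecEquiv Y _).injective ?_⟩
  rw [homSpecEquiv_comp_specMap, Equiv.apply_symm_apply]
  exact CommRingCat.hom_ext (IsLocalization.Away.lift_comp _ hu)

theorem exists_transition (i j : 𝒜.J) :
    ∃ t : Spec (CommRingCat.of (Localization.Away (𝒜.D i j))) ⟶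
        Spec (CommRingCat.of (Localization.Away (𝒜.D j i))),
      𝒜.chartPt j (t ≫ 𝒜.overlapι j i) = 𝒜.chartPt i (𝒜.overlapι i j) := by
  obtain ⟨g, hg⟩ := (𝒜.isUnit_iff i j (awayHom (𝒜.D i j))).1
    (IsLocalization.Away.algebraMap_isUnit _)
  have hb := (𝒜.chartPt_specMap_eq_iff g (awayHom (𝒜.D i j))).2 hg
  obtain ⟨t, ht⟩ := 𝒜.exists_lift_overlapι hb
  exact ⟨t, by rw [ht, hb]⟩

/-- The transition map from the overlap in the chart `i` to the overlap in the chart `j`. -/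
def transition (i j : 𝒜.J) :
    Spec (CommRingCat.of (Localization.Away (𝒜.D i j))) ⟶
      Spec (CommRingCat.of (Localization.Away (𝒜.D j i))) :=
  (𝒜.exists_transition i j).choose

theorem chartPt_transition (i j : 𝒜.J) {Y : Scheme.{u}}
    (l : Y ⟶ Spec (CommRingCat.of (Localization.Away (𝒜.D i j)))) :
    𝒜.chartPt j (l ≫ 𝒜.transition i j ≫ 𝒜.overlapι j i) = 𝒜.chartPt i (l ≫ 𝒜.overlapι i j) := by
  rw [𝒜.chartPt_comp j l, 𝒜.chartPt_comp i l]
  exact congrArg _ (𝒜.exists_transition i j).choose_spec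

theorem exists_transition₃ (i j l : 𝒜.J) :
    ∃ t : pullback (𝒜.overlapι i j) (𝒜.overlapι i l) ⟶
      pullback (𝒜.overlapι j l) (𝒜.overlapι j i),
      t ≫ pullback.snd _ _ = pullback.fst _ _ ≫ 𝒜.transition i j := by
  obtain ⟨m, hm⟩ := 𝒜.exists_lift_overlapι (i := j) (j := l)
    (a := pullback.fst (𝒜.overlapι i j) (𝒜.overlapι i l) ≫ 𝒜.transition i j ≫ 𝒜.overlapι j i)
    (b := pullback.snd (𝒜.overlapι i j) (𝒜.overlapι i l) ≫ 𝒜.transition i l ≫ 𝒜.overlapι l i)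
    (by rw [chartPt_transition, chartPt_transition, pullback.condition])
  exact ⟨pullback.lift m (pullback.fst _ _ ≫ 𝒜.transition i j) (by rw [hm, Category.assoc]),
    pullback.lift_snd _ _ _⟩

/-- The transition maps on triple overlaps. -/
def transition₃ (i j l : 𝒜.J) :
    pullback (𝒜.overlapι i j) (𝒜.overlapι i l) ⟶ pullback (𝒜.overlapι j l) (𝒜.overlapι j i) :=
  (𝒜.exists_transition₃ i j l).choose

theorem transition₃_snd (i j l : 𝒜.J) :
    𝒜.transition₃ i j l ≫ pullback.snd _ _ = pullback.fst _ _ ≫ 𝒜.transition i j :=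
  (𝒜.exists_transition₃ i j l).choose_spec

theorem chartPt_transition₃ (i j l : 𝒜.J) {Y : Scheme.{u}}
    (a : Y ⟶ pullback (𝒜.overlapι i j) (𝒜.overlapι i l)) :
    𝒜.chartPt j ((a ≫ 𝒜.transition₃ i j l) ≫ pullback.fst _ _ ≫ 𝒜.overlapι j l) =
      𝒜.chartPt i (a ≫ pullback.fst _ _ ≫ 𝒜.overlapι i j) := by
  rw [pullback.condition, Category.assoc, reassoc_of% 𝒜.transition₃_snd i j l,
    ← Category.assoc, chartPt_transition, Category.assoc]

/-- The glueing data of the charts: by injectivity of the charts, the cocycle condition only has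
to be checked on points of `F`, where every transition map is the identity. -/
def glueData : Scheme.GlueData.{u} where
  J := 𝒜.J
  U i := Spec (𝒜.R i)
  V p := Spec (CommRingCat.of (Localization.Away (𝒜.D p.1 p.2)))
  f i j := 𝒜.overlapι i j
  f_id i := by
    obtain ⟨l, hl⟩ := 𝒜.exists_lift_overlapι (rfl : 𝒜.chartPt i (𝟙 _) = 𝒜.chartPt i (𝟙 _))
    refine ⟨l, ?_, hl⟩
    rw [← cancel_mono (𝒜.overlapι i i), Category.assoc, hl, Category.comp_id, Category.id_comp]
  t := 𝒜.transition
  t_id i := by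
    rw [← cancel_mono (𝒜.overlapι i i)]
    apply 𝒜.chartPt_injective i
    simpa only [Category.id_comp] using 𝒜.chartPt_transition i i (𝟙 _)
  t' := 𝒜.transition₃
  t_fac := 𝒜.transition₃_snd
  cocycle i j l := by
    rw [← cancel_mono (pullback.fst _ _), ← cancel_mono (𝒜.overlapι i j)]
    apply 𝒜.chartPt_injective i
    have hli := 𝒜.chartPt_transition₃ l i j (𝒜.transition₃ i j l ≫ 𝒜.transition₃ j l i)
    have hjl := 𝒜.chartPt_transition₃ j l i (𝒜.transition₃ i j l)
    have hij := 𝒜.chartPt_transition₃ i j l (𝟙 _)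
    simp only [Category.id_comp, Category.assoc] at hli hjl hij ⊢
    rw [hli, hjl, hij]
  f_open i j := inferInstance

/-- The scheme glued from the charts of an atlas. -/
def scheme : Scheme.{u} := 𝒜.glueData.glued

/-- The inclusion of a chart into the glued scheme. -/
def chartι (i : 𝒜.J) : Spec (𝒜.R i) ⟶ 𝒜.scheme := 𝒜.glueData.ι i

instance isOpenImmersion_chartι (i : 𝒜.J) : IsOpenImmersion (𝒜.chartι i) :=
  Scheme.GlueData.ι_isOpenImmersion 𝒜.glueData i

theorem exists_chartι_eq (z : 𝒜.scheme) : ∃ (i : 𝒜.J) (y : _), 𝒜.chartι i y = z :=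
  𝒜.glueData.ι_jointly_surjective z

theorem chartPt_eq_of_comp_chartι_eq {i j : 𝒜.J} {Y : Scheme.{u}} {a : Y ⟶ Spec (𝒜.R i)}
    {b : Y ⟶ Spec (𝒜.R j)} (h : a ≫ 𝒜.chartι i = b ≫ 𝒜.chartι j) :
    𝒜.chartPt i a = 𝒜.chartPt j b := by
  have hlim := 𝒜.glueData.vPullbackConeIsLimit i j
  obtain ⟨l, hla, hlb⟩ := PullbackCone.IsLimit.lift' hlim a b h
  rw [← hla, ← hlb]
  exact (𝒜.chartPt_transition i j l).symm

theorem comp_chartι_eq_of_chartPt_eq {i j : 𝒜.J} {Y : Scheme.{u}} {a : Y ⟶ Spec (𝒜.R i)}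
    {b : Y ⟶ Spec (𝒜.R j)} (h : 𝒜.chartPt i a = 𝒜.chartPt j b) :
    a ≫ 𝒜.chartι i = b ≫ 𝒜.chartι j := by
  obtain ⟨l, rfl⟩ := 𝒜.exists_lift_overlapι h
  obtain rfl := 𝒜.chartPt_injective j ((𝒜.chartPt_transition i j l).trans h)
  simp only [Category.assoc]
  congr 1
  exact (𝒜.glueData.glue_condition i j).symm

theorem comp_chartι_eq_iff {i j : 𝒜.J} {A : CommRingCat.{u}} (g : 𝒜.R i ⟶ A) (h : 𝒜.R j ⟶ A) :
    Spec.map g ≫ 𝒜.chartι i = Spec.map h ≫ 𝒜.chartι j ↔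
      F.map g (𝒜.pt i) = F.map h (𝒜.pt j) :=
  ⟨fun H => (𝒜.chartPt_specMap_eq_iff g h).1 (𝒜.chartPt_eq_of_comp_chartι_eq H),
    fun H => 𝒜.comp_chartι_eq_of_chartPt_eq ((𝒜.chartPt_specMap_eq_iff g h).2 H)⟩

theorem isZariskiCovering_chartι : IsZariskiCovering (affinePoints 𝒜.scheme) 𝒜.chartι := by
  intro A (x : Spec A ⟶ _) p
  obtain ⟨i, hi⟩ := 𝒜.exists_chartι_eq (x p)
  obtain ⟨f, hf, h, hh⟩ := exists_awayHom_comp_factors x (𝒜.chartι i) hi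
  exact ⟨f, hf, i, h, hh⟩

theorem exists_natIso_affinePoints (hF : IsZariskiSheaf F) :
    ∃ η : affinePoints 𝒜.scheme ≅ F, ∀ i, η.hom.app _ (𝒜.chartι i) = 𝒜.pt i :=
  𝒜.isZariskiCovering_chartι.exists_natIso 𝒜.covering (isZariskiSheaf_affinePoints _) hF
    fun _ _ _ g h => 𝒜.comp_chartι_eq_iff g h

end AffineAtlas

/-! ### Extension of scalars of submodules of `A ^ n` -/

section ExtendSub

open TensorProduct

variable {A B C : Type u} [CommRing A] [CommRing B] [CommRing C] {n : ℕ}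

theorem extendSub_le_iff (f : A →+* B) (N : Submodule A (Fin n → A))
    (M : Submodule B (Fin n → B)) : extendSub f N ≤ M ↔ ∀ v ∈ N, f ∘ v ∈ M := by
  simp only [extendSub, Submodule.span_le, Set.image_subset_iff]
  rfl

theorem comp_mem_extendSub (f : A →+* B) {N : Submodule A (Fin n → A)} {v : Fin n → A}
    (hv : v ∈ N) : f ∘ v ∈ extendSub f N :=
  Submodule.subset_span ⟨v, hv, rfl⟩

theorem extendSub_mono (f : A →+* B) {N M : Submodule A (Fin n → A)} (h : N ≤ M) :
    extendSub f N ≤ extendSub f M :=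
  (extendSub_le_iff _ _ _).2 fun _ hv => comp_mem_extendSub f (h hv)

theorem extendSub_id (N : Submodule A (Fin n → A)) : extendSub (RingHom.id A) N = N :=
  le_antisymm ((extendSub_le_iff _ _ _).2 fun _ hv => hv) fun _ hv =>
    comp_mem_extendSub (RingHom.id A) hv

theorem map_extendSub_eq_range_lTensor [Algebra A B] (N : Submodule A (Fin n → A)) :
    LinearMap.range (AlgebraTensorModule.lTensor B B (N.subtype.restrictScalars A)) =
      (extendSub (algebraMap A B) N).map
        (TensorProduct.piScalarRight A B B (Fin n)).symm.toLinearMap := by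
  have himage (v : Fin n → A) :
      (TensorProduct.piScalarRight A B B (Fin n)).symm (algebraMap A B ∘ v) = 1 ⊗ₜ[A] v := by
    rw [LinearEquiv.symm_apply_eq]
    ext i
    simp [Algebra.smul_def]
  apply le_antisymm
  · rintro _ ⟨x, rfl⟩
    induction x with
    | zero => simp
    | add x y hx hy => rw [map_add]; exact Submodule.add_mem _ hx hy
    | tmul b v =>
      refine ⟨b • (algebraMap A B ∘ v.1),
        Submodule.smul_mem _ _ (comp_mem_extendSub _ v.2), ?_⟩
      simp [himage, smul_tmul']
  · rw [Submodule.map_le_iff_le_comap, extendSub_le_iff]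
    intro v hv
    exact ⟨1 ⊗ₜ ⟨v, hv⟩, (himage v).symm⟩

/-- Extension of scalars commutes with the formation of the quotient of `A ^ n`. -/
def quotientExtendSubEquiv [Algebra A B] (N : Submodule A (Fin n → A)) :
    ((Fin n → B) ⧸ extendSub (algebraMap A B) N) ≃ₗ[B] B ⊗[A] ((Fin n → A) ⧸ N) :=
  (Submodule.Quotient.equiv _ _ (TensorProduct.piScalarRight A B B (Fin n)).symm
    (map_extendSub_eq_range_lTensor N).symm).trans
    (AlgebraTensorModule.tensorQuotientEquiv B A B N).symm

theorem range_toLin'_eq_span {m : ℕ} (M : Matrix (Fin n) (Fin m) A) :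
    LinearMap.range (Matrix.toLin' M) = Submodule.span A (Set.range fun j i => M i j) := by
  rw [Matrix.range_toLin']
  rfl

theorem extendSub_span (f : A →+* B) (s : Set (Fin n → A)) :
    extendSub f (Submodule.span A s) = Submodule.span B ((f ∘ ·) '' s) := by
  algebraize [f]
  refine le_antisymm ?_ (Submodule.span_mono (Set.image_mono Submodule.subset_span))
  let F : (Fin n → A) →ₗ[A] (Fin n → B) := (Algebra.linearMap A B).compLeft (Fin n)
  rw [extendSub_le_iff]
  exact (Submodule.span_le (p := ((Submodule.span B (F '' s)).restrictScalars A).comap F)).2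
    fun v hv => Submodule.subset_span ⟨v, hv, rfl⟩

theorem extendSub_comp (f : A →+* B) (g : B →+* C) (N : Submodule A (Fin n → A)) :
    extendSub (g.comp f) N = extendSub g (extendSub f N) := by
  rw [extendSub, extendSub.eq_1 f N, extendSub_span, Set.image_image]
  rfl

theorem extendSub_range (f : A →+* B) {m : ℕ} (M : Matrix (Fin n) (Fin m) A) :
    extendSub f (LinearMap.range (Matrix.toLin' M)) =
      LinearMap.range (Matrix.toLin' (M.map f)) := by
  rw [range_toLin'_eq_span, range_toLin'_eq_span, extendSub_span, ← Set.range_comp]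
  rfl

end ExtendSub

section ProjectiveQuotient

open TensorProduct

variable {A B : Type u} [CommRing A] [CommRing B] {n : ℕ} (N : Submodule A (Fin n → A))
  [Module.Projective A ((Fin n → A) ⧸ N)]

theorem exists_leftInverse_subtype :
    ∃ π : (Fin n → A) →ₗ[A] N, π ∘ₗ N.subtype = LinearMap.id := by
  obtain ⟨s, hs⟩ := Module.projective_lifting_property N.mkQ LinearMap.id
    (Submodule.mkQ_surjective N)
  have hsplit : (∃ l, N.mkQ ∘ₗ l = LinearMap.id) ↔ ∃ l, l ∘ₗ N.subtype = LinearMap.id :=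
    ((LinearMap.exact_subtype_mkQ N).split_tfae N.subtype_injective
      (Submodule.mkQ_surjective N)).out 0 1
  exact hsplit.1 ⟨s, hs⟩

theorem projective_of_projective_quotient : Module.Projective A N := by
  obtain ⟨π, hπ⟩ := exists_leftInverse_subtype N
  exact Module.Projective.of_split _ _ hπ

theorem finite_of_projective_quotient : Module.Finite A N := by
  obtain ⟨π, hπ⟩ := exists_leftInverse_subtype N
  exact Module.Finite.of_surjective π fun v => ⟨v, LinearMap.congr_fun hπ v⟩

theorem projective_quotient_extendSub (f : A →+* B) :
    Module.Projective B ((Fin n → B) ⧸ extendSub f N) := by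
  algebraize [f]
  exact Module.Projective.of_equiv (quotientExtendSubEquiv N).symm

theorem injective_lTensor_subtype [Algebra A B] :
    Function.Injective (AlgebraTensorModule.lTensor B B (N.subtype.restrictScalars A)) := by
  obtain ⟨π, hπ⟩ := exists_leftInverse_subtype N
  refine Function.LeftInverse.injective (g := π.baseChange B) fun x => ?_
  change (π.baseChange B ∘ₗ N.subtype.baseChange B) x = x
  rw [← LinearMap.baseChange_comp, hπ, LinearMap.baseChange_id, LinearMap.id_apply]

theorem rankAtStalk_extendSub (f : A →+* B) (p : PrimeSpectrum B) :
    Module.rankAtStalk (extendSub f N) p = Module.rankAtStalk N (PrimeSpectrum.comap f p) := by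
  algebraize [f]
  have := projective_of_projective_quotient N
  have := finite_of_projective_quotient N
  have e : B ⊗[A] N ≃ₗ[B] extendSub f N :=
    (LinearEquiv.ofInjective _ (injective_lTensor_subtype N)).trans <|
      (LinearEquiv.ofEq _ _ (map_extendSub_eq_range_lTensor N)).trans
        (LinearEquiv.submoduleMap _ _).symm
  rw [← Module.rankAtStalk_eq_of_equiv e, Module.rankAtStalk_baseChange]
  rfl

end ProjectiveQuotient

section Localization

variable {A B : Type u} [CommRing A] [CommRing B] [Algebra A B] {n : ℕ}

instance isLocalizedModule_compLeft (S : Submonoid A) [IsLocalization S B] :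
    IsLocalizedModule S ((Algebra.linearMap A B).compLeft (Fin n)) :=
  IsLocalizedModule.pi S fun _ => Algebra.linearMap A B

theorem extendSub_algebraMap_eq_localized' (S : Submonoid A) [IsLocalization S B]
    (N : Submodule A (Fin n → A)) : extendSub (algebraMap A B) N =
      N.localized' B S ((Algebra.linearMap A B).compLeft (Fin n)) := by
  rw [Submodule.localized'_eq_span]
  rfl

theorem exists_pow_smul_mem_of_comp_mem_extendSub (s : A) [IsLocalization.Away s B]
    {N : Submodule A (Fin n → A)} {v : Fin n → A}
    (hv : algebraMap A B ∘ v ∈ extendSub (algebraMap A B) N) : ∃ m : ℕ, s ^ m • v ∈ N := by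
  rw [extendSub_algebraMap_eq_localized' (.powers s), Submodule.mem_localized'] at hv
  obtain ⟨w, hw, ⟨_, a, rfl⟩, h⟩ := hv
  rw [IsLocalizedModule.mk'_eq_iff] at h
  obtain ⟨⟨_, b, rfl⟩, hb⟩ := IsLocalizedModule.exists_of_eq (S := .powers s)
    (f := (Algebra.linearMap A B).compLeft (Fin n)) (x₁ := w) (x₂ := s ^ a • v)
    (by rw [map_smul]; exact h)
  refine ⟨b + a, ?_⟩
  rw [pow_add, mul_smul]
  exact (show s ^ b • w = s ^ b • s ^ a • v from hb) ▸ N.smul_mem _ hw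

theorem exists_pow_smul_eq_comp (s : A) [IsLocalization.Away s B] (w : Fin n → B) :
    ∃ (m : ℕ) (v : Fin n → A), s ^ m • w = algebraMap A B ∘ v := by
  obtain ⟨⟨v, ⟨_, m, rfl⟩⟩, h⟩ := IsLocalizedModule.surj (.powers s)
    ((Algebra.linearMap A B).compLeft (Fin n)) w
  exact ⟨m, v, h⟩

theorem le_of_extendSub_le {ι : Type*} {f : ι → A} (hf : Ideal.span (Set.range f) = ⊤)
    {N M : Submodule A (Fin n → A)}
    (h : ∀ i, extendSub (algebraMap A (Localization.Away (f i))) N ≤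
      extendSub (algebraMap A (Localization.Away (f i))) M) : N ≤ M := by
  intro v hv
  refine Submodule.mem_of_span_eq_top_of_smul_pow_mem M _ hf v ?_
  rintro ⟨_, i, rfl⟩
  exact exists_pow_smul_mem_of_comp_mem_extendSub (f i) (h i (comp_mem_extendSub _ hv))

theorem fg_of_extendSub_fg {ι : Type*} {f : ι → A} (hf : Ideal.span (Set.range f) = ⊤)
    {M : Submodule A (Fin n → A)}
    (h : ∀ i, (extendSub (algebraMap A (Localization.Away (f i))) M).FG) : M.FG := by
  refine M.of_localizationSpan' _ hf (Rₚ := fun g => Localization.Away g.1)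
    (fun g => (Algebra.linearMap A (Localization.Away g.1)).compLeft (Fin n)) ?_
  rintro ⟨_, i, rfl⟩
  rw [← extendSub_algebraMap_eq_localized']
  exact h i

end Localization

/-! ### Gluing of submodules -/

section Glue

variable {A : Type u} [CommRing A] {n : ℕ} {ι : Type*} (f : ι → A)
  (N : (i : ι) → Submodule (Localization.Away (f i)) (Fin n → Localization.Away (f i)))

/-- A family of submodules over the localizations at `f i` is compatible if its members have the
same extension of scalars to every common algebra of two of the localizations. -/
def IsCompatible : Prop :=
  ∀ (i j : ι) (B : Type u) [CommRing B] (g : Localization.Away (f i) →+* B)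
    (h : Localization.Away (f j) →+* B),
    g.comp (algebraMap A _) = h.comp (algebraMap A _) → extendSub g (N i) = extendSub h (N j)

/-- The submodule of `A ^ n` consisting of the vectors whose images lie in all the `N j`, `j ∈ t`;
for a finite set `t` with `f` generating the unit ideal on it, it glues a compatible family. -/
def gluedSub (t : Finset ι) : Submodule A (Fin n → A) :=
  ⨅ j ∈ t, ((N j).restrictScalars A).comap ((Algebra.linearMap A _).compLeft (Fin n))

variable {f N}

theorem mem_gluedSub {t : Finset ι} {v : Fin n → A} :
    v ∈ gluedSub f N t ↔ ∀ j ∈ t, algebraMap A (Localization.Away (f j)) ∘ v ∈ N j := by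
  simp only [gluedSub, Submodule.mem_iInf]
  rfl

theorem smul_comp_mem_of_comp_mem {B : Type u} [CommRing B] [Algebra A B]
    {M : Submodule B (Fin n → B)} {v : Fin n → A} (hv : algebraMap A B ∘ v ∈ M) (a : A) :
    algebraMap A B ∘ (a • v) ∈ M :=
  ((M.restrictScalars A).comap ((Algebra.linearMap A B).compLeft (Fin n))).smul_mem a hv

theorem IsCompatible.exists_pow_smul_comp_mem (hN : IsCompatible f N) (i j : ι) {v : Fin n → A}
    (hv : algebraMap A (Localization.Away (f i)) ∘ v ∈ N i) :
    ∃ m : ℕ, algebraMap A (Localization.Away (f j)) ∘ (f i ^ m • v) ∈ N j := by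
  let s := algebraMap A (Localization.Away (f j)) (f i)
  let h : Localization.Away (f j) →+* Localization.Away s := algebraMap _ _
  have hunit : IsUnit (h.comp (algebraMap A _) (f i)) := IsLocalization.Away.algebraMap_isUnit s
  let g : Localization.Away (f i) →+* Localization.Away s := IsLocalization.Away.lift (f i) hunit
  have hgh : g.comp (algebraMap A _) = h.comp (algebraMap A _) :=
    IsLocalization.Away.lift_comp (f i) hunit
  have hmem : g ∘ algebraMap A _ ∘ v ∈ extendSub h (N j) :=
    hN i j _ g h hgh ▸ comp_mem_extendSub g hv
  have hcomp : g ∘ algebraMap A _ ∘ v = h ∘ algebraMap A _ ∘ v :=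
    funext fun l => RingHom.congr_fun hgh (v l)
  obtain ⟨m, hm⟩ := exists_pow_smul_mem_of_comp_mem_extendSub s (hcomp ▸ hmem)
  refine ⟨m, ?_⟩
  convert hm using 1
  ext l
  simp [s]

theorem IsCompatible.extendSub_gluedSub_le (hN : IsCompatible f N) {t : Finset ι}
    (ht : Ideal.span (f '' t) = ⊤) (i : ι) :
    extendSub (algebraMap A (Localization.Away (f i))) (gluedSub f N t) ≤ N i := by
  rw [extendSub_le_iff]
  intro v hv
  have hspan : Ideal.span (algebraMap A (Localization.Away (f i)) '' (f '' t)) = ⊤ := by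
    rw [← Ideal.map_span, ht, Ideal.map_top]
  refine Submodule.mem_of_span_eq_top_of_smul_pow_mem _ _ hspan _ ?_
  rintro ⟨_, _, ⟨j, hj, rfl⟩, rfl⟩
  obtain ⟨m, hm⟩ := hN.exists_pow_smul_comp_mem j i (mem_gluedSub.1 hv j hj)
  refine ⟨m, ?_⟩
  convert hm using 1
  ext l
  simp

theorem IsCompatible.exists_pow_smul_mem_gluedSub (hN : IsCompatible f N) (t : Finset ι) (i : ι)
    {v : Fin n → A} (hv : algebraMap A (Localization.Away (f i)) ∘ v ∈ N i) :
    ∃ m : ℕ, f i ^ m • v ∈ gluedSub f N t := by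
  choose m hm using fun j => hN.exists_pow_smul_comp_mem i j hv
  refine ⟨∑ j ∈ t, m j, mem_gluedSub.2 fun j hj => ?_⟩
  obtain ⟨d, hd⟩ := Nat.exists_eq_add_of_le
    (Finset.single_le_sum (f := m) (fun _ _ => Nat.zero_le _) hj)
  rw [hd, add_comm, pow_add, mul_smul]
  exact smul_comp_mem_of_comp_mem (hm j) _

theorem IsCompatible.le_extendSub_gluedSub (hN : IsCompatible f N) (t : Finset ι) (i : ι) :
    N i ≤ extendSub (algebraMap A (Localization.Away (f i))) (gluedSub f N t) := by
  intro w hw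
  obtain ⟨a, v, hv⟩ := exists_pow_smul_eq_comp (f i) w
  obtain ⟨m, hm⟩ := hN.exists_pow_smul_mem_gluedSub t i (v := v)
    (hv ▸ ((N i).restrictScalars A).smul_mem _ hw)
  have hunit : IsUnit (algebraMap A (Localization.Away (f i)) (f i ^ (m + a))) := by
    rw [map_pow]
    exact (IsLocalization.Away.algebraMap_isUnit (f i)).pow _
  rw [← Submodule.smul_mem_iff_of_isUnit _ hunit]
  convert comp_mem_extendSub (algebraMap A (Localization.Away (f i))) hm using 1
  ext l
  simpa [pow_add, mul_assoc, Algebra.smul_def] using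
    congrArg (algebraMap A (Localization.Away (f i)) (f i) ^ m * ·) (congrFun hv l)

theorem IsCompatible.exists_extendSub_eq (hN : IsCompatible f N)
    (hf : Ideal.span (Set.range f) = ⊤) :
    ∃ M : Submodule A (Fin n → A),
      ∀ i, extendSub (algebraMap A (Localization.Away (f i))) M = N i := by
  classical
  obtain ⟨s, hs, hspan⟩ := (Ideal.span_eq_top_iff_finite _).1 hf
  obtain ⟨t, -, ht⟩ := Finset.subset_set_image_iff.1
    (show (s : Set A) ⊆ f '' Set.univ by rwa [Set.image_univ])
  have ht : Ideal.span (f '' t) = ⊤ := by rw [← hspan, ← ht, Finset.coe_image]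
  exact ⟨gluedSub f N t, fun i =>
    le_antisymm (hN.extendSub_gluedSub_le ht i) (hN.le_extendSub_gluedSub t i)⟩

end Glue

/-! ### Points of Grassmannians -/

namespace Gr

variable {A B : Type u} [CommRing A] [CommRing B] {r n : ℕ}

instance (N : Gr A r n) : Module.Projective A ((Fin n → A) ⧸ N.sub) := N.projective_quotient

instance (N : Gr A r n) : Module.Projective A N.sub := projective_of_projective_quotient N.sub

instance (N : Gr A r n) : Module.Finite A N.sub := finite_of_projective_quotient N.sub

/-- Base change of a point of the Grassmannian. -/
def map (f : A →+* B) (N : Gr A r n) : Gr B r n where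
  sub := extendSub f N.sub
  projective_quotient := projective_quotient_extendSub N.sub f
  rank_eq p := by rw [rankAtStalk_extendSub, N.rank_eq]

theorem bijective_domRestrict_of_map_eq_top (N : Gr A r n)
    (g : (Fin n → A) →ₗ[A] (Fin r → A)) (hg : N.sub.map g = ⊤) :
    Function.Bijective (g.domRestrict N.sub) := by
  refine Module.bijective_of_surjective_of_rankAtStalk_eq ?_ fun m _ => ?_
  · rw [← LinearMap.range_eq_top, LinearMap.range_domRestrict, hg]
  · have := PrimeSpectrum.nontrivial (⟨m, inferInstance⟩ : PrimeSpectrum A)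
    rw [N.rank_eq, Module.rankAtStalk_eq_finrank_of_free]
    simp

theorem eq_of_le_of_map_eq_top (N : Gr A r n) (g : (Fin n → A) →ₗ[A] (Fin r → A))
    {M : Submodule A (Fin n → A)} (hM : M ≤ N.sub) (hg : M.map g = ⊤) : N.sub = M := by
  refine le_antisymm (fun v hv => ?_) hM
  have hgN : N.sub.map g = ⊤ := top_le_iff.1 (hg ▸ Submodule.map_mono hM)
  obtain ⟨w, hw, hwv⟩ := (hg ▸ Submodule.mem_top : g v ∈ M.map g)
  have hvw : w = v := congrArg Subtype.val
    ((N.bijective_domRestrict_of_map_eq_top g hgN).1 (a₁ := ⟨w, hM hw⟩) (a₂ := ⟨v, hv⟩) hwv)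
  exact hvw ▸ hw

theorem projective_quotient_of_extendSub {ι : Type*} {f : ι → A}
    (hf : Ideal.span (Set.range f) = ⊤) {M : Submodule A (Fin n → A)} (hM : M.FG)
    (hproj : ∀ i, Module.Projective (Localization.Away (f i))
      ((Fin n → _) ⧸ extendSub (algebraMap A (Localization.Away (f i))) M)) :
    Module.Projective A ((Fin n → A) ⧸ M) := by
  have : Module.FinitePresentation A ((Fin n → A) ⧸ M) :=
    Module.finitePresentation_of_free_of_surjective M.mkQ (Submodule.mkQ_surjective M)
      (by rwa [Submodule.ker_mkQ])
  rw [← Module.freeLocus_eq_univ_iff, ← Set.univ_subset_iff, ← TopologicalSpace.Opens.coe_top,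
    ← PrimeSpectrum.iSup_basicOpen_eq_top_iff.2 hf, TopologicalSpace.Opens.coe_iSup,
    Set.iUnion_subset_iff]
  intro i
  have := hproj i
  exact Module.basicOpen_subset_freeLocus_iff.2 <| Module.Projective.of_equiv <|
    (quotientExtendSubEquiv M).trans
      (LocalizedModule.equivTensorProduct (Submonoid.powers (f i)) ((Fin n → A) ⧸ M)).symm

theorem exists_map_eq {ι : Type*} {f : ι → A} (hf : Ideal.span (Set.range f) = ⊤)
    (N : (i : ι) → Gr (Localization.Away (f i)) r n) (hN : IsCompatible f fun i => (N i).sub) :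
    ∃ M : Gr A r n, ∀ i, M.map (algebraMap A (Localization.Away (f i))) = N i := by
  obtain ⟨M, hM⟩ := hN.exists_extendSub_eq hf
  have hfg : M.FG := fg_of_extendSub_fg hf fun i => by
    rw [hM]
    exact Module.Finite.iff_fg.1 inferInstance
  have hproj : Module.Projective A ((Fin n → A) ⧸ M) :=
    projective_quotient_of_extendSub hf hfg fun i => by rw [hM]; infer_instance
  refine ⟨⟨M, hproj, fun p => ?_⟩, fun i => Gr.ext (hM i)⟩
  obtain ⟨i, hi⟩ : ∃ i, p ∈ PrimeSpectrum.basicOpen (f i) := by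
    rw [← TopologicalSpace.Opens.mem_iSup, PrimeSpectrum.iSup_basicOpen_eq_top_iff.2 hf]
    trivial
  obtain ⟨q, rfl⟩ : p ∈ Set.range (PrimeSpectrum.comap
      (algebraMap A (Localization.Away (f i)))) := by
    rwa [PrimeSpectrum.localization_away_comap_range (Localization.Away (f i)) (f i)]
  rw [← rankAtStalk_extendSub, hM, (N i).rank_eq]

end Gr

/-! ### Matrices mapping a submodule onto a free module -/

/-- The matrix `G` maps the submodule `N` of `A ^ n` onto `A ^ r`. For the projection `G` to a set
of coordinates, this is the open condition defining a chart of the Grassmannian. -/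
def MapsOnto {A : Type u} [CommRing A] {r n : ℕ} (G : Matrix (Fin r) (Fin n) A)
    (N : Submodule A (Fin n → A)) : Prop :=
  N.map (Matrix.toLin' G) = ⊤

section Matrix

variable {A B K : Type u} [CommRing A] [CommRing B] [Field K] {r n m : ℕ}

theorem toLin'_map_comp (f : A →+* B) (G : Matrix (Fin r) (Fin n) A) (v : Fin n → A) :
    Matrix.toLin' (G.map f) (f ∘ v) = f ∘ Matrix.toLin' G v :=
  funext fun i => (f.map_mulVec G v i).symm

theorem map_extendSub (f : A →+* B) (G : Matrix (Fin r) (Fin n) A)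
    (N : Submodule A (Fin n → A)) :
    (extendSub f N).map (Matrix.toLin' (G.map f)) = extendSub f (N.map (Matrix.toLin' G)) := by
  rw [extendSub, extendSub, Submodule.map_span, Set.image_image, Submodule.map_coe,
    Set.image_image]
  exact congrArg _ (Set.image_congr fun v _ => toLin'_map_comp f G v)

theorem det_map (f : A →+* B) (M : Matrix (Fin r) (Fin r) A) : (M.map f).det = f M.det :=
  (f.map_det M).symm

theorem range_toLin'_eq_top_iff (M : Matrix (Fin r) (Fin r) A) :
    LinearMap.range (Matrix.toLin' M) = ⊤ ↔ IsUnit M.det := by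
  rw [← Matrix.isUnit_iff_isUnit_det, LinearMap.range_eq_top]
  exact Matrix.mulVec_surjective_iff_isUnit

theorem range_toLin'_mul_le (S : Matrix (Fin n) (Fin r) A) (Y : Matrix (Fin r) (Fin m) A) :
    LinearMap.range (Matrix.toLin' (S * Y)) ≤ LinearMap.range (Matrix.toLin' S) := by
  rw [Matrix.toLin'_mul]
  exact LinearMap.range_comp_le_range _ _

theorem range_toLin'_le_iff (S : Matrix (Fin n) (Fin r) A) (N : Submodule A (Fin n → A)) :
    LinearMap.range (Matrix.toLin' S) ≤ N ↔ ∀ j, (fun i => S i j) ∈ N := by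
  rw [range_toLin'_eq_span, Submodule.span_le, Set.range_subset_iff]
  rfl

theorem exists_eq_mul_of_range_le {S : Matrix (Fin n) (Fin r) A} {M : Matrix (Fin n) (Fin m) A}
    (h : LinearMap.range (Matrix.toLin' M) ≤ LinearMap.range (Matrix.toLin' S)) :
    ∃ Y : Matrix (Fin r) (Fin m) A, M = S * Y := by
  choose y hy using (range_toLin'_le_iff M _).1 h
  exact ⟨Matrix.of fun i j => y j i, Matrix.ext fun i j => (congrFun (hy j) i).symm⟩

theorem eq_of_range_le {S S' : Matrix (Fin n) (Fin r) A} {L : Matrix (Fin r) (Fin n) A}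
    (h : L * S = 1) (h' : L * S' = 1)
    (hle : LinearMap.range (Matrix.toLin' S) ≤ LinearMap.range (Matrix.toLin' S')) : S = S' := by
  obtain ⟨Y, rfl⟩ := exists_eq_mul_of_range_le hle
  rw [← Matrix.mul_assoc, h', Matrix.one_mul] at h
  rw [h, Matrix.mul_one]

theorem MapsOnto.mono {G : Matrix (Fin r) (Fin n) A} {N M : Submodule A (Fin n → A)}
    (h : MapsOnto G N) (hNM : N ≤ M) : MapsOnto G M :=
  top_le_iff.1 (h ▸ Submodule.map_mono hNM)

theorem mapsOnto_range_iff (G : Matrix (Fin r) (Fin n) A) (S : Matrix (Fin n) (Fin r) A) :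
    MapsOnto G (LinearMap.range (Matrix.toLin' S)) ↔ IsUnit (G * S).det := by
  rw [MapsOnto, ← LinearMap.range_comp, ← Matrix.toLin'_mul, range_toLin'_eq_top_iff]

theorem exists_linearIndependent_comp_of_span_eq_top {V : Type*} {ι : Type*} [AddCommGroup V]
    [Module K V] [FiniteDimensional K V] (hV : Module.finrank K V = r) {w : ι → V}
    (hw : Submodule.span K (Set.range w) = ⊤) :
    ∃ a : Fin r → ι, LinearIndependent K (w ∘ a) := by
  obtain ⟨κ, a, -, hspan, hli⟩ := exists_linearIndependent' K w
  have basis := Module.Basis.mk hli (by rw [hspan, hw])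
  have := FiniteDimensional.fintypeBasisIndex basis
  have hcard : Fintype.card (Fin r) = Fintype.card κ := by
    rw [← Module.finrank_eq_card_basis basis, hV, Fintype.card_fin]
  exact ⟨a ∘ Fintype.equivOfCardEq hcard, hli.comp _ (Equiv.injective _)⟩

theorem exists_range_le_det_ne_zero (f : A →+* K) (G : Matrix (Fin r) (Fin n) A)
    (N : Submodule A (Fin n → A)) (h : MapsOnto (G.map f) (extendSub f N)) :
    ∃ S : Matrix (Fin n) (Fin r) A,
      LinearMap.range (Matrix.toLin' S) ≤ N ∧ f (G * S).det ≠ 0 := by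
  have hspan : Submodule.span K (Set.range fun v : N => f ∘ Matrix.toLin' G v) = ⊤ := by
    rw [← h, map_extendSub, extendSub, Submodule.map_coe, Set.image_image, Set.image_eq_range]
    rfl
  obtain ⟨a, ha⟩ := exists_linearIndependent_comp_of_span_eq_top
    (Module.finrank_fin_fun K) hspan
  refine ⟨Matrix.of fun i j => (a j).1 i, (range_toLin'_le_iff _ _).2 fun j => (a j).2, ?_⟩
  rw [← det_map, ← isUnit_iff_ne_zero, ← Matrix.isUnit_iff_isUnit_det,
    ← Matrix.linearIndependent_cols_iff_isUnit]
  exact ha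

theorem exists_forall_mapsOnto_extendSub (G : Matrix (Fin r) (Fin n) A)
    (N : Submodule A (Fin n → A)) (p : PrimeSpectrum A)
    (h : MapsOnto (G.map (algebraMap A p.asIdeal.ResidueField))
      (extendSub (algebraMap A p.asIdeal.ResidueField) N)) :
    ∃ f ∉ p.asIdeal, ∀ (B : Type u) [CommRing B] (g : A →+* B), IsUnit (g f) →
      MapsOnto (G.map g) (extendSub g N) := by
  obtain ⟨S, hSN, hdet⟩ := exists_range_le_det_ne_zero _ G N h
  refine ⟨(G * S).det, mt Ideal.algebraMap_residueField_eq_zero.2 hdet, fun B _ g hg => ?_⟩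
  refine MapsOnto.mono ?_ (extendSub_mono g hSN)
  rwa [extendSub_range, mapsOnto_range_iff, ← Matrix.map_mul, det_map]

end Matrix

/-! ### Coordinate projections and graphs -/

section Graph

variable (A : Type u) {B : Type u} [CommRing A] [CommRing B] {r b n : ℕ} (σ : Fin r ⊕ Fin b ≃ Fin n)

/-- The projection of `A ^ n` to the first block of the coordinates split by `σ`. -/
def fstProj : Matrix (Fin r) (Fin n) A := (1 : Matrix (Fin n) (Fin n) A).submatrix (σ ∘ Sum.inl) id

/-- The projection of `A ^ n` to the second block of the coordinates split by `σ`. -/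
def sndProj : Matrix (Fin b) (Fin n) A := (1 : Matrix (Fin n) (Fin n) A).submatrix (σ ∘ Sum.inr) id

/-- The inclusion into `A ^ n` of the first block of the coordinates split by `σ`. -/
def fstIncl : Matrix (Fin n) (Fin r) A := (1 : Matrix (Fin n) (Fin n) A).submatrix id (σ ∘ Sum.inl)

/-- The inclusion into `A ^ n` of the second block of the coordinates split by `σ`. -/
def sndIncl : Matrix (Fin n) (Fin b) A := (1 : Matrix (Fin n) (Fin n) A).submatrix id (σ ∘ Sum.inr)

theorem fstProj_mul {m : ℕ} (S : Matrix (Fin n) (Fin m) A) :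
    fstProj A σ * S = S.submatrix (σ ∘ Sum.inl) id := by
  ext i j
  simp [fstProj, Matrix.mul_apply, Matrix.one_apply]

theorem sndProj_mul {m : ℕ} (S : Matrix (Fin n) (Fin m) A) :
    sndProj A σ * S = S.submatrix (σ ∘ Sum.inr) id := by
  ext i j
  simp [sndProj, Matrix.mul_apply, Matrix.one_apply]

theorem fstProj_mul_fstIncl : fstProj A σ * fstIncl A σ = 1 := by
  ext i j
  simp [fstProj_mul, fstIncl, Matrix.one_apply]

theorem fstProj_mul_sndIncl : fstProj A σ * sndIncl A σ = 0 := by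
  ext i j
  simp [fstProj_mul, sndIncl]

theorem sndProj_mul_fstIncl : sndProj A σ * fstIncl A σ = 0 := by
  ext i j
  simp [sndProj_mul, fstIncl]

theorem sndProj_mul_sndIncl : sndProj A σ * sndIncl A σ = 1 := by
  ext i j
  simp [sndProj_mul, sndIncl, Matrix.one_apply]

theorem fstIncl_mul_fstProj_add : fstIncl A σ * fstProj A σ + sndIncl A σ * sndProj A σ = 1 := by
  have hrow (i : Fin n) (f : Fin n → A) :
      ∑ x, (1 : Matrix (Fin n) (Fin n) A) i (σ x) * f (σ x) = f i := by
    rw [σ.sum_comp fun j => (1 : Matrix (Fin n) (Fin n) A) i j * f j]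
    simp [Matrix.one_apply]
  ext i j
  rw [← hrow i fun x => (1 : Matrix (Fin n) (Fin n) A) x j, Fintype.sum_sum_type]
  rfl

variable {A}

theorem one_submatrix_map {l o : Type*} (f : A →+* B) (e₁ : l → Fin n) (e₂ : o → Fin n) :
    ((1 : Matrix (Fin n) (Fin n) A).submatrix e₁ e₂).map f =
      (1 : Matrix (Fin n) (Fin n) B).submatrix e₁ e₂ := by
  rw [← Matrix.submatrix_map, Matrix.map_one _ f.map_zero f.map_one]

theorem fstProj_map (f : A →+* B) : (fstProj A σ).map f = fstProj B σ := one_submatrix_map f _ _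

theorem sndProj_map (f : A →+* B) : (sndProj A σ).map f = sndProj B σ := one_submatrix_map f _ _

theorem fstIncl_map (f : A →+* B) : (fstIncl A σ).map f = fstIncl B σ := one_submatrix_map f _ _

theorem sndIncl_map (f : A →+* B) : (sndIncl A σ).map f = sndIncl B σ := one_submatrix_map f _ _

/-- The matrix whose columns span the graph of `X`. -/
def graphFrame (X : Matrix (Fin b) (Fin r) A) : Matrix (Fin n) (Fin r) A :=
  fstIncl A σ + sndIncl A σ * X

/-- The matrix of the projection of `A ^ n` to the second block along the graph of `X`. -/
def graphCoframe (X : Matrix (Fin b) (Fin r) A) : Matrix (Fin b) (Fin n) A :=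
  sndProj A σ - X * fstProj A σ

variable (X : Matrix (Fin b) (Fin r) A)

theorem fstProj_mul_graphFrame : fstProj A σ * graphFrame σ X = 1 := by
  rw [graphFrame, Matrix.mul_add, ← Matrix.mul_assoc, fstProj_mul_fstIncl, fstProj_mul_sndIncl,
    Matrix.zero_mul, add_zero]

theorem sndProj_mul_graphFrame : sndProj A σ * graphFrame σ X = X := by
  rw [graphFrame, Matrix.mul_add, ← Matrix.mul_assoc, sndProj_mul_fstIncl, sndProj_mul_sndIncl,
    Matrix.one_mul, zero_add]

theorem graphCoframe_mul_graphFrame : graphCoframe σ X * graphFrame σ X = 0 := by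
  rw [graphCoframe, Matrix.sub_mul, Matrix.mul_assoc, fstProj_mul_graphFrame,
    sndProj_mul_graphFrame, Matrix.mul_one, sub_self]

theorem graphCoframe_mul_sndIncl : graphCoframe σ X * sndIncl A σ = 1 := by
  rw [graphCoframe, Matrix.sub_mul, Matrix.mul_assoc, fstProj_mul_sndIncl, sndProj_mul_sndIncl,
    Matrix.mul_zero, sub_zero]

theorem graphFrame_mul_fstProj_add :
    graphFrame σ X * fstProj A σ + sndIncl A σ * graphCoframe σ X = 1 := by
  rw [← fstIncl_mul_fstProj_add A σ, graphFrame, graphCoframe, Matrix.add_mul, Matrix.mul_sub,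
    Matrix.mul_assoc]
  abel

theorem graphFrame_map (f : A →+* B) : (graphFrame σ X).map f = graphFrame σ (X.map f) := by
  rw [graphFrame, graphFrame, Matrix.map_add _ (map_add f), Matrix.map_mul, fstIncl_map,
    sndIncl_map]

theorem graphCoframe_map (f : A →+* B) :
    (graphCoframe σ X).map f = graphCoframe σ (X.map f) := by
  rw [graphCoframe, graphCoframe, Matrix.map_sub _ (map_sub f), Matrix.map_mul, fstProj_map,
    sndProj_map]

theorem graphFrame_sndProj_mul {S : Matrix (Fin n) (Fin r) A} (h : fstProj A σ * S = 1) :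
    graphFrame σ (sndProj A σ * S) = S := by
  conv_rhs => rw [← Matrix.one_mul S, ← fstIncl_mul_fstProj_add A σ, Matrix.add_mul,
    Matrix.mul_assoc, h, Matrix.mul_one, Matrix.mul_assoc]
  rfl

end Graph

section Sections

variable {A : Type u} [CommRing A] {r n : ℕ}

theorem projective_quotient_range_of_mul_eq_one {S : Matrix (Fin n) (Fin r) A}
    {L : Matrix (Fin r) (Fin n) A} (h : L * S = 1) :
    Module.Projective A ((Fin n → A) ⧸ LinearMap.range (Matrix.toLin' S)) := by
  let E : (Fin n → A) →ₗ[A] (Fin n → A) := LinearMap.id - Matrix.toLin' (S * L)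
  have hE : LinearMap.range (Matrix.toLin' S) ≤ LinearMap.ker E := by
    rw [LinearMap.range_le_ker_iff, LinearMap.sub_comp, LinearMap.id_comp, ← Matrix.toLin'_mul,
      Matrix.mul_assoc, h, Matrix.mul_one, sub_self]
  refine Module.Projective.of_split (Submodule.liftQ _ E hE) (Submodule.mkQ _) ?_
  refine Submodule.linearMap_qext _ (LinearMap.ext fun v => (Submodule.Quotient.eq _).2 ?_)
  exact ⟨-(Matrix.toLin' L v), by simp [E, Matrix.mulVec_neg]⟩

/-- The point of the Grassmannian spanned by the columns of a matrix with a left inverse. -/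
def Gr.ofLeftInverse (S : Matrix (Fin n) (Fin r) A) (L : Matrix (Fin r) (Fin n) A)
    (h : L * S = 1) : Gr A r n where
  sub := LinearMap.range (Matrix.toLin' S)
  projective_quotient := projective_quotient_range_of_mul_eq_one h
  rank_eq p := by
    have hinj : Function.Injective (Matrix.toLin' S) :=
      Function.LeftInverse.injective (g := Matrix.toLin' L) fun v => by
        rw [← LinearMap.comp_apply, ← Matrix.toLin'_mul, h, Matrix.toLin'_one, LinearMap.id_apply]
    have := p.nontrivial
    rw [← Module.rankAtStalk_eq_of_equiv (LinearEquiv.ofInjective _ hinj),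
      Module.rankAtStalk_eq_finrank_of_free, Module.finrank_fin_fun, Pi.natCast_apply, Nat.cast_id]

theorem Gr.exists_section (N : Gr A r n) {L : Matrix (Fin r) (Fin n) A} (h : MapsOnto L N.sub) :
    ∃ S : Matrix (Fin n) (Fin r) A, L * S = 1 ∧ N.sub = LinearMap.range (Matrix.toLin' S) := by
  have hbasis (j : Fin r) : ∃ v ∈ N.sub, Matrix.toLin' L v = Pi.single j 1 :=
    (h ▸ Submodule.mem_top : Pi.single j 1 ∈ N.sub.map (Matrix.toLin' L))
  choose v hv hvj using hbasis
  have hLS : L * (Matrix.of fun i j => v j i) = 1 := by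
    ext i j
    rw [Matrix.one_apply, ← Pi.single_apply, ← hvj j]
    rfl
  refine ⟨_, hLS, N.eq_of_le_of_map_eq_top (Matrix.toLin' L)
    ((range_toLin'_le_iff _ _).2 hv) ((mapsOnto_range_iff _ _).2 ?_)⟩
  rw [hLS, Matrix.det_one]
  exact isUnit_one

end Sections

section Field

variable {K : Type u} [Field K] {r n m : ℕ}

theorem Gr.finrank_sub (N : Gr K r n) : Module.finrank K N.sub = r := by
  have := N.rank_eq ⊥
  rwa [Module.rankAtStalk_eq_finrank_of_free] at this

theorem exists_equiv_comp_inl_eq (hn : n = r + m) {a : Fin r → Fin n}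
    (ha : Function.Injective a) : ∃ ρ : Fin r ⊕ Fin m ≃ Fin n, ρ ∘ Sum.inl = a := by
  classical
  have hcompl : Fintype.card (Fin m) = Fintype.card ((Set.range a)ᶜ : Set (Fin n)) := by
    rw [Fintype.card_compl_set, Set.card_range_of_injective ha]
    simp [hn]
  exact ⟨((Equiv.ofInjective a ha).sumCongr (Fintype.equivOfCardEq hcompl)).trans
    (Equiv.Set.sumCompl _), funext fun i => by simp⟩

theorem exists_mapsOnto_fstProj (hn : n = r + m) (W : Submodule K (Fin n → K))
    (hW : Module.finrank K W = r) : ∃ ρ : Fin r ⊕ Fin m ≃ Fin n, MapsOnto (fstProj K ρ) W := by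
  let basis := Module.finBasisOfFinrankEq K W hW
  let S : Matrix (Fin n) (Fin r) K := Matrix.of fun i j => (basis j).1 i
  have hrank : S.rank = r := by
    rw [← S.rank_transpose]
    simpa using LinearIndependent.rank_matrix (M := S.transpose)
      (basis.linearIndependent.map' W.subtype W.ker_subtype)
  have hrows : Submodule.span K (Set.range S.row) = ⊤ := by
    apply Submodule.eq_top_of_finrank_eq
    rw [← Matrix.rank_eq_finrank_span_row, hrank, Module.finrank_fin_fun]
  obtain ⟨a, ha⟩ := exists_linearIndependent_comp_of_span_eq_top (Module.finrank_fin_fun K) hrows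
  obtain ⟨ρ, rfl⟩ := exists_equiv_comp_inl_eq hn (ha.injective.of_comp)
  refine ⟨ρ, MapsOnto.mono ?_ ((range_toLin'_le_iff S W).2 fun j => (basis j).2)⟩
  rw [mapsOnto_range_iff, fstProj_mul, ← Matrix.isUnit_iff_isUnit_det,
    ← Matrix.linearIndependent_rows_iff_isUnit]
  exact ha

theorem MapsOnto.finrank_map {W W' : Submodule K (Fin n → K)} {G : Matrix (Fin r) (Fin n) K}
    (h : MapsOnto G W) (hW : Module.finrank K W = r) (hle : W' ≤ W) :
    Module.finrank K (W'.map (Matrix.toLin' G)) = Module.finrank K W' := by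
  have hsurj : Function.Surjective ((Matrix.toLin' G).domRestrict W) := by
    rw [← LinearMap.range_eq_top, LinearMap.range_domRestrict]
    exact h
  have hinj : Function.Injective ((Matrix.toLin' G).domRestrict W) :=
    (LinearMap.injective_iff_surjective_of_finrank_eq_finrank
      (by rw [hW, Module.finrank_fin_fun])).2 hsurj
  rw [← LinearMap.range_domRestrict]
  exact LinearMap.finrank_range_of_inj (hinj.comp (Submodule.inclusion_injective hle))

end Field

/-! ### The functor of incidence points -/

section MvPolynomial

variable {k A B : Type u} [CommRing k] [CommRing A] [CommRing B] {I : Type}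

/-- A homomorphism out of a polynomial ring as a homomorphism out of the coefficients together with
the values of the variables. -/
def evalEquiv : (k →+* A) × (I → A) ≃ (MvPolynomial I k →+* A) where
  toFun x := MvPolynomial.eval₂Hom x.1 x.2
  invFun φ := (φ.comp MvPolynomial.C, φ ∘ MvPolynomial.X)
  left_inv _ := Prod.ext (RingHom.ext fun a => MvPolynomial.eval₂Hom_C _ _ a)
    (funext fun i => MvPolynomial.eval₂Hom_X' _ _ i)
  right_inv _ := MvPolynomial.ringHom_ext (fun a => MvPolynomial.eval₂Hom_C _ _ a)
    fun i => MvPolynomial.eval₂Hom_X' _ _ i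

theorem comp_evalEquiv (f : A →+* B) (x : (k →+* A) × (I → A)) :
    f.comp (evalEquiv x) = evalEquiv (f.comp x.1, f ∘ x.2) :=
  MvPolynomial.comp_eval₂Hom _ _ _

end MvPolynomial

section Functor

variable {k A B C : Type u} [Field k] [CommRing A] [CommRing B] [CommRing C]
  {d₁ d₂ d₃ r₁ r₂ c : ℕ}

namespace RepSpace

/-- Base change of a pair of matrices. -/
def map (f : A →+* B) (W : RepSpace A d₁ d₂ d₃) : RepSpace B d₁ d₂ d₃ :=
  ⟨W.α.map f, W.β.map f⟩

/-- A pair of matrices is determined by its entries, which are arbitrary. -/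
def coordsEquiv : RepSpace A d₁ d₂ d₃ ≃ (Coord d₁ d₂ d₃ → A) where
  toFun := coords
  invFun x := ⟨.of fun i j => x (.inl (i, j)), .of fun i j => x (.inr (i, j))⟩
  left_inv _ := rfl
  right_inv x := by
    ext (_ | _) <;> rfl

theorem coords_map (f : A →+* B) (W : RepSpace A d₁ d₂ d₃) :
    (W.map f).coords = f ∘ W.coords := by
  ext (_ | _) <;> rfl

end RepSpace

variable (k d₁ d₂ d₃) in
/-- The functor sending `A` to the pairs of matrices over `A`, together with a `k`-algebra
structure on `A`. -/
def repFunctor : CommRingCat.{u} ⥤ Type u where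
  obj A := (k →+* A) × RepSpace A d₁ d₂ d₃
  map f := ↾fun P => (f.hom.comp P.1, P.2.map f.hom)

variable (k d₁ d₂ d₃) in
/-- The points of the affine space `Rep(Q, d)`: `k`-algebra structures together with pairs of
matrices. -/
def repPoints (A : CommRingCat.{u}) :
    (Spec A ⟶ repScheme k d₁ d₂ d₃) ≃ (k →+* A) × RepSpace A d₁ d₂ d₃ :=
  ((((Equiv.refl _).prodCongr RepSpace.coordsEquiv).trans evalEquiv).trans
    ((ConcreteCategory.homEquiv (C := CommRingCat)
      (X := CommRingCat.of (MvPolynomial (Coord d₁ d₂ d₃) k)) (Y := A)).symm.trans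
        Spec.homEquiv.symm)).symm

theorem repPoints_symm_apply {A : CommRingCat.{u}} (P : (k →+* A) × RepSpace A d₁ d₂ d₃) :
    (repPoints k d₁ d₂ d₃ A).symm P =
      Spec.map (CommRingCat.ofHom (MvPolynomial.eval₂Hom P.1 P.2.coords)) :=
  rfl

theorem specMap_comp_repPoints_symm {A B : CommRingCat.{u}} (f : A ⟶ B)
    (P : (k →+* A) × RepSpace A d₁ d₂ d₃) :
    Spec.map f ≫ (repPoints k d₁ d₂ d₃ A).symm P =
      (repPoints k d₁ d₂ d₃ B).symm (f.hom.comp P.1, P.2.map f.hom) := by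
  rw [repPoints_symm_apply, repPoints_symm_apply, RepSpace.coords_map]
  refine (Spec.map_comp _ _).symm.trans ?_
  exact congrArg (Spec.map ∘ CommRingCat.ofHom) (comp_evalEquiv f.hom (P.1, P.2.coords))

variable (k d₁ d₂ d₃) in
/-- `repFunctor` is the functor of points of the affine space `Rep(Q, d)`. -/
def repFunctorIso : repFunctor k d₁ d₂ d₃ ≅ affinePoints (repScheme k d₁ d₂ d₃) :=
  NatIso.ofComponents (fun A => (repPoints k d₁ d₂ d₃ A).symm.toIso) fun f =>
    ConcreteCategory.hom_ext _ _ fun P => (specMap_comp_repPoints_symm f P).symm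

theorem isZariskiSheaf_repFunctor : IsZariskiSheaf (repFunctor k d₁ d₂ d₃) :=
  .of_iso (repFunctorIso k d₁ d₂ d₃) (isZariskiSheaf_affinePoints _)

namespace IncidencePoint

theorem ext_of_eq {P Q : IncidencePoint A d₁ d₂ d₃ r₁ r₂ c} (hV : P.V = Q.V)
    (h₁ : P.F.R₁.sub = Q.F.R₁.sub) (h₂ : P.F.R₂.sub = Q.F.R₂.sub) (h : P.R.sub = Q.R.sub) :
    P = Q :=
  IncidencePoint.ext hV (Flag.ext (Gr.ext h₁) (Gr.ext h₂)) (Gr.ext h)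

/-- Base change of an incidence point. -/
def map (f : A →+* B) (P : IncidencePoint A d₁ d₂ d₃ r₁ r₂ c) :
    IncidencePoint B d₁ d₂ d₃ r₁ r₂ c where
  V := P.V.map f
  F := ⟨P.F.R₁.map f, P.F.R₂.map f, extendSub_mono f P.F.le⟩
  R := P.R.map f
  range_le := (extendSub_range f P.V.α).symm.trans_le (extendSub_mono f P.range_le)
  map_le := (map_extendSub f P.V.β P.F.R₂.sub).trans_le (extendSub_mono f P.map_le)

theorem map_id (P : IncidencePoint A d₁ d₂ d₃ r₁ r₂ c) : P.map (RingHom.id A) = P :=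
  ext_of_eq rfl (extendSub_id _) (extendSub_id _) (extendSub_id _)

theorem map_comp (f : A →+* B) (g : B →+* C) (P : IncidencePoint A d₁ d₂ d₃ r₁ r₂ c) :
    P.map (g.comp f) = (P.map f).map g :=
  ext_of_eq rfl (extendSub_comp _ _ _) (extendSub_comp _ _ _) (extendSub_comp _ _ _)

end IncidencePoint

variable (k d₁ d₂ d₃ r₁ r₂ c) in
/-- The functor sending `A` to the incidence points over `A`, together with a `k`-algebra
structure on `A`. -/
def incidenceFunctor : CommRingCat.{u} ⥤ Type u where
  obj A := (k →+* A) × IncidencePoint A d₁ d₂ d₃ r₁ r₂ c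
  map f := ↾fun P => (f.hom.comp P.1, P.2.map f.hom)
  map_id _ := ConcreteCategory.hom_ext _ _ fun P => congrArg (Prod.mk P.1) P.2.map_id
  map_comp f g := ConcreteCategory.hom_ext _ _ fun P =>
    congrArg (Prod.mk _) (P.2.map_comp f.hom g.hom)

variable (k d₁ d₂ d₃ r₁ r₂ c) in
/-- The projection `(W, R₁ ⊆ R₂, R) ↦ W`. -/
def incidenceToRep : incidenceFunctor k d₁ d₂ d₃ r₁ r₂ c ⟶ repFunctor k d₁ d₂ d₃ where
  app _ := ↾fun P => (P.1, P.2.V)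

theorem eq_of_extendSub_eq {ι : Type*} {f : ι → A} (hf : Ideal.span (Set.range f) = ⊤) {n : ℕ}
    {N M : Submodule A (Fin n → A)}
    (h : ∀ i, extendSub (algebraMap A (Localization.Away (f i))) N =
      extendSub (algebraMap A (Localization.Away (f i))) M) : N = M :=
  le_antisymm (le_of_extendSub_le hf fun i => (h i).le) (le_of_extendSub_le hf fun i => (h i).ge)

theorem IncidencePoint.exists_map_eq {ι : Type*} {f : ι → A}
    (hf : Ideal.span (Set.range f) = ⊤)
    (P : ∀ i, IncidencePoint (Localization.Away (f i)) d₁ d₂ d₃ r₁ r₂ c)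
    (h₁ : IsCompatible f fun i => (P i).F.R₁.sub) (h₂ : IsCompatible f fun i => (P i).F.R₂.sub)
    (h : IsCompatible f fun i => (P i).R.sub) {W : RepSpace A d₁ d₂ d₃}
    (hW : ∀ i, W.map (algebraMap A _) = (P i).V) :
    ∃ Q : IncidencePoint A d₁ d₂ d₃ r₁ r₂ c, Q.V = W ∧ ∀ i, Q.map (algebraMap A _) = P i := by
  obtain ⟨R₁, hR₁⟩ := Gr.exists_map_eq hf (fun i => (P i).F.R₁) h₁
  obtain ⟨R₂, hR₂⟩ := Gr.exists_map_eq hf (fun i => (P i).F.R₂) h₂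
  obtain ⟨R, hR⟩ := Gr.exists_map_eq hf (fun i => (P i).R) h
  have hα i : W.α.map (algebraMap A _) = (P i).V.α := congrArg RepSpace.α (hW i)
  have hβ i : W.β.map (algebraMap A _) = (P i).V.β := congrArg RepSpace.β (hW i)
  have hR₁ i : extendSub (algebraMap A _) R₁.sub = (P i).F.R₁.sub := congrArg Gr.sub (hR₁ i)
  have hR₂ i : extendSub (algebraMap A _) R₂.sub = (P i).F.R₂.sub := congrArg Gr.sub (hR₂ i)
  have hR i : extendSub (algebraMap A _) R.sub = (P i).R.sub := congrArg Gr.sub (hR i)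
  have le : R₁.sub ≤ R₂.sub := le_of_extendSub_le hf fun i => by
    rw [hR₁, hR₂]
    exact (P i).F.le
  have range_le : LinearMap.range (Matrix.toLin' W.α) ≤ R₁.sub :=
    le_of_extendSub_le hf fun i => by
      rw [extendSub_range, hα, hR₁]
      exact (P i).range_le
  have map_le : R₂.sub.map (Matrix.toLin' W.β) ≤ R.sub := le_of_extendSub_le hf fun i => by
    rw [← map_extendSub, hβ, hR₂, hR]
    exact (P i).map_le
  exact ⟨⟨W, ⟨R₁, R₂, le⟩, R, range_le, map_le⟩, rfl,
    fun i => ext_of_eq (hW i) (hR₁ i) (hR₂ i) (hR i)⟩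

theorem isZariskiSheaf_incidenceFunctor :
    IsZariskiSheaf (incidenceFunctor k d₁ d₂ d₃ r₁ r₂ c) where
  separated {A _} f hf P Q H := by
    obtain ⟨hk, hV⟩ : P.1 = Q.1 ∧ P.2.V = Q.2.V :=
      Prod.ext_iff.1 <| isZariskiSheaf_repFunctor.separated f hf ((incidenceToRep ..).app A P)
        ((incidenceToRep ..).app A Q) fun i => by
          rw [← NatTrans.naturality_apply, H, NatTrans.naturality_apply]
    have hP i : P.2.map (awayHom (f i)).hom = Q.2.map (awayHom (f i)).hom :=
      congrArg Prod.snd (H i)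
    exact congrArg₂ Prod.mk hk (IncidencePoint.ext_of_eq hV
      (eq_of_extendSub_eq hf fun i => congrArg (fun z => z.F.R₁.sub) (hP i))
      (eq_of_extendSub_eq hf fun i => congrArg (fun z => z.F.R₂.sub) (hP i))
      (eq_of_extendSub_eq hf fun i => congrArg (fun z => z.R.sub) (hP i)))
  glue {A _} f hf P H := by
    obtain ⟨W, hW⟩ := isZariskiSheaf_repFunctor.glue f hf
      (fun i => (incidenceToRep ..).app _ (P i)) fun i j B g h hgh => by
        rw [← NatTrans.naturality_apply, H i j B g h hgh, NatTrans.naturality_apply]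
    have compat (i j) (B : Type u) [CommRing B] (g h) (hgh : RingHom.comp g _ = RingHom.comp h _) :
        (P i).2.map g = (P j).2.map h :=
      congrArg Prod.snd (H i j (.of B) (CommRingCat.ofHom g) (CommRingCat.ofHom h)
        (CommRingCat.hom_ext hgh))
    obtain ⟨Q, _, hQ⟩ := IncidencePoint.exists_map_eq hf (fun i => (P i).2)
      (fun i j B _ g h hgh => congrArg (fun z => z.F.R₁.sub) (compat i j B g h hgh))
      (fun i j B _ g h hgh => congrArg (fun z => z.F.R₂.sub) (compat i j B g h hgh))
      (fun i j B _ g h hgh => congrArg (fun z => z.R.sub) (compat i j B g h hgh))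
      fun i => congrArg Prod.snd (hW i)
    exact ⟨(W.1, Q), fun i => congrArg₂ Prod.mk (congrArg Prod.fst (hW i)) (hQ i)⟩

end Functor

/-! ### Charts of the incidence variety -/

section Charts

variable {k A B : Type u} [Field k] [CommRing A] [CommRing B] {d₁ d₂ d₃ r₁ m r₂ b c e : ℕ}

/-- Index set of the charts: decompositions of the bases of `A ^ d₂`, `A ^ r₂` and `A ^ d₃`. On the
chart, `R₂` is the graph of a linear map between the two summands of the first one, `R₁` (inside
`R₂ ≅ A ^ r₂`) the graph of a linear map between the summands of the second one, and `R` the graph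
of a linear map between the summands of the third one. -/
structure ChartIndex (d₂ d₃ r₁ m r₂ b c e : ℕ) where
  σ : Fin r₂ ⊕ Fin b ≃ Fin d₂
  ρ : Fin r₁ ⊕ Fin m ≃ Fin r₂
  τ : Fin c ⊕ Fin e ≃ Fin d₃

instance : Finite (ChartIndex d₂ d₃ r₁ m r₂ b c e) :=
  Finite.of_injective (fun w => (w.σ, w.ρ, w.τ)) fun ⟨_, _, _⟩ ⟨_, _, _⟩ h => by simpa using h

/-- The coordinates of an incidence point on a chart: the linear maps `X₂`, `X₁`, `X` whose graphs
are `R₂`, `R₁`, `R`, the map `α` into `R₁`, and the restrictions `β₁`, `β₂` of `W(β)` to `R₂` and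
to its coordinate complement. -/
@[ext]
structure ChartPoint (A : Type u) [CommRing A] (d₁ d₃ r₁ m r₂ b c e : ℕ) where
  X₂ : Matrix (Fin b) (Fin r₂) A
  X₁ : Matrix (Fin m) (Fin r₁) A
  X : Matrix (Fin e) (Fin c) A
  α : Matrix (Fin r₁) (Fin d₁) A
  β₁ : Matrix (Fin c) (Fin r₂) A
  β₂ : Matrix (Fin d₃) (Fin b) A

/-- Index set of the matrix entries of a `ChartPoint`. -/
abbrev ChartCoord (d₁ d₃ r₁ m r₂ b c e : ℕ) : Type :=
  (Fin b × Fin r₂) ⊕ (Fin m × Fin r₁) ⊕ (Fin e × Fin c) ⊕ (Fin r₁ × Fin d₁) ⊕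
    (Fin c × Fin r₂) ⊕ (Fin d₃ × Fin b)

namespace ChartPoint

/-- Base change of the coordinates on a chart. -/
def map (f : A →+* B) (x : ChartPoint A d₁ d₃ r₁ m r₂ b c e) :
    ChartPoint B d₁ d₃ r₁ m r₂ b c e :=
  ⟨x.X₂.map f, x.X₁.map f, x.X.map f, x.α.map f, x.β₁.map f, x.β₂.map f⟩

/-- A `ChartPoint` is determined by its matrix entries, which are arbitrary: the charts are affine
spaces. -/
def coordsEquiv : ChartPoint A d₁ d₃ r₁ m r₂ b c e ≃ (ChartCoord d₁ d₃ r₁ m r₂ b c e → A) where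
  toFun x := Sum.elim (fun p => x.X₂ p.1 p.2) <| Sum.elim (fun p => x.X₁ p.1 p.2) <|
    Sum.elim (fun p => x.X p.1 p.2) <| Sum.elim (fun p => x.α p.1 p.2) <|
    Sum.elim (fun p => x.β₁ p.1 p.2) fun p => x.β₂ p.1 p.2
  invFun y := ⟨.of fun i j => y (.inl (i, j)), .of fun i j => y (.inr (.inl (i, j))),
    .of fun i j => y (.inr (.inr (.inl (i, j)))),
    .of fun i j => y (.inr (.inr (.inr (.inl (i, j))))),
    .of fun i j => y (.inr (.inr (.inr (.inr (.inl (i, j)))))),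
    .of fun i j => y (.inr (.inr (.inr (.inr (.inr (i, j))))))⟩
  left_inv _ := rfl
  right_inv y := by
    ext (_ | _ | _ | _ | _ | _) <;> rfl

theorem coordsEquiv_symm_comp (f : A →+* B) (y : ChartCoord d₁ d₃ r₁ m r₂ b c e → A) :
    coordsEquiv.symm (f ∘ y) = (coordsEquiv.symm y).map f :=
  rfl

end ChartPoint

namespace ChartIndex

variable (w : ChartIndex d₂ d₃ r₁ m r₂ b c e) (x y : ChartPoint A d₁ d₃ r₁ m r₂ b c e)

/-- The matrix whose columns span `R₂`. -/
def frame₂ : Matrix (Fin d₂) (Fin r₂) A := graphFrame w.σ x.X₂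

/-- The matrix whose columns span `R₁`. -/
def frame₁ : Matrix (Fin d₂) (Fin r₁) A := w.frame₂ x * graphFrame w.ρ x.X₁

/-- The matrix whose columns span `R`. -/
def frame : Matrix (Fin d₃) (Fin c) A := graphFrame w.τ x.X

variable (A) in
/-- The coordinate projection that is an isomorphism on `R₁`. -/
def proj₁ : Matrix (Fin r₁) (Fin d₂) A := fstProj A w.ρ * fstProj A w.σ

/-- The matrix of `W(α)`. -/
def matα : Matrix (Fin d₂) (Fin d₁) A := w.frame₁ x * x.α

/-- The matrix of `W(β)`. -/
def matβ : Matrix (Fin d₃) (Fin d₂) A :=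
  w.frame x * x.β₁ * fstProj A w.σ + x.β₂ * graphCoframe w.σ x.X₂

theorem fstProj_mul_frame₂ : fstProj A w.σ * w.frame₂ x = 1 := fstProj_mul_graphFrame _ _

theorem fstProj_mul_frame₁ : fstProj A w.σ * w.frame₁ x = graphFrame w.ρ x.X₁ := by
  rw [frame₁, ← Matrix.mul_assoc, fstProj_mul_frame₂, Matrix.one_mul]

theorem proj₁_mul_frame₁ : w.proj₁ A * w.frame₁ x = 1 := by
  rw [proj₁, Matrix.mul_assoc, fstProj_mul_frame₁, fstProj_mul_graphFrame]

theorem fstProj_mul_frame : fstProj A w.τ * w.frame x = 1 := fstProj_mul_graphFrame _ _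

theorem matβ_mul_frame₂ : w.matβ x * w.frame₂ x = w.frame x * x.β₁ := by
  rw [matβ, Matrix.add_mul, Matrix.mul_assoc, fstProj_mul_frame₂, Matrix.mul_one, Matrix.mul_assoc,
    frame₂, graphCoframe_mul_graphFrame, Matrix.mul_zero, add_zero]

theorem matβ_mul_sndIncl : w.matβ x * sndIncl A w.σ = x.β₂ := by
  rw [matβ, Matrix.add_mul, Matrix.mul_assoc, fstProj_mul_sndIncl, Matrix.mul_zero, zero_add,
    Matrix.mul_assoc, graphCoframe_mul_sndIncl, Matrix.mul_one]

variable {w x} in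
theorem matβ_eq {β : Matrix (Fin d₃) (Fin d₂) A} (h₁ : β * w.frame₂ x = w.frame x * x.β₁)
    (h₂ : β * sndIncl A w.σ = x.β₂) : w.matβ x = β := by
  rw [matβ, ← h₁, ← h₂, frame₂, Matrix.mul_assoc, Matrix.mul_assoc, ← Matrix.mul_add,
    graphFrame_mul_fstProj_add, Matrix.mul_one]

theorem proj₁_map (f : A →+* B) : (w.proj₁ A).map f = w.proj₁ B := by
  rw [proj₁, Matrix.map_mul, fstProj_map, fstProj_map, proj₁]

theorem frame₂_map (f : A →+* B) : (w.frame₂ x).map f = w.frame₂ (x.map f) :=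
  graphFrame_map _ _ _

theorem frame₁_map (f : A →+* B) : (w.frame₁ x).map f = w.frame₁ (x.map f) := by
  rw [frame₁, Matrix.map_mul, frame₂_map, graphFrame_map, frame₁, ChartPoint.map]

theorem frame_map (f : A →+* B) : (w.frame x).map f = w.frame (x.map f) :=
  graphFrame_map _ _ _

theorem matα_map (f : A →+* B) : (w.matα x).map f = w.matα (x.map f) := by
  rw [matα, Matrix.map_mul, frame₁_map, matα, ChartPoint.map]

theorem matβ_map (f : A →+* B) : (w.matβ x).map f = w.matβ (x.map f) := by
  rw [matβ, Matrix.map_add _ (map_add f), Matrix.map_mul, Matrix.map_mul, Matrix.map_mul,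
    frame_map, fstProj_map, graphCoframe_map, matβ, ChartPoint.map]

/-- The incidence point with given coordinates on a chart. -/
def incidencePoint : IncidencePoint A d₁ d₂ d₃ r₁ r₂ c where
  V := ⟨w.matα x, w.matβ x⟩
  F := ⟨.ofLeftInverse _ _ (w.proj₁_mul_frame₁ x), .ofLeftInverse _ _ (w.fstProj_mul_frame₂ x),
    range_toLin'_mul_le _ _⟩
  R := .ofLeftInverse _ _ (w.fstProj_mul_frame x)
  range_le := range_toLin'_mul_le _ _
  map_le := by
    change (LinearMap.range (Matrix.toLin' (w.frame₂ x))).map (Matrix.toLin' (w.matβ x)) ≤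
      LinearMap.range (Matrix.toLin' (w.frame x))
    rw [← LinearMap.range_comp, ← Matrix.toLin'_mul, matβ_mul_frame₂]
    exact range_toLin'_mul_le _ _

theorem incidencePoint_map (f : A →+* B) :
    (w.incidencePoint x).map f = w.incidencePoint (x.map f) := by
  refine IncidencePoint.ext_of_eq (RepSpace.ext (w.matα_map x f) (w.matβ_map x f))
    ((extendSub_range f _).trans ?_) ((extendSub_range f _).trans ?_)
    ((extendSub_range f _).trans ?_)
  · rw [frame₁_map]; rfl
  · rw [frame₂_map]; rfl
  · rw [frame_map]; rfl

variable {x y} in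
theorem frames_eq_of_incidencePoint_eq (h : w.incidencePoint x = w.incidencePoint y) :
    w.frame₁ x = w.frame₁ y ∧ w.frame₂ x = w.frame₂ y ∧ w.frame x = w.frame y :=
  ⟨eq_of_range_le (w.proj₁_mul_frame₁ x) (w.proj₁_mul_frame₁ y)
      (congrArg (fun P => P.F.R₁.sub) h).le,
    eq_of_range_le (w.fstProj_mul_frame₂ x) (w.fstProj_mul_frame₂ y)
      (congrArg (fun P => P.F.R₂.sub) h).le,
    eq_of_range_le (w.fstProj_mul_frame x) (w.fstProj_mul_frame y)
      (congrArg (fun P => P.R.sub) h).le⟩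

theorem incidencePoint_injective : Function.Injective
    (w.incidencePoint : ChartPoint A d₁ d₃ r₁ m r₂ b c e → IncidencePoint A d₁ d₂ d₃ r₁ r₂ c) := by
  intro x y h
  obtain ⟨h₁, h₂, h₃⟩ := w.frames_eq_of_incidencePoint_eq h
  have hα : w.matα x = w.matα y := congrArg (fun P => P.V.α) h
  have hβ : w.matβ x = w.matβ y := congrArg (fun P => P.V.β) h
  ext1
  · rw [← sndProj_mul_graphFrame w.σ x.X₂, ← frame₂, h₂, frame₂, sndProj_mul_graphFrame]
  · rw [← sndProj_mul_graphFrame w.ρ x.X₁, ← fstProj_mul_frame₁, h₁, fstProj_mul_frame₁,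
      sndProj_mul_graphFrame]
  · rw [← sndProj_mul_graphFrame w.τ x.X, ← frame, h₃, frame, sndProj_mul_graphFrame]
  · have recover (z : ChartPoint A d₁ d₃ r₁ m r₂ b c e) : w.proj₁ A * w.matα z = z.α := by
      rw [matα, ← Matrix.mul_assoc, proj₁_mul_frame₁, Matrix.one_mul]
    rw [← recover x, hα, recover]
  · have recover (z : ChartPoint A d₁ d₃ r₁ m r₂ b c e) :
        fstProj A w.τ * (w.matβ z * w.frame₂ z) = z.β₁ := by
      rw [matβ_mul_frame₂, ← Matrix.mul_assoc, fstProj_mul_frame, Matrix.one_mul]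
    rw [← recover x, hβ, h₂, recover]
  · rw [← w.matβ_mul_sndIncl x, hβ, matβ_mul_sndIncl]

theorem exists_incidencePoint_eq (P : IncidencePoint A d₁ d₂ d₃ r₁ r₂ c)
    (h₁ : MapsOnto (w.proj₁ A) P.F.R₁.sub) (h₂ : MapsOnto (fstProj A w.σ) P.F.R₂.sub)
    (h₃ : MapsOnto (fstProj A w.τ) P.R.sub) :
    ∃ x : ChartPoint A d₁ d₃ r₁ m r₂ b c e, w.incidencePoint x = P := by
  obtain ⟨S₁, hS₁, hR₁⟩ := P.F.R₁.exists_section h₁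
  obtain ⟨S₂, hS₂, hR₂⟩ := P.F.R₂.exists_section h₂
  obtain ⟨S, hS, hR⟩ := P.R.exists_section h₃
  obtain ⟨Y, rfl⟩ := exists_eq_mul_of_range_le (hR₁ ▸ hR₂ ▸ P.F.le)
  obtain ⟨α, hα⟩ := exists_eq_mul_of_range_le (hR₁ ▸ P.range_le)
  obtain ⟨β₁, hβ⟩ : ∃ β₁, P.V.β * S₂ = S * β₁ := exists_eq_mul_of_range_le <| by
    rw [Matrix.toLin'_mul, LinearMap.range_comp, ← hR₂, ← hR]
    exact P.map_le
  have hY : fstProj A w.ρ * Y = 1 := by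
    rwa [proj₁, Matrix.mul_assoc, ← Matrix.mul_assoc (fstProj A w.σ), hS₂, Matrix.one_mul] at hS₁
  let x : ChartPoint A d₁ d₃ r₁ m r₂ b c e :=
    ⟨sndProj A w.σ * S₂, sndProj A w.ρ * Y, sndProj A w.τ * S, α, β₁, P.V.β * sndIncl A w.σ⟩
  have frame₂_eq : w.frame₂ x = S₂ := graphFrame_sndProj_mul w.σ hS₂
  have frame₁_eq : w.frame₁ x = S₂ * Y :=
    congrArg₂ (· * ·) frame₂_eq (graphFrame_sndProj_mul w.ρ hY)
  have frame_eq : w.frame x = S := graphFrame_sndProj_mul w.τ hS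
  have matα_eq : w.matα x = P.V.α := by rw [matα, frame₁_eq, hα]
  have matβ_eq : w.matβ x = P.V.β := matβ_eq (by rw [frame₂_eq, frame_eq, hβ]) rfl
  have range_eq {r n : ℕ} {S S' : Matrix (Fin n) (Fin r) A} {N : Submodule A (Fin n → A)}
      (h : S = S') (hN : N = LinearMap.range (Matrix.toLin' S')) :
      LinearMap.range (Matrix.toLin' S) = N := by rw [h, hN]
  exact ⟨x, IncidencePoint.ext_of_eq (RepSpace.ext matα_eq matβ_eq) (range_eq frame₁_eq hR₁)
    (range_eq frame₂_eq hR₂) (range_eq frame_eq hR)⟩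

variable (w' : ChartIndex d₂ d₃ r₁ m r₂ b c e)

/-- The function on the chart `w` whose nonvanishing locus is the overlap with the chart `w'`. -/
def overlapDet : A :=
  (w'.proj₁ A * w.frame₁ x).det * ((fstProj A w'.σ * w.frame₂ x).det *
    (fstProj A w'.τ * w.frame x).det)

theorem map_overlapDet (f : A →+* B) : f (w.overlapDet x w') = w.overlapDet (x.map f) w' := by
  simp only [overlapDet, map_mul, ← det_map, Matrix.map_mul, frame₁_map, frame₂_map, frame_map,
    proj₁_map, fstProj_map]

theorem isUnit_overlapDet_iff :
    IsUnit (w.overlapDet x w') ↔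
      ∃ y : ChartPoint A d₁ d₃ r₁ m r₂ b c e, w'.incidencePoint y = w.incidencePoint x := by
  rw [overlapDet, IsUnit.mul_iff, IsUnit.mul_iff, ← mapsOnto_range_iff, ← mapsOnto_range_iff,
    ← mapsOnto_range_iff]
  constructor
  · rintro ⟨h₁, h₂, h₃⟩
    exact w'.exists_incidencePoint_eq _ h₁ h₂ h₃
  · rintro ⟨y, hy⟩
    have mapsOnto {r n : ℕ} {L : Matrix (Fin r) (Fin n) A} {S S' : Matrix (Fin n) (Fin r) A}
        (hL : L * S' = 1)
        (h : LinearMap.range (Matrix.toLin' S') = LinearMap.range (Matrix.toLin' S)) :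
        MapsOnto L (LinearMap.range (Matrix.toLin' S)) := by
      rw [← h, mapsOnto_range_iff, hL, Matrix.det_one]
      exact isUnit_one
    exact ⟨mapsOnto (w'.proj₁_mul_frame₁ y) (congrArg (fun P => P.F.R₁.sub) hy),
      mapsOnto (w'.fstProj_mul_frame₂ y) (congrArg (fun P => P.F.R₂.sub) hy),
      mapsOnto (w'.fstProj_mul_frame y) (congrArg (fun P => P.R.sub) hy)⟩

end ChartIndex

theorem exists_chartIndex_mapsOnto {K : Type u} [Field K] (hd₂ : d₂ = r₂ + b) (hr₂ : r₂ = r₁ + m)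
    (hd₃ : d₃ = c + e) (F : Flag K r₁ r₂ d₂) (R : Gr K c d₃) :
    ∃ w : ChartIndex d₂ d₃ r₁ m r₂ b c e, MapsOnto (w.proj₁ K) F.R₁.sub ∧
      MapsOnto (fstProj K w.σ) F.R₂.sub ∧ MapsOnto (fstProj K w.τ) R.sub := by
  obtain ⟨σ, hσ⟩ := exists_mapsOnto_fstProj hd₂ _ F.R₂.finrank_sub
  obtain ⟨τ, hτ⟩ := exists_mapsOnto_fstProj hd₃ _ R.finrank_sub
  have finrank_map := (hσ.finrank_map F.R₂.finrank_sub F.le).trans F.R₁.finrank_sub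
  obtain ⟨ρ, hρ⟩ := exists_mapsOnto_fstProj hr₂ _ finrank_map
  refine ⟨⟨σ, ρ, τ⟩, ?_, hσ, hτ⟩
  rwa [MapsOnto, ← Submodule.map_comp, ← Matrix.toLin'_mul] at hρ

theorem IncidencePoint.exists_notMem_forall_eq_incidencePoint (hd₂ : d₂ = r₂ + b)
    (hr₂ : r₂ = r₁ + m) (hd₃ : d₃ = c + e) (P : IncidencePoint A d₁ d₂ d₃ r₁ r₂ c)
    (p : PrimeSpectrum A) :
    ∃ f ∉ p.asIdeal, ∃ w : ChartIndex d₂ d₃ r₁ m r₂ b c e, ∀ (B : Type u) [CommRing B]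
      (g : A →+* B), IsUnit (g f) →
        ∃ x : ChartPoint B d₁ d₃ r₁ m r₂ b c e, w.incidencePoint x = P.map g := by
  let PK := P.map (algebraMap A p.asIdeal.ResidueField)
  obtain ⟨w, h₁, h₂, h₃⟩ := exists_chartIndex_mapsOnto hd₂ hr₂ hd₃ PK.F PK.R
  rw [← w.proj₁_map (algebraMap A _)] at h₁
  rw [← fstProj_map _ (algebraMap A _)] at h₂ h₃
  obtain ⟨f₁, hf₁, H₁⟩ := exists_forall_mapsOnto_extendSub _ P.F.R₁.sub p h₁
  obtain ⟨f₂, hf₂, H₂⟩ := exists_forall_mapsOnto_extendSub _ P.F.R₂.sub p h₂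
  obtain ⟨f₃, hf₃, H₃⟩ := exists_forall_mapsOnto_extendSub _ P.R.sub p h₃
  refine ⟨f₁ * (f₂ * f₃), p.2.mul_notMem hf₁ (p.2.mul_notMem hf₂ hf₃), w, fun B _ g hg => ?_⟩
  simp only [map_mul, IsUnit.mul_iff] at hg
  have mapsOnto₁ := H₁ B g hg.1
  have mapsOnto₂ := H₂ B g hg.2.1
  have mapsOnto₃ := H₃ B g hg.2.2
  rw [w.proj₁_map] at mapsOnto₁
  rw [fstProj_map] at mapsOnto₂ mapsOnto₃
  exact w.exists_incidencePoint_eq _ mapsOnto₁ mapsOnto₂ mapsOnto₃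

variable (k d₁) in
/-- The tautological incidence point over the coordinate ring of a chart. -/
def ChartIndex.genericPoint (w : ChartIndex d₂ d₃ r₁ m r₂ b c e) :
    (incidenceFunctor k d₁ d₂ d₃ r₁ r₂ c).obj
      (.of (MvPolynomial (ChartCoord d₁ d₃ r₁ m r₂ b c e) k)) :=
  (MvPolynomial.C, w.incidencePoint (ChartPoint.coordsEquiv.symm MvPolynomial.X))

theorem ChartIndex.map_genericPoint (w : ChartIndex d₂ d₃ r₁ m r₂ b c e) {A : CommRingCat.{u}}
    (h : CommRingCat.of (MvPolynomial (ChartCoord d₁ d₃ r₁ m r₂ b c e) k) ⟶ A) :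
    (incidenceFunctor k d₁ d₂ d₃ r₁ r₂ c).map h (w.genericPoint k d₁) =
      ((evalEquiv.symm h.hom).1,
        w.incidencePoint (ChartPoint.coordsEquiv.symm (evalEquiv.symm h.hom).2)) :=
  congrArg (Prod.mk _) (w.incidencePoint_map _ _)

theorem ChartIndex.exists_map_genericPoint_eq_iff (w : ChartIndex d₂ d₃ r₁ m r₂ b c e)
    {A : CommRingCat.{u}} (P : (incidenceFunctor k d₁ d₂ d₃ r₁ r₂ c).obj A) :
    (∃ h, (incidenceFunctor k d₁ d₂ d₃ r₁ r₂ c).map h (w.genericPoint k d₁) = P) ↔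
      ∃ x : ChartPoint A d₁ d₃ r₁ m r₂ b c e, w.incidencePoint x = P.2 := by
  constructor
  · rintro ⟨h, rfl⟩
    exact ⟨_, (w.incidencePoint_map _ _).symm⟩
  · rintro ⟨x, hx⟩
    refine ⟨CommRingCat.ofHom (evalEquiv (P.1, ChartPoint.coordsEquiv x)), ?_⟩
    rw [w.map_genericPoint, CommRingCat.hom_ofHom, Equiv.symm_apply_apply, Equiv.symm_apply_apply,
      hx]
    rfl

variable (k d₁) in
/-- The atlas of the functor of incidence points whose charts are the affine spaces of
`ChartPoint`s. -/
def incidenceAtlas (hd₂ : d₂ = r₂ + b) (hr₂ : r₂ = r₁ + m) (hd₃ : d₃ = c + e) :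
    AffineAtlas (incidenceFunctor k d₁ d₂ d₃ r₁ r₂ c) where
  J := ULift.{u} (ChartIndex d₂ d₃ r₁ m r₂ b c e)
  R _ := .of (MvPolynomial (ChartCoord d₁ d₃ r₁ m r₂ b c e) k)
  pt w := w.down.genericPoint k d₁
  injective w A g h H := by
    rw [ChartIndex.map_genericPoint, ChartIndex.map_genericPoint] at H
    obtain ⟨hk, hx⟩ := Prod.ext_iff.1 H
    exact CommRingCat.hom_ext <| evalEquiv.symm.injective <| Prod.ext hk <|
      ChartPoint.coordsEquiv.symm.injective <| w.down.incidencePoint_injective hx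
  D w w' := w.down.overlapDet (ChartPoint.coordsEquiv.symm MvPolynomial.X) w'.down
  isUnit_iff w w' A h := by
    rw [ChartIndex.exists_map_genericPoint_eq_iff, ChartIndex.map_genericPoint,
      ← ChartIndex.isUnit_overlapDet_iff]
    exact iff_of_eq (congrArg IsUnit (w.down.map_overlapDet _ w'.down h.hom))
  covering A P p := by
    obtain ⟨f, hf, w, hw⟩ := P.2.exists_notMem_forall_eq_incidencePoint hd₂ hr₂ hd₃ p
    obtain ⟨h, hh⟩ := (w.exists_map_genericPoint_eq_iff
      ((incidenceFunctor k d₁ d₂ d₃ r₁ r₂ c).map (awayHom f) P)).2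
      (hw _ (algebraMap A (Localization.Away f)) (IsLocalization.Away.algebraMap_isUnit f))
    exact ⟨f, hf, ⟨w⟩, h, hh.symm⟩

end Charts

/-! ### The scheme of incidence points -/

section Projection

variable {k : Type u} [Field k] {d₁ d₂ d₃ r₁ r₂ c : ℕ} {A B : CommRingCat.{u}}

variable (k d₁ d₂ d₃) in
/-- The structure morphism of the affine space `Rep(Q, d)`. -/
def repBase : repScheme k d₁ d₂ d₃ ⟶ Spec (.of k) :=
  Spec.map (CommRingCat.ofHom MvPolynomial.C)

theorem repPoints_symm_comp_repBase (P : (k →+* A) × RepSpace A d₁ d₂ d₃) :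
    (repPoints k d₁ d₂ d₃ A).symm P ≫ repBase k d₁ d₂ d₃ = Spec.map (CommRingCat.ofHom P.1) :=
  (Spec.map_comp _ _).symm.trans <| congrArg (Spec.map ∘ CommRingCat.ofHom) <|
    RingHom.ext fun a => MvPolynomial.eval₂Hom_C _ _ a

variable {Z : Scheme.{u}} (η : affinePoints Z ≅ incidenceFunctor k d₁ d₂ d₃ r₁ r₂ c)

/-- The points of a scheme representing the functor of incidence points: `k`-algebra structures
together with incidence points. -/
def incidencePoints (A : CommRingCat.{u}) :
    (Spec A ⟶ Z) ≃ (k →+* A) × IncidencePoint A d₁ d₂ d₃ r₁ r₂ c :=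
  (η.app A).toEquiv

theorem incidencePoints_comp (f : A ⟶ B) (x : Spec A ⟶ Z) :
    incidencePoints η B (Spec.map f ≫ x) =
      (f.hom.comp (incidencePoints η A x).1, (incidencePoints η A x).2.map f.hom) :=
  NatTrans.naturality_apply η.hom f (x : (affinePoints Z).obj A)

/-- The projection `(W, R₁ ⊆ R₂, R) ↦ W` as a morphism of schemes. -/
def toRep : Z ⟶ repScheme k d₁ d₂ d₃ :=
  (exists_hom_of_natTrans (η.hom ≫ incidenceToRep .. ≫ (repFunctorIso ..).hom)).choose

/-- The structure morphism of a scheme of incidence points. -/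
def toBase : Z ⟶ Spec (.of k) :=
  toRep η ≫ repBase k d₁ d₂ d₃

theorem comp_toRep (x : Spec A ⟶ Z) :
    x ≫ toRep η =
      (repPoints k d₁ d₂ d₃ A).symm ((incidencePoints η A x).1, (incidencePoints η A x).2.V) :=
  (exists_hom_of_natTrans (η.hom ≫ incidenceToRep .. ≫ (repFunctorIso ..).hom)).choose_spec A x

theorem comp_toBase (x : Spec A ⟶ Z) :
    x ≫ toBase η = Spec.map (CommRingCat.ofHom (incidencePoints η A x).1) := by
  rw [toBase, ← Category.assoc, comp_toRep, repPoints_symm_comp_repBase]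

theorem incidencePoints_fst {A : Type u} [CommRing A] [Algebra k A] (x : Points (toBase η) A) :
    (incidencePoints η (.of A) x.1).1 = algebraMap k A :=
  congrArg CommRingCat.Hom.hom (Spec.map_injective ((comp_toBase η x.1).symm.trans x.2))

/-- A scheme representing the functor of incidence points is the incidence variety. -/
def incidenceVarietyStr : IncidenceVarietyStr (toBase η) d₁ d₂ d₃ r₁ r₂ c where
  equiv A _ _ :=
    { toFun x := (incidencePoints η (.of A) x.1).2
      invFun P := ⟨(incidencePoints η (.of A)).symm (algebraMap k A, P), by
        rw [comp_toBase, Equiv.apply_symm_apply]⟩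
      left_inv x := Subtype.ext <| (Equiv.symm_apply_eq _).2 <|
        congrArg (Prod.mk · _) (incidencePoints_fst η x).symm
      right_inv P :=
        congrArg Prod.snd ((incidencePoints η (.of A)).apply_symm_apply (algebraMap k A, P)) }
  natural A B _ _ _ _ f x y h := by
    have hy : (incidencePoints η (.of B) y.1).2 =
        (incidencePoints η (.of A) x.1).2.map f.toRingHom := by
      rw [h, incidencePoints_comp]
      rfl
    change IncidencePoint.IsBaseChange _ _ (incidencePoints η (.of B) y.1).2
    rw [hy]
    exact ⟨rfl, rfl, rfl, rfl, rfl⟩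

end Projection

/-! ### Smoothness and integrality -/

section Vandermonde

variable {K : Type u} [Field K] {n r : ℕ}

/-- The first `r` columns of the Vandermonde matrix with nodes `v`, as a rectangular matrix. -/
def vandermondeFrame (v : Fin n → K) (r : ℕ) : Matrix (Fin n) (Fin r) K :=
  Matrix.of fun i j => v i ^ (j : ℕ)

theorem isUnit_det_vandermondeFrame {v : Fin r → K} (hv : Function.Injective v) :
    IsUnit (vandermondeFrame v r).det :=
  isUnit_iff_ne_zero.2 (Matrix.det_vandermonde_ne_zero_iff.2 hv)

theorem range_vandermondeFrame_mono (v : Fin n → K) {s : ℕ} (h : r ≤ s) :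
    LinearMap.range (Matrix.toLin' (vandermondeFrame v r)) ≤
      LinearMap.range (Matrix.toLin' (vandermondeFrame v s)) := by
  rw [range_toLin'_eq_span, range_toLin'_eq_span]
  apply Submodule.span_mono
  rintro _ ⟨j, rfl⟩
  exact ⟨Fin.castLE h j, rfl⟩

theorem mapsOnto_fstProj_vandermondeFrame {b : ℕ} {v : Fin n → K} (hv : Function.Injective v)
    (σ : Fin r ⊕ Fin b ≃ Fin n) :
    MapsOnto (fstProj K σ) (LinearMap.range (Matrix.toLin' (vandermondeFrame v r))) := by
  rw [mapsOnto_range_iff, fstProj_mul]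
  exact isUnit_det_vandermondeFrame (hv.comp (σ.injective.comp Sum.inl_injective))

theorem exists_mul_vandermondeFrame_eq_one {v : Fin n → K} (hv : Function.Injective v)
    (h : r ≤ n) : ∃ L : Matrix (Fin r) (Fin n) K, L * vandermondeFrame v r = 1 := by
  let σ : Fin r ⊕ Fin (n - r) ≃ Fin n :=
    finSumFinEquiv.trans (finCongr (Nat.add_sub_of_le h))
  have hdet := (mapsOnto_range_iff _ _).1 (mapsOnto_fstProj_vandermondeFrame hv σ)
  exact ⟨(fstProj K σ * vandermondeFrame v r)⁻¹ * fstProj K σ, by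
    rw [Matrix.mul_assoc, Matrix.nonsing_inv_mul _ hdet]⟩

variable (K) in
theorem exists_forall_eq_incidencePoint [Infinite K] (d₁ : ℕ) {d₂ d₃ r₁ m r₂ b c e : ℕ}
    (hd₂ : d₂ = r₂ + b) (hr₂ : r₂ = r₁ + m) (hd₃ : d₃ = c + e) :
    ∃ P : IncidencePoint K d₁ d₂ d₃ r₁ r₂ c, ∀ w : ChartIndex d₂ d₃ r₁ m r₂ b c e,
      ∃ x, w.incidencePoint x = P := by
  have nodes_injective (n : ℕ) :
      Function.Injective fun i : Fin n => Infinite.natEmbedding K i :=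
    (Infinite.natEmbedding K).injective.comp Fin.val_injective
  obtain ⟨L₁, h₁⟩ := exists_mul_vandermondeFrame_eq_one (r := r₁) (nodes_injective d₂) (by omega)
  obtain ⟨L₂, h₂⟩ := exists_mul_vandermondeFrame_eq_one (r := r₂) (nodes_injective d₂) (by omega)
  obtain ⟨L₃, h₃⟩ := exists_mul_vandermondeFrame_eq_one (r := c) (nodes_injective d₃) (by omega)
  refine ⟨⟨⟨0, 0⟩, ⟨Gr.ofLeftInverse _ _ h₁, Gr.ofLeftInverse _ _ h₂,
    range_vandermondeFrame_mono _ (by omega)⟩, Gr.ofLeftInverse _ _ h₃, ?_, ?_⟩, fun w => ?_⟩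
  · rw [map_zero, LinearMap.range_zero]
    exact bot_le
  · rw [map_zero, Submodule.map_zero]
    exact bot_le
  · refine w.exists_incidencePoint_eq _ ((mapsOnto_range_iff _ _).2 ?_)
      (mapsOnto_fstProj_vandermondeFrame (nodes_injective d₂) w.σ)
      (mapsOnto_fstProj_vandermondeFrame (nodes_injective d₃) w.τ)
    rw [ChartIndex.proj₁, Matrix.mul_assoc, fstProj_mul, fstProj_mul]
    exact isUnit_det_vandermondeFrame ((nodes_injective d₂).comp
      ((w.σ.injective.comp Sum.inl_injective).comp (w.ρ.injective.comp Sum.inl_injective)))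

end Vandermonde

theorem irreducibleSpace_of_cover {X ι : Type*} [TopologicalSpace X] {U : ι → Set X}
    (hU : ∀ i, IsOpen (U i)) (hirr : ∀ i, IsPreirreducible (U i)) (hcov : ∀ x, ∃ i, x ∈ U i)
    {x₀ : X} (hx₀ : ∀ i, x₀ ∈ U i) : IrreducibleSpace X where
  toNonempty := ⟨x₀⟩
  isPreirreducible_univ := by
    rintro S T hS hT ⟨x, -, hx⟩ ⟨y, -, hy⟩
    obtain ⟨i, hi⟩ := hcov x
    obtain ⟨j, hj⟩ := hcov y
    obtain ⟨z, -, hzS, hzj⟩ := hirr i S (U j) hS (hU j) ⟨x, hi, hx⟩ ⟨x₀, hx₀ i, hx₀ j⟩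
    obtain ⟨t, -, htS, htT⟩ := hirr j S T hS hT ⟨z, hzj, hzS⟩ ⟨y, hj, hy⟩
    exact ⟨t, Set.mem_univ _, htS, htT⟩

section Scheme

variable (k : Type u) [Field k] (d₁ : ℕ) {d₂ d₃ r₁ m r₂ b c e : ℕ} (hd₂ : d₂ = r₂ + b)
  (hr₂ : r₂ = r₁ + m) (hd₃ : d₃ = c + e)

/-- The incidence variety, glued from its charts. -/
def incidenceScheme : Scheme.{u} :=
  (incidenceAtlas k d₁ hd₂ hr₂ hd₃).scheme

/-- The incidence variety represents the functor of incidence points. -/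
def incidenceSchemeIso :
    affinePoints (incidenceScheme k d₁ hd₂ hr₂ hd₃) ≅ incidenceFunctor k d₁ d₂ d₃ r₁ r₂ c :=
  ((incidenceAtlas k d₁ hd₂ hr₂ hd₃).exists_natIso_affinePoints
    isZariskiSheaf_incidenceFunctor).choose

/-- The inclusion of a chart into the incidence variety. -/
def incidenceChart (w : ChartIndex d₂ d₃ r₁ m r₂ b c e) :
    Spec (.of (MvPolynomial (ChartCoord d₁ d₃ r₁ m r₂ b c e) k)) ⟶
      incidenceScheme k d₁ hd₂ hr₂ hd₃ :=
  (incidenceAtlas k d₁ hd₂ hr₂ hd₃).chartι ⟨w⟩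

instance (w : ChartIndex d₂ d₃ r₁ m r₂ b c e) :
    IsOpenImmersion (incidenceChart k d₁ hd₂ hr₂ hd₃ w) :=
  (incidenceAtlas k d₁ hd₂ hr₂ hd₃).isOpenImmersion_chartι ⟨w⟩

theorem incidencePoints_incidenceChart (w : ChartIndex d₂ d₃ r₁ m r₂ b c e) :
    incidencePoints (incidenceSchemeIso k d₁ hd₂ hr₂ hd₃) _ (incidenceChart k d₁ hd₂ hr₂ hd₃ w) =
      w.genericPoint k d₁ :=
  ((incidenceAtlas k d₁ hd₂ hr₂ hd₃).exists_natIso_affinePoints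
    isZariskiSheaf_incidenceFunctor).choose_spec ⟨w⟩

/-- The cover of the incidence variety by its charts. -/
def incidenceOpenCover : (incidenceScheme k d₁ hd₂ hr₂ hd₃).OpenCover :=
  (incidenceAtlas k d₁ hd₂ hr₂ hd₃).glueData.openCover

theorem incidenceChart_comp_toBase (w : ChartIndex d₂ d₃ r₁ m r₂ b c e) :
    incidenceChart k d₁ hd₂ hr₂ hd₃ w ≫ toBase (incidenceSchemeIso k d₁ hd₂ hr₂ hd₃) =
      Spec.map (CommRingCat.ofHom MvPolynomial.C) := by
  rw [comp_toBase, incidencePoints_incidenceChart]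
  rfl

instance smooth_toBase : Smooth (toBase (incidenceSchemeIso k d₁ hd₂ hr₂ hd₃)) := by
  have : IsZariskiLocalAtSource @Smooth.{u} :=
    HasRingHomProperty.instIsZariskiLocalAtSource (P := @Smooth)
  refine (IsZariskiLocalAtSource.iff_of_openCover (P := @Smooth)
    (incidenceOpenCover k d₁ hd₂ hr₂ hd₃)).2 fun w => ?_
  change Smooth (incidenceChart k d₁ hd₂ hr₂ hd₃ w.down ≫ _)
  rw [incidenceChart_comp_toBase, HasRingHomProperty.Spec_iff (P := @Smooth)]
  exact RingHom.smooth_algebraMap.2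
    (⟨inferInstance, inferInstance⟩ :
      Algebra.Smooth k (MvPolynomial (ChartCoord d₁ d₃ r₁ m r₂ b c e) k))

instance compactSpace_incidenceScheme : CompactSpace (incidenceScheme k d₁ hd₂ hr₂ hd₃) := by
  have : Finite (incidenceOpenCover k d₁ hd₂ hr₂ hd₃).I₀ :=
    inferInstanceAs (Finite (ULift.{u} (ChartIndex d₂ d₃ r₁ m r₂ b c e)))
  have inst (i : (incidenceOpenCover k d₁ hd₂ hr₂ hd₃).I₀) :
      CompactSpace ((incidenceOpenCover k d₁ hd₂ hr₂ hd₃).X i) :=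
    inferInstanceAs (CompactSpace (Spec (.of
      (MvPolynomial (ChartCoord d₁ d₃ r₁ m r₂ b c e) k))))
  exact (incidenceOpenCover k d₁ hd₂ hr₂ hd₃).compactSpace

instance isReduced_incidenceScheme : IsReduced (incidenceScheme k d₁ hd₂ hr₂ hd₃) := by
  have inst (i : (incidenceOpenCover k d₁ hd₂ hr₂ hd₃).I₀) :
      IsReduced ((incidenceOpenCover k d₁ hd₂ hr₂ hd₃).X i) :=
    inferInstanceAs (IsReduced (Spec (.of
      (MvPolynomial (ChartCoord d₁ d₃ r₁ m r₂ b c e) k))))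
  exact IsReduced.of_openCover _ (incidenceOpenCover k d₁ hd₂ hr₂ hd₃)

theorem isPreirreducible_range_incidenceChart (w : ChartIndex d₂ d₃ r₁ m r₂ b c e) :
    IsPreirreducible (Set.range (incidenceChart k d₁ hd₂ hr₂ hd₃ w)) := by
  have : IrreducibleSpace (PrimeSpectrum (MvPolynomial (ChartCoord d₁ d₃ r₁ m r₂ b c e) k)) :=
    inferInstance
  rw [← Set.image_univ]
  exact this.isPreirreducible_univ.image _
    (incidenceChart k d₁ hd₂ hr₂ hd₃ w).continuous.continuousOn

theorem exists_forall_mem_range_incidenceChart :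
    ∃ z, ∀ w : ChartIndex d₂ d₃ r₁ m r₂ b c e,
      z ∈ Set.range (incidenceChart k d₁ hd₂ hr₂ hd₃ w) := by
  let K := AlgebraicClosure k
  let η := incidenceSchemeIso k d₁ hd₂ hr₂ hd₃
  obtain ⟨P, hP⟩ := exists_forall_eq_incidencePoint K d₁ hd₂ hr₂ hd₃
  let x := (incidencePoints η (.of K)).symm (algebraMap k K, P)
  let pt : Spec (.of K) := (⊥ : PrimeSpectrum K)
  refine ⟨x pt, fun w => ?_⟩
  obtain ⟨h, hh⟩ := (w.exists_map_genericPoint_eq_iff (A := .of K) (algebraMap k K, P)).2 (hP w)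
  have factor : x = Spec.map h ≫ incidenceChart k d₁ hd₂ hr₂ hd₃ w :=
    (Equiv.symm_apply_eq _).2 <| by
      rw [incidencePoints_comp, incidencePoints_incidenceChart]
      exact hh.symm
  exact ⟨Spec.map h pt, by rw [factor, Scheme.Hom.comp_apply]⟩

instance isIntegral_incidenceScheme : IsIntegral (incidenceScheme k d₁ hd₂ hr₂ hd₃) := by
  obtain ⟨z, hz⟩ := exists_forall_mem_range_incidenceChart k d₁ hd₂ hr₂ hd₃
  have : IrreducibleSpace (incidenceScheme k d₁ hd₂ hr₂ hd₃) :=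
    irreducibleSpace_of_cover
      (fun w => (incidenceChart k d₁ hd₂ hr₂ hd₃ w).isOpenEmbedding.isOpen_range)
      (isPreirreducible_range_incidenceChart k d₁ hd₂ hr₂ hd₃)
      (fun y => by
        obtain ⟨⟨w⟩, y', hy⟩ := (incidenceAtlas k d₁ hd₂ hr₂ hd₃).exists_chartι_eq y
        exact ⟨w, y', hy⟩) hz
  exact isIntegral_of_irreducibleSpace_of_isReduced _

end Scheme

/-! ### Properness -/

section Contract

open TensorProduct

variable {R K : Type u} [CommRing R] [CommRing K] [Algebra R K] {n : ℕ}

variable (R) in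
/-- The submodule of the vectors over `R` whose image over `K` lies in `N`. -/
def contractSub (N : Submodule K (Fin n → K)) : Submodule R (Fin n → R) :=
  (N.restrictScalars R).comap ((Algebra.linearMap R K).compLeft (Fin n))

theorem extendSub_contractSub (M : Submonoid R) [IsLocalization M K]
    (N : Submodule K (Fin n → K)) : extendSub (algebraMap R K) (contractSub R N) = N := by
  rw [extendSub_algebraMap_eq_localized' M]
  exact (Submodule.localized'gi K M _).l_u_eq N

theorem quotientExtendSubEquiv_mk (N : Submodule R (Fin n → R)) (v : Fin n → R) :
    quotientExtendSubEquiv (B := K) N (Submodule.Quotient.mk (algebraMap R K ∘ v)) =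
      1 ⊗ₜ Submodule.Quotient.mk v := by
  have h : (TensorProduct.piScalarRight R K K (Fin n)).symm (algebraMap R K ∘ v) = 1 ⊗ₜ v :=
    (LinearEquiv.symm_apply_eq _).2 <| funext fun i =>
      Algebra.algebraMap_eq_smul_one (v i)
  change (AlgebraTensorModule.tensorQuotientEquiv K R K N).symm (Submodule.Quotient.mk
    ((TensorProduct.piScalarRight R K K (Fin n)).symm (algebraMap R K ∘ v))) = _
  rw [h]
  rfl

theorem contractSub_extendSub [FaithfulSMul R K] (N : Submodule R (Fin n → R))
    [Module.Flat R ((Fin n → R) ⧸ N)] : contractSub R (extendSub (algebraMap R K) N) = N := by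
  refine le_antisymm (fun v hv => ?_) fun v => comp_mem_extendSub (algebraMap R K)
  rw [← Submodule.Quotient.mk_eq_zero]
  apply Module.Flat.tensorProduct_mk_injective (R := R) (S := K) (M := (Fin n → R) ⧸ N)
  have mk_eq_zero : Submodule.Quotient.mk (algebraMap R K ∘ v) =
      (0 : (Fin n → K) ⧸ extendSub (algebraMap R K) N) := (Submodule.Quotient.mk_eq_zero _).2 hv
  rw [TensorProduct.mk_apply, ← quotientExtendSubEquiv_mk, mk_eq_zero, map_zero, map_zero]

theorem eq_of_extendSub_eq_of_injective {A B : Type u} [CommRing A] [CommRing B] {f : A →+* B}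
    (hf : Function.Injective f) {N M : Submodule A (Fin n → A)}
    [Module.Projective A ((Fin n → A) ⧸ N)] [Module.Projective A ((Fin n → A) ⧸ M)]
    (h : extendSub f N = extendSub f M) : N = M := by
  algebraize [f]
  have : FaithfulSMul A B := (faithfulSMul_iff_algebraMap_injective A B).2 hf
  rw [← contractSub_extendSub (K := B) N, ← contractSub_extendSub (K := B) M]
  exact congrArg (contractSub A) h

end Contract

section ValuationRing

variable {R K : Type u} [CommRing R] [IsDomain R] [ValuationRing R] [Field K] [Algebra R K]
  {n r : ℕ}

theorem projective_quotient_contractSub [FaithfulSMul R K] (N : Submodule K (Fin n → K)) :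
    Module.Projective R ((Fin n → R) ⧸ contractSub R N) := by
  let ι : ((Fin n → R) ⧸ contractSub R N) →ₗ[R] (Fin n → K) ⧸ N.restrictScalars R :=
    Submodule.mapQ _ _ ((Algebra.linearMap R K).compLeft (Fin n)) le_rfl
  have ι_injective : Function.Injective ι :=
    LinearMap.ker_eq_bot.1 ((Submodule.ker_mapQ ..).trans (Submodule.mkQ_map_self _))
  have : Module.IsTorsionFree R ((Fin n → K) ⧸ N.restrictScalars R) :=
    .trans_faithfulSMul R K ((Fin n → K) ⧸ N)
  have torsionFree := ι_injective.moduleIsTorsionFree ι (map_smul ι)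
  rw [Submodule.isTorsionFree_iff_torsion_eq_bot,
    ← Module.Flat.flat_iff_torsion_eq_bot_of_isBezout] at torsionFree
  have : Module.Free R ((Fin n → R) ⧸ contractSub R N) := Module.free_of_flat_of_isLocalRing
  infer_instance

variable [IsFractionRing R K]

variable (R) in
/-- The extension of a point of the Grassmannian from the field of fractions of a valuation
ring. -/
def Gr.contract (N : Gr K r n) : Gr R r n where
  sub := contractSub R N.sub
  projective_quotient := projective_quotient_contractSub N.sub
  rank_eq p := by
    have := projective_quotient_contractSub (R := R) N.sub
    have := projective_of_projective_quotient (contractSub R N.sub)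
    have := finite_of_projective_quotient (contractSub R N.sub)
    have comap_le : PrimeSpectrum.comap (algebraMap R K) ⊥ ≤ p := fun x hx =>
      ((FaithfulSMul.algebraMap_eq_zero_iff R K).1 hx).symm ▸ p.asIdeal.zero_mem
    rw [← Module.rankAtStalk_eq_of_le_of_finite_of_flat _ comap_le, ← rankAtStalk_extendSub,
      extendSub_contractSub (nonZeroDivisors R), N.rank_eq]

theorem Gr.map_contract (N : Gr K r n) : (N.contract R).map (algebraMap R K) = N :=
  Gr.ext (extendSub_contractSub (nonZeroDivisors R) N.sub)

theorem IncidencePoint.exists_map_eq_of_isFractionRing {d₁ d₂ d₃ r₁ r₂ c : ℕ}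
    (P : IncidencePoint K d₁ d₂ d₃ r₁ r₂ c) {W : RepSpace R d₁ d₂ d₃}
    (hW : W.map (algebraMap R K) = P.V) :
    ∃ Q : IncidencePoint R d₁ d₂ d₃ r₁ r₂ c, Q.V = W ∧ Q.map (algebraMap R K) = P := by
  have hα : W.α.map (algebraMap R K) = P.V.α := congrArg RepSpace.α hW
  have hβ : W.β.map (algebraMap R K) = P.V.β := congrArg RepSpace.β hW
  have range_le : LinearMap.range (Matrix.toLin' W.α) ≤ (P.F.R₁.contract R).sub := by
    rintro _ ⟨v, rfl⟩
    change algebraMap R K ∘ _ ∈ P.F.R₁.sub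
    rw [← toLin'_map_comp, hα]
    exact P.range_le ⟨_, rfl⟩
  have map_le : (P.F.R₂.contract R).sub.map (Matrix.toLin' W.β) ≤ (P.R.contract R).sub := by
    rintro _ ⟨v, hv, rfl⟩
    change algebraMap R K ∘ _ ∈ P.R.sub
    rw [← toLin'_map_comp, hβ]
    exact P.map_le ⟨_, hv, rfl⟩
  exact ⟨⟨W, ⟨P.F.R₁.contract R, P.F.R₂.contract R, fun v hv => P.F.le hv⟩, P.R.contract R,
    range_le, map_le⟩, rfl, IncidencePoint.ext hW
      (Flag.ext (Gr.map_contract _) (Gr.map_contract _)) (Gr.map_contract _)⟩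

end ValuationRing

theorem IncidencePoint.map_injective {A B : Type u} [CommRing A] [CommRing B] {f : A →+* B}
    (hf : Function.Injective f) {d₁ d₂ d₃ r₁ r₂ c : ℕ} :
    Function.Injective (map f : IncidencePoint A d₁ d₂ d₃ r₁ r₂ c → IncidencePoint B _ _ _ _ _ _) :=
  fun _ _ h => ext_of_eq
    (RepSpace.ext (Matrix.map_injective hf (congrArg (fun P => P.V.α) h))
      (Matrix.map_injective hf (congrArg (fun P => P.V.β) h)))
    (eq_of_extendSub_eq_of_injective hf (congrArg (fun P => P.F.R₁.sub) h))
    (eq_of_extendSub_eq_of_injective hf (congrArg (fun P => P.F.R₂.sub) h))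
    (eq_of_extendSub_eq_of_injective hf (congrArg (fun P => P.R.sub) h))

section Proper

variable {k : Type u} [Field k] {d₁ d₂ d₃ r₁ r₂ c : ℕ} {Z : Scheme.{u}}
  (η : affinePoints Z ≅ incidenceFunctor k d₁ d₂ d₃ r₁ r₂ c)

theorem existence_toRep : ValuativeCriterion.Existence (toRep η) := by
  rintro ⟨R, K, x, y, ⟨hsq⟩⟩
  let f : CommRingCat.of R ⟶ CommRingCat.of K := CommRingCat.ofHom (algebraMap R K)
  change x ≫ toRep η = Spec.map f ≫ y at hsq
  obtain ⟨⟨κ, W⟩, rfl⟩ := (repPoints k d₁ d₂ d₃ (.of R)).symm.surjective y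
  rw [comp_toRep, specMap_comp_repPoints_symm] at hsq
  obtain ⟨hκ, hW⟩ := Prod.ext_iff.1 ((repPoints k d₁ d₂ d₃ (.of K)).symm.injective hsq)
  obtain ⟨Q, rfl, hQ⟩ := (incidencePoints η (.of K) x).2.exists_map_eq_of_isFractionRing hW.symm
  refine ⟨⟨(incidencePoints η (.of R)).symm (κ, Q), ?_, ?_⟩⟩
  · refine (incidencePoints η (.of K)).injective ((incidencePoints_comp η f _).trans ?_)
    rw [Equiv.apply_symm_apply]
    exact Prod.ext hκ.symm hQ
  · rw [comp_toRep, Equiv.apply_symm_apply]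

theorem uniqueness_toRep : ValuativeCriterion.Uniqueness (toRep η) := by
  rintro ⟨R, K, x, y, hsq⟩
  refine ⟨fun ⟨l, hl, _⟩ ⟨l', hl', _⟩ => ?_⟩
  let f : CommRingCat.of R ⟶ CommRingCat.of K := CommRingCat.ofHom (algebraMap R K)
  have hf : Function.Injective f.hom := IsFractionRing.injective R K
  have h : Spec.map f ≫ l = Spec.map f ≫ l' := hl.trans hl'.symm
  replace h := congrArg (incidencePoints η (.of K)) h
  rw [incidencePoints_comp, incidencePoints_comp] at h
  obtain ⟨hκ, hP⟩ := Prod.ext_iff.1 h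
  obtain rfl : l = l' := (incidencePoints η (.of R)).injective <|
    Prod.ext (RingHom.cancel_left hf |>.1 hκ) (IncidencePoint.map_injective hf hP)
  rfl

theorem isProper_toRep [CompactSpace Z] [LocallyOfFiniteType (toBase η)] :
    IsProper (toRep η) := by
  have : LocallyOfFiniteType (toRep η ≫ repBase k d₁ d₂ d₃) :=
    inferInstanceAs (LocallyOfFiniteType (toBase η))
  have : LocallyOfFiniteType (toRep η) := locallyOfFiniteType_of_comp _ (repBase k d₁ d₂ d₃)
  have : IsLocallyNoetherian Z := LocallyOfFiniteType.isLocallyNoetherian (toBase η)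
  have : QuasiSeparatedSpace (repScheme k d₁ d₂ d₃) :=
    inferInstanceAs (QuasiSeparatedSpace (Spec _))
  exact IsProper.of_valuativeCriterion _ (ValuativeCriterion.iff.2
    ⟨existence_toRep η, uniqueness_toRep η⟩)

end Proper

/-! ### Ranks and the isomorphism type of a representation -/

section LinearMap

variable {k E F E' F' G : Type*} [Field k] [AddCommGroup E] [Module k E] [AddCommGroup F]
  [Module k F] [AddCommGroup E'] [Module k E'] [AddCommGroup F'] [Module k F'] [AddCommGroup G]
  [Module k G]

theorem finrank_map_add_finrank_inf_ker [FiniteDimensional k E] (f : E →ₗ[k] F)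
    (p : Submodule k E) : Module.finrank k (p.map f) + Module.finrank k ↥(p ⊓ LinearMap.ker f) =
      Module.finrank k p := by
  rw [← LinearMap.finrank_range_add_finrank_ker (f.domRestrict p), LinearMap.range_domRestrict,
    LinearMap.ker_domRestrict, ← Submodule.finrank_map_subtype_eq p, Submodule.map_comap_subtype]

theorem exists_linearMap_injective_comp [FiniteDimensional k E] (f : E →ₗ[k] F)
    (p : Submodule k E) {r : ℕ}
    (h : Module.finrank k p = Module.finrank k ↥(p ⊓ LinearMap.ker f) + r) :
    ∃ y : (Fin r → k) →ₗ[k] E, (∀ v, y v ∈ p) ∧ ∀ v, f (y v) = 0 → v = 0 := by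
  let g := (f.domRestrict p).rangeRestrict
  have finrank_range : Module.finrank k (Fin r → k) =
      Module.finrank k (LinearMap.range (f.domRestrict p)) := by
    have := finrank_map_add_finrank_inf_ker f p
    rw [LinearMap.range_domRestrict, Module.finrank_fin_fun]
    omega
  let e := LinearEquiv.ofFinrankEq _ _ finrank_range
  obtain ⟨s, hs⟩ := g.exists_rightInverse_of_surjective (f.domRestrict p).range_rangeRestrict
  refine ⟨p.subtype ∘ₗ s ∘ₗ e.toLinearMap, fun v => (s (e v)).2, fun v hv => ?_⟩
  have hgs : g (s (e v)) = e v := LinearMap.congr_fun hs (e v)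
  exact e.map_eq_zero_iff.1 (hgs.symm.trans (Subtype.ext hv))

theorem finrank_range_eq_of_comp_eq {f : E →ₗ[k] F} {g : E' →ₗ[k] F'} (e : E ≃ₗ[k] E')
    (e' : F ≃ₗ[k] F') (h : ∀ x, e' (f x) = g (e x)) :
    Module.finrank k (LinearMap.range f) = Module.finrank k (LinearMap.range g) := by
  have hcomp : e'.toLinearMap ∘ₗ f = g ∘ₗ e.toLinearMap := LinearMap.ext h
  rw [← LinearMap.range_comp_of_range_eq_top g e.range, ← hcomp, LinearMap.range_comp]
  exact (LinearEquiv.finrank_map_eq e' _).symm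

theorem finrank_range_eq_of_factors {f : E →ₗ[k] F} (p : E →ₗ[k] G) (g : G →ₗ[k] F)
    (hp : Function.Surjective p) (hg : Function.Injective g) (h : ∀ x, f x = g (p x)) :
    Module.finrank k (LinearMap.range f) = Module.finrank k G := by
  obtain rfl : f = g ∘ₗ p := LinearMap.ext h
  rw [LinearMap.range_comp_of_range_eq_top g (LinearMap.range_eq_top.2 hp),
    LinearMap.finrank_range_of_inj hg]

end LinearMap

section Ranks

variable {k E₁ E₂ E₃ F₁ F₂ F₃ : Type*} [Field k] [AddCommGroup E₁] [Module k E₁]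
  [AddCommGroup E₂] [Module k E₂] [AddCommGroup E₃] [Module k E₃] [AddCommGroup F₁] [Module k F₁]
  [AddCommGroup F₂] [Module k F₂] [AddCommGroup F₃] [Module k F₃] {a₁ a₂ a₃ b₁ b₂ c : ℕ}
  {α : E₁ →ₗ[k] E₂} {β : E₂ →ₗ[k] E₃}

/-- The ranks of the maps of a representation `α, β` isomorphic to
`S₁^a₁ ⊕ S₂^a₂ ⊕ S₃^a₃ ⊕ I₂^b₁ ⊕ P₂^b₂ ⊕ I₃^c`. -/
structure HasRanks (b₁ b₂ c : ℕ) (α : E₁ →ₗ[k] E₂) (β : E₂ →ₗ[k] E₃) : Prop where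
  finrank_range_fst : Module.finrank k (LinearMap.range α) = b₁ + c
  finrank_range_snd : Module.finrank k (LinearMap.range β) = b₂ + c
  finrank_range_comp : Module.finrank k (LinearMap.range (β ∘ₗ α)) = c

theorem HasRanks.congr {α' : F₁ →ₗ[k] F₂} {β' : F₂ →ₗ[k] F₃} (h : HasRanks b₁ b₂ c α β)
    (e₁ : E₁ ≃ₗ[k] F₁) (e₂ : E₂ ≃ₗ[k] F₂) (e₃ : E₃ ≃ₗ[k] F₃) (hα : ∀ x, e₂ (α x) = α' (e₁ x))
    (hβ : ∀ y, e₃ (β y) = β' (e₂ y)) : HasRanks b₁ b₂ c α' β' where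
  finrank_range_fst := finrank_range_eq_of_comp_eq e₁ e₂ hα ▸ h.finrank_range_fst
  finrank_range_snd := finrank_range_eq_of_comp_eq e₂ e₃ hβ ▸ h.finrank_range_snd
  finrank_range_comp :=
    finrank_range_eq_of_comp_eq (f := β ∘ₗ α) (g := β' ∘ₗ α') e₁ e₃
      (fun x => (hβ (α x)).trans (congrArg β' (hα x))) ▸ h.finrank_range_comp

theorem finrank_comap_range_comp_add [FiniteDimensional k E₂] (α : E₁ →ₗ[k] E₂)
    (β : E₂ →ₗ[k] E₃) : Module.finrank k ((LinearMap.range (β ∘ₗ α)).comap β) +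
      Module.finrank k (LinearMap.range β) =
        Module.finrank k E₂ + Module.finrank k (LinearMap.range (β ∘ₗ α)) := by
  have finrank_comap := finrank_map_add_finrank_inf_ker β ((LinearMap.range (β ∘ₗ α)).comap β)
  rw [Submodule.map_comap_eq, inf_eq_right.2 (LinearMap.range_comp_le_range _ _),
    inf_eq_right.2 (LinearMap.ker_le_comap _)] at finrank_comap
  have rank_nullity := LinearMap.finrank_range_add_finrank_ker β
  omega

theorem HasRanks.finrank_comap_range_comp [FiniteDimensional k E₂] (h : HasRanks b₁ b₂ c α β) :
    Module.finrank k ((LinearMap.range (β ∘ₗ α)).comap β) + b₂ = Module.finrank k E₂ := by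
  have := finrank_comap_range_comp_add α β
  rw [h.finrank_range_snd, h.finrank_range_comp] at this
  omega

/-- Generators of the indecomposable summands `S₁^a₁`, `I₂^b₁`, `I₃^c` (at the vertex `1`),
`S₂^a₂`, `P₂^b₂` (at the vertex `2`) and `S₃^a₃` (at the vertex `3`) of the representation
`α, β`, with the relations they satisfy. -/
structure SummandGenerators (a₁ a₂ a₃ b₁ b₂ c : ℕ) (α : E₁ →ₗ[k] E₂) (β : E₂ →ₗ[k] E₃) where
  s₁ : (Fin a₁ → k) →ₗ[k] E₁
  i₂ : (Fin b₁ → k) →ₗ[k] E₁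
  i₃ : (Fin c → k) →ₗ[k] E₁
  s₂ : (Fin a₂ → k) →ₗ[k] E₂
  p₂ : (Fin b₂ → k) →ₗ[k] E₂
  s₃ : (Fin a₃ → k) →ₗ[k] E₃
  α_s₁ (v) : α (s₁ v) = 0
  β_α_i₂ (v) : β (α (i₂ v)) = 0
  β_s₂ (v) : β (s₂ v) = 0
  eq_zero_of_s₁ (v) : s₁ v = 0 → v = 0
  eq_zero_of_i₂ (v) : α (i₂ v) = 0 → v = 0
  eq_zero_of_i₃ (v) : β (α (i₃ v)) = 0 → v = 0
  eq_zero_of_s₂ (v) : s₂ v ∈ LinearMap.range α → v = 0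
  eq_zero_of_p₂ (v) : β (p₂ v) ∈ LinearMap.range (β ∘ₗ α) → v = 0
  eq_zero_of_s₃ (v) : s₃ v ∈ LinearMap.range β → v = 0

theorem HasRanks.nonempty_summandGenerators [FiniteDimensional k E₁] [FiniteDimensional k E₂]
    [FiniteDimensional k E₃] (h : HasRanks b₁ b₂ c α β)
    (h₁ : Module.finrank k E₁ = a₁ + b₁ + c) (h₂ : Module.finrank k E₂ = a₂ + b₁ + b₂ + c)
    (h₃ : Module.finrank k E₃ = a₃ + b₂ + c) :
    Nonempty (SummandGenerators a₁ a₂ a₃ b₁ b₂ c α β) := by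
  obtain ⟨rank_α, rank_β, rank_βα⟩ := id h
  have comap_βα := h.finrank_comap_range_comp
  have ker_α := LinearMap.finrank_range_add_finrank_ker α
  have ker_β := LinearMap.finrank_range_add_finrank_ker β
  have ker_βα := LinearMap.finrank_range_add_finrank_ker (β ∘ₗ α)
  have map_range_α := finrank_map_add_finrank_inf_ker β (LinearMap.range α)
  rw [← LinearMap.range_comp] at map_range_α
  obtain ⟨s₁, s₁_mem, hs₁⟩ := exists_linearMap_injective_comp (r := a₁) .id (LinearMap.ker α)
    (by rw [LinearMap.ker_id, inf_bot_eq, finrank_bot]; omega)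
  obtain ⟨i₂, i₂_mem, hi₂⟩ := exists_linearMap_injective_comp (r := b₁) α
    (LinearMap.ker (β ∘ₗ α)) (by rw [inf_eq_right.2 (LinearMap.ker_le_ker_comp _ _)]; omega)
  obtain ⟨i₃, -, hi₃⟩ := exists_linearMap_injective_comp (r := c) (β ∘ₗ α) ⊤
    (by rw [top_inf_eq, finrank_top]; omega)
  obtain ⟨s₂, s₂_mem, hs₂⟩ := exists_linearMap_injective_comp (r := a₂) (LinearMap.range α).mkQ
    (LinearMap.ker β) (by rw [Submodule.ker_mkQ, inf_comm]; omega)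
  obtain ⟨p₂, -, hp₂⟩ := exists_linearMap_injective_comp (r := b₂)
    ((LinearMap.range (β ∘ₗ α)).mkQ ∘ₗ β) ⊤
    (by rw [top_inf_eq, finrank_top, LinearMap.ker_comp, Submodule.ker_mkQ]; omega)
  obtain ⟨s₃, -, hs₃⟩ := exists_linearMap_injective_comp (r := a₃) (LinearMap.range β).mkQ ⊤
    (by rw [top_inf_eq, finrank_top, Submodule.ker_mkQ]; omega)
  exact ⟨⟨s₁, i₂, i₃, s₂, p₂, s₃, s₁_mem, i₂_mem, s₂_mem, hs₁, hi₂, hi₃,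
    fun v hv => hs₂ v ((Submodule.Quotient.mk_eq_zero _).2 hv),
    fun v hv => hp₂ v ((Submodule.Quotient.mk_eq_zero _).2 hv),
    fun v hv => hs₃ v ((Submodule.Quotient.mk_eq_zero _).2 hv)⟩⟩

namespace SummandGenerators

variable (g : SummandGenerators a₁ a₂ a₃ b₁ b₂ c α β)

/-- The space at the vertex `1` in terms of generators. -/
def map₁ : ((Fin a₁ → k) × (Fin b₁ → k) × (Fin c → k)) →ₗ[k] E₁ :=
  g.s₁.coprod (g.i₂.coprod g.i₃)

/-- The space at the vertex `2` in terms of generators. -/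
def map₂ : ((Fin a₂ → k) × (Fin b₁ → k) × (Fin b₂ → k) × (Fin c → k)) →ₗ[k] E₂ :=
  g.s₂.coprod ((α ∘ₗ g.i₂).coprod (g.p₂.coprod (α ∘ₗ g.i₃)))

/-- The space at the vertex `3` in terms of generators. -/
def map₃ : ((Fin a₃ → k) × (Fin b₂ → k) × (Fin c → k)) →ₗ[k] E₃ :=
  g.s₃.coprod ((β ∘ₗ g.p₂).coprod (β ∘ₗ α ∘ₗ g.i₃))

theorem map₁_injective : Function.Injective g.map₁ := by
  rw [injective_iff_map_eq_zero]
  rintro ⟨u, x, y⟩ h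
  change g.s₁ u + (g.i₂ x + g.i₃ y) = 0 at h
  have hα : α (g.i₂ x) + α (g.i₃ y) = 0 := by simpa [g.α_s₁] using congrArg α h
  obtain rfl : y = 0 := g.eq_zero_of_i₃ y (by simpa [g.β_α_i₂] using congrArg β hα)
  obtain rfl : x = 0 := g.eq_zero_of_i₂ x (by simpa using hα)
  obtain rfl : u = 0 := g.eq_zero_of_s₁ u (by simpa using h)
  rfl

theorem eq_zero_of_add_eq_zero {t : Fin b₂ → k} {y : Fin c → k}
    (h : β (g.p₂ t) + β (α (g.i₃ y)) = 0) : t = 0 ∧ y = 0 := by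
  obtain rfl : t = 0 := g.eq_zero_of_p₂ t
    ⟨-g.i₃ y, by simpa using (eq_neg_of_add_eq_zero_left h).symm⟩
  exact ⟨rfl, g.eq_zero_of_i₃ y (by simpa using h)⟩

theorem map₂_injective : Function.Injective g.map₂ := by
  rw [injective_iff_map_eq_zero]
  rintro ⟨s, x, t, y⟩ h
  change g.s₂ s + (α (g.i₂ x) + (g.p₂ t + α (g.i₃ y))) = 0 at h
  obtain ⟨rfl, rfl⟩ : t = 0 ∧ y = 0 :=
    g.eq_zero_of_add_eq_zero (by simpa [g.β_s₂, g.β_α_i₂] using congrArg β h)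
  simp only [map_zero, add_zero] at h
  obtain rfl : s = 0 := g.eq_zero_of_s₂ s
    ⟨-g.i₂ x, by simpa using (eq_neg_of_add_eq_zero_left h).symm⟩
  obtain rfl : x = 0 := g.eq_zero_of_i₂ x (by simpa using h)
  rfl

theorem map₃_injective : Function.Injective g.map₃ := by
  rw [injective_iff_map_eq_zero]
  rintro ⟨z, t, y⟩ h
  change g.s₃ z + (β (g.p₂ t) + β (α (g.i₃ y))) = 0 at h
  obtain rfl : z = 0 := g.eq_zero_of_s₃ z ⟨-(g.p₂ t + α (g.i₃ y)), by
    simpa using (eq_neg_of_add_eq_zero_left h).symm⟩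
  obtain ⟨rfl, rfl⟩ : t = 0 ∧ y = 0 := g.eq_zero_of_add_eq_zero (by simpa using h)
  rfl

theorem map₂_apply (z : (Fin a₁ → k) × (Fin b₁ → k) × (Fin c → k)) :
    g.map₂ (0, z.2.1, 0, z.2.2) = α (g.map₁ z) := by
  simp [map₁, map₂, g.α_s₁]

theorem map₃_apply (z : (Fin a₂ → k) × (Fin b₁ → k) × (Fin b₂ → k) × (Fin c → k)) :
    g.map₃ (0, z.2.2.1, z.2.2.2) = β (g.map₂ z) := by
  simp [map₂, map₃, g.β_s₂, g.β_α_i₂]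

end SummandGenerators

end Ranks

namespace QRep

variable {k : Type u} [Field k] {U V W : QRep k} {a₁ a₂ a₃ b₁ b₂ c : ℕ}

theorem Isomorphic.symm : V.Isomorphic W → W.Isomorphic V :=
  fun ⟨e₁, e₂, e₃, hα, hβ⟩ => ⟨e₁.symm, e₂.symm, e₃.symm,
    fun x => (LinearEquiv.symm_apply_eq e₂).2 (by rw [hα, LinearEquiv.apply_symm_apply]),
    fun y => (LinearEquiv.symm_apply_eq e₃).2 (by rw [hβ, LinearEquiv.apply_symm_apply])⟩

theorem Isomorphic.trans : U.Isomorphic V → V.Isomorphic W → U.Isomorphic W :=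
  fun ⟨e₁, e₂, e₃, hα, hβ⟩ ⟨f₁, f₂, f₃, hα', hβ'⟩ =>
    ⟨e₁.trans f₁, e₂.trans f₂, e₃.trans f₃, fun x => (congrArg f₂ (hα x)).trans (hα' (e₁ x)),
      fun y => (congrArg f₃ (hβ y)).trans (hβ' (e₂ y))⟩

variable (k a₁ a₂ a₃ b₁ b₂ c) in
/-- The direct sum `S₁^a₁ ⊕ S₂^a₂ ⊕ S₃^a₃ ⊕ I₂^b₁ ⊕ P₂^b₂ ⊕ I₃^c` without its zero summands. -/
def normalForm : QRep k where
  V₁ := ModuleCat.of k ((Fin a₁ → k) × (Fin b₁ → k) × (Fin c → k))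
  V₂ := ModuleCat.of k ((Fin a₂ → k) × (Fin b₁ → k) × (Fin b₂ → k) × (Fin c → k))
  V₃ := ModuleCat.of k ((Fin a₃ → k) × (Fin b₂ → k) × (Fin c → k))
  α := LinearMap.prod 0 (LinearMap.prod (LinearMap.fst k _ _ ∘ₗ LinearMap.snd k _ _)
    (LinearMap.prod 0 (LinearMap.snd k _ _ ∘ₗ LinearMap.snd k _ _)))
  β := LinearMap.prod 0 (LinearMap.snd k _ _ ∘ₗ LinearMap.snd k _ _)

theorem ofMultiplicities_isomorphic_normalForm :
    (ofMultiplicities k a₁ a₂ a₃ b₁ b₂ c).Isomorphic (normalForm k a₁ a₂ a₃ b₁ b₂ c) :=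
  ⟨{ toFun z := (z.1, z.2.2.2.1, z.2.2.2.2.2)
     invFun z := (z.1, 0, 0, z.2.1, 0, z.2.2)
     map_add' _ _ := rfl
     map_smul' _ _ := rfl },
   { toFun z := (z.2.1, z.2.2.2.1, z.2.2.2.2.1, z.2.2.2.2.2)
     invFun z := (0, z.1, 0, z.2.1, z.2.2.1, z.2.2.2)
     map_add' _ _ := rfl
     map_smul' _ _ := rfl },
   { toFun z := (z.2.2.1, z.2.2.2.2.1, z.2.2.2.2.2)
     invFun z := (0, 0, z.1, 0, z.2.1, z.2.2)
     map_add' _ _ := rfl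
     map_smul' _ _ := rfl },
   fun _ => rfl, fun _ => rfl⟩

theorem hasRanks_normalForm : HasRanks b₁ b₂ c (normalForm k a₁ a₂ a₃ b₁ b₂ c).α
    (normalForm k a₁ a₂ a₃ b₁ b₂ c).β where
  finrank_range_fst := by
    refine (finrank_range_eq_of_factors (G := (Fin b₁ → k) × (Fin c → k))
      (LinearMap.snd k _ _) (LinearMap.prod 0 (LinearMap.prod (LinearMap.fst k _ _)
        (LinearMap.prod 0 (LinearMap.snd k _ _)))) Prod.snd_surjective (fun z w h => ?_)
      fun _ => rfl).trans (by simp)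
    exact Prod.ext (congrArg (·.2.1) h) (congrArg (·.2.2.2) h)
  finrank_range_snd :=
    (finrank_range_eq_of_factors (G := (Fin b₂ → k) × (Fin c → k))
      (LinearMap.snd k _ _ ∘ₗ LinearMap.snd k _ _) (LinearMap.inr k _ _)
      (Prod.snd_surjective.comp Prod.snd_surjective) LinearMap.inr_injective
      fun _ => rfl).trans (by simp)
  finrank_range_comp :=
    (finrank_range_eq_of_factors (G := Fin c → k) (LinearMap.snd k _ _ ∘ₗ LinearMap.snd k _ _)
      (LinearMap.inr k _ _ ∘ₗ LinearMap.inr k _ _) (Prod.snd_surjective.comp Prod.snd_surjective)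
      (LinearMap.inr_injective.comp LinearMap.inr_injective) fun _ => rfl).trans (by simp)

theorem finrank_normalForm :
    Module.finrank k (normalForm k a₁ a₂ a₃ b₁ b₂ c).V₁ = a₁ + b₁ + c ∧
    Module.finrank k (normalForm k a₁ a₂ a₃ b₁ b₂ c).V₂ = a₂ + b₁ + b₂ + c ∧
    Module.finrank k (normalForm k a₁ a₂ a₃ b₁ b₂ c).V₃ = a₃ + b₂ + c := by
  change Module.finrank k ((Fin a₁ → k) × (Fin b₁ → k) × (Fin c → k)) = _ ∧
    Module.finrank k ((Fin a₂ → k) × (Fin b₁ → k) × (Fin b₂ → k) × (Fin c → k)) = _ ∧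
    Module.finrank k ((Fin a₃ → k) × (Fin b₂ → k) × (Fin c → k)) = _
  simp [add_assoc]

theorem normalForm_isomorphic [FiniteDimensional k V.V₁] [FiniteDimensional k V.V₂]
    [FiniteDimensional k V.V₃] (h : HasRanks b₁ b₂ c V.α V.β)
    (h₁ : Module.finrank k V.V₁ = a₁ + b₁ + c) (h₂ : Module.finrank k V.V₂ = a₂ + b₁ + b₂ + c)
    (h₃ : Module.finrank k V.V₃ = a₃ + b₂ + c) : (normalForm k a₁ a₂ a₃ b₁ b₂ c).Isomorphic V := by
  obtain ⟨g⟩ := h.nonempty_summandGenerators h₁ h₂ h₃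
  obtain ⟨h₁', h₂', h₃'⟩ := finrank_normalForm (k := k) (a₁ := a₁) (a₂ := a₂) (a₃ := a₃)
    (b₁ := b₁) (b₂ := b₂) (c := c)
  exact ⟨.ofInjectiveOfFinrankEq g.map₁ g.map₁_injective (h₁'.trans h₁.symm),
    .ofInjectiveOfFinrankEq g.map₂ g.map₂_injective (h₂'.trans h₂.symm),
    .ofInjectiveOfFinrankEq g.map₃ g.map₃_injective (h₃'.trans h₃.symm),
    g.map₂_apply, g.map₃_apply⟩

end QRep

namespace RepSpace

variable {k : Type u} [Field k] {d₁ d₂ d₃ a₁ a₂ a₃ b₁ b₂ c : ℕ} {V W : RepSpace k d₁ d₂ d₃}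

theorem mem_orbit_iff_isomorphic : W ∈ V.orbit ↔ V.toQRep.Isomorphic W.toQRep := by
  let toEquiv (n : ℕ) := Matrix.GeneralLinearGroup.toLin.trans
    (LinearMap.GeneralLinearGroup.generalLinearEquiv k (Fin n → k))
  have intertwines_iff {m n : ℕ} (M N : Matrix (Fin m) (Fin n) k) (g : GL (Fin n) k)
      (h : GL (Fin m) k) : N = h.val * M * g⁻¹.val ↔
        ∀ x, toEquiv m h (Matrix.toLin' M x) = Matrix.toLin' N (toEquiv n g x) := by
    have hcomp : h.val * M = N * g.val ↔ ∀ x,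
        toEquiv m h (Matrix.toLin' M x) = Matrix.toLin' N (toEquiv n g x) := by
      rw [← Matrix.toLin'.injective.eq_iff, Matrix.toLin'_mul, Matrix.toLin'_mul, LinearMap.ext_iff]
      rfl
    rw [← hcomp]
    constructor
    · rintro rfl
      rw [Matrix.mul_assoc _ _ g.val, Units.inv_mul, Matrix.mul_one]
    · intro h
      rw [h, Matrix.mul_assoc, Units.mul_inv, Matrix.mul_one]
  constructor
  · rintro ⟨g₁, g₂, g₃, h⟩
    exact ⟨toEquiv d₁ g₁, toEquiv d₂ g₂, toEquiv d₃ g₃,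
      (intertwines_iff _ _ g₁ g₂).1 (congrArg RepSpace.α h),
      (intertwines_iff _ _ g₂ g₃).1 (congrArg RepSpace.β h)⟩
  · rintro ⟨e₁, e₂, e₃, hα, hβ⟩
    obtain ⟨g₁, rfl⟩ := (toEquiv d₁).surjective e₁
    obtain ⟨g₂, rfl⟩ := (toEquiv d₂).surjective e₂
    obtain ⟨g₃, rfl⟩ := (toEquiv d₃).surjective e₃
    exact ⟨g₁, g₂, g₃, RepSpace.ext ((intertwines_iff _ _ g₁ g₂).2 hα)
      ((intertwines_iff _ _ g₂ g₃).2 hβ)⟩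

theorem mem_orbit_self (V : RepSpace k d₁ d₂ d₃) : V ∈ V.orbit :=
  mem_orbit_iff_isomorphic.2
    ⟨LinearEquiv.refl .., LinearEquiv.refl .., LinearEquiv.refl .., fun _ => rfl, fun _ => rfl⟩

theorem dim_eq_of_isomorphic
    (hV : V.toQRep.Isomorphic (QRep.ofMultiplicities k a₁ a₂ a₃ b₁ b₂ c)) :
    d₁ = a₁ + b₁ + c ∧ d₂ = a₂ + b₁ + b₂ + c ∧ d₃ = a₃ + b₂ + c := by
  obtain ⟨e₁, e₂, e₃, -, -⟩ := hV.trans QRep.ofMultiplicities_isomorphic_normalForm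
  obtain ⟨h₁, h₂, h₃⟩ := QRep.finrank_normalForm (k := k) (a₁ := a₁) (a₂ := a₂) (a₃ := a₃)
    (b₁ := b₁) (b₂ := b₂) (c := c)
  exact ⟨(Module.finrank_fin_fun k).symm.trans (e₁.finrank_eq.trans h₁),
    (Module.finrank_fin_fun k).symm.trans (e₂.finrank_eq.trans h₂),
    (Module.finrank_fin_fun k).symm.trans (e₃.finrank_eq.trans h₃)⟩

theorem mem_orbit_iff_hasRanks
    (hV : V.toQRep.Isomorphic (QRep.ofMultiplicities k a₁ a₂ a₃ b₁ b₂ c)) :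
    W ∈ V.orbit ↔ HasRanks b₁ b₂ c (Matrix.toLin' W.α) (Matrix.toLin' W.β) := by
  obtain ⟨rfl, rfl, rfl⟩ := dim_eq_of_isomorphic hV
  have isomorphic_normalForm := hV.trans QRep.ofMultiplicities_isomorphic_normalForm
  rw [mem_orbit_iff_isomorphic]
  constructor
  · intro h
    obtain ⟨e₁, e₂, e₃, hα, hβ⟩ := isomorphic_normalForm.symm.trans h
    exact QRep.hasRanks_normalForm.congr e₁ e₂ e₃ hα hβ
  · intro h
    have finiteDimensional (n : ℕ) : FiniteDimensional k (Fin n → k) := inferInstance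
    exact isomorphic_normalForm.trans (@QRep.normalForm_isomorphic _ _ W.toQRep _ _ _ _ _ _
      (finiteDimensional _) (finiteDimensional _) (finiteDimensional _) h
      (Module.finrank_fin_fun k) (Module.finrank_fin_fun k) (Module.finrank_fin_fun k))

end RepSpace

section IncidencePoint

variable {k : Type u} [Field k] {d₁ d₂ d₃ b₁ b₂ c r n : ℕ}

/-- A subspace of dimension `r` of `k ^ n` as a point of the Grassmannian. -/
def Gr.ofFinrank (N : Submodule k (Fin n → k)) (h : Module.finrank k N = r) : Gr k r n where
  sub := N
  projective_quotient := inferInstance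
  rank_eq p := by rw [Module.rankAtStalk_eq_finrank_of_free, ← h]; rfl

theorem HasRanks.exists_incidencePoint {V : RepSpace k d₁ d₂ d₃} (hd₂ : d₂ = r + b₂)
    (h : HasRanks b₁ b₂ c (Matrix.toLin' V.α) (Matrix.toLin' V.β)) :
    ∃ P : IncidencePoint k d₁ d₂ d₃ (b₁ + c) r c, P.V = V := by
  have finrank_comap := Nat.add_right_cancel
    (h.finrank_comap_range_comp.trans ((Module.finrank_fin_fun k).trans hd₂))
  exact ⟨{
    V := V
    F := ⟨.ofFinrank _ h.finrank_range_fst, .ofFinrank _ finrank_comap,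
      Submodule.map_le_iff_le_comap.1 (LinearMap.range_comp _ _).ge⟩
    R := .ofFinrank _ h.finrank_range_comp
    range_le := le_rfl
    map_le := Submodule.map_comap_le _ _ }, rfl⟩

end IncidencePoint

/-! ### The locus where the flags are determined by the representation -/

section Comap

variable {A : Type u} [CommRing A] {r b c n m : ℕ}

theorem Gr.eq_comap (hn : n = r + b) (N : Gr A r n) (M : Gr A c m)
    {f : (Fin n → A) →ₗ[A] (Fin m → A)} (hf : N.sub.map f ≤ M.sub)
    (g : (Fin m → A) →ₗ[A] (Fin (b + c) → A)) (hg : (LinearMap.range f).map g = ⊤) :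
    N.sub = M.sub.comap f := by
  obtain ⟨π, hπ⟩ := exists_leftInverse_subtype N.sub
  have π_coe (v : N.sub) : π v = v := LinearMap.congr_fun hπ v
  have map_mem (v : N.sub) : f v ∈ M.sub := hf ⟨v, v.2, rfl⟩
  -- Both sides are projective of rank `n + c = r + b + c`, so surjectivity implies injectivity.
  let ψ : (Fin n → A) × M.sub →ₗ[A] N.sub × (Fin (b + c) → A) :=
    (π ∘ₗ LinearMap.fst A _ _).prod ((g ∘ₗ f).coprod (g ∘ₗ M.sub.subtype))
  have ψ_surjective : Function.Surjective ψ := by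
    rintro ⟨w, t⟩
    obtain ⟨_, ⟨v, rfl⟩, rfl⟩ := (hg ▸ Submodule.mem_top : t ∈ (LinearMap.range f).map g)
    refine ⟨(v - π v + w, ⟨f (π v), map_mem _⟩ - ⟨f w, map_mem _⟩), Prod.ext ?_ ?_⟩
    · simp [ψ, π_coe]
    · simp [ψ]
  have ψ_bijective : Function.Bijective ψ :=
    Module.bijective_of_surjective_of_rankAtStalk_eq ψ_surjective fun p _ => by
      have := PrimeSpectrum.nontrivial (⟨p, inferInstance⟩ : PrimeSpectrum A)
      simp only [Module.rankAtStalk_prod, Pi.add_apply, N.rank_eq, M.rank_eq,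
        Module.rankAtStalk_eq_finrank_of_free, Module.finrank_fin_fun, hn]
      exact Nat.add_assoc r b c
  refine le_antisymm (Submodule.map_le_iff_le_comap.1 hf) fun v hv => ?_
  have sub_mem : f (v - π v) ∈ M.sub := map_sub f _ _ ▸ M.sub.sub_mem hv (map_mem _)
  have h : ψ (v - π v, -⟨_, sub_mem⟩) = ψ 0 := by
    rw [map_zero]
    exact Prod.ext (by simp [ψ, π_coe]) (by simp [ψ])
  have hv : v = π v := sub_eq_zero.1 (congrArg Prod.fst (ψ_bijective.1 h))
  exact hv ▸ (π v).2

end Comap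

section Minors

variable {A : Type u} [CommRing A] {k : Type u} [Field k] {n m r : ℕ}

theorem mapsOnto_range_of_isUnit_det {P : Matrix (Fin r) (Fin m) A}
    {M : Matrix (Fin m) (Fin n) A} {Q : Matrix (Fin n) (Fin r) A}
    (h : IsUnit (P * (M * Q)).det) : MapsOnto P (LinearMap.range (Matrix.toLin' M)) :=
  ((mapsOnto_range_iff P (M * Q)).2 h).mono (range_toLin'_mul_le M Q)

theorem exists_mul_mul_eq_one {M : Matrix (Fin m) (Fin n) k}
    (h : Module.finrank k (LinearMap.range (Matrix.toLin' M)) = r) :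
    ∃ (P : Matrix (Fin r) (Fin m) k) (Q : Matrix (Fin n) (Fin r) k), P * (M * Q) = 1 := by
  obtain ⟨y, -, hy⟩ := exists_linearMap_injective_comp (r := r) (Matrix.toLin' M) ⊤ (by
    rw [top_inf_eq, finrank_top, ← LinearMap.finrank_range_add_finrank_ker (Matrix.toLin' M), h,
      add_comm])
  obtain ⟨p, hp⟩ := (Matrix.toLin' M ∘ₗ y).exists_leftInverse_of_injective
    (LinearMap.ker_eq_bot'.2 hy)
  refine ⟨LinearMap.toMatrix' p, LinearMap.toMatrix' y, Matrix.toLin'.injective ?_⟩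
  rw [Matrix.toLin'_mul, Matrix.toLin'_mul, Matrix.toLin'_toMatrix', Matrix.toLin'_toMatrix',
    Matrix.toLin'_one, hp]

end Minors

/-- A choice of a minor of each of the maps `α`, `β` and `β ∘ α` of a representation, of sizes
`r`, `b + c` and `c`: the minor of `M` given by `P` and `Q` is the determinant of `P M Q`. -/
structure MinorChoice (A : Type u) (d₁ d₂ d₃ r b c : ℕ) where
  Pα : Matrix (Fin r) (Fin d₂) A
  Qα : Matrix (Fin d₁) (Fin r) A
  Pβ : Matrix (Fin (b + c)) (Fin d₃) A
  Qβ : Matrix (Fin d₂) (Fin (b + c)) A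
  Pβα : Matrix (Fin c) (Fin d₃) A
  Qβα : Matrix (Fin d₁) (Fin c) A

namespace MinorChoice

variable {A B : Type u} [CommRing A] [CommRing B] {k : Type u} [Field k] {d₁ d₂ d₃ r b b₁ c r₂ : ℕ}

/-- Base change of a choice of minors. -/
def map (f : A →+* B) (D : MinorChoice A d₁ d₂ d₃ r b c) : MinorChoice B d₁ d₂ d₃ r b c :=
  ⟨D.Pα.map f, D.Qα.map f, D.Pβ.map f, D.Qβ.map f, D.Pβα.map f, D.Qβα.map f⟩

/-- The product of the three minors of the representation `W`. -/
def discr (D : MinorChoice A d₁ d₂ d₃ r b c) (W : RepSpace A d₁ d₂ d₃) : A :=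
  (D.Pα * (W.α * D.Qα)).det * (D.Pβ * (W.β * D.Qβ)).det * (D.Pβα * (W.β * W.α * D.Qβα)).det

theorem discr_map (f : A →+* B) (D : MinorChoice A d₁ d₂ d₃ r b c) (W : RepSpace A d₁ d₂ d₃) :
    (D.map f).discr (W.map f) = f (D.discr W) := by
  simp only [discr, map, RepSpace.map, ← Matrix.map_mul, det_map, map_mul]

theorem isUnit_discr_iff {D : MinorChoice A d₁ d₂ d₃ r b c} {W : RepSpace A d₁ d₂ d₃} :
    IsUnit (D.discr W) ↔ IsUnit (D.Pα * (W.α * D.Qα)).det ∧ IsUnit (D.Pβ * (W.β * D.Qβ)).det ∧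
      IsUnit (D.Pβα * (W.β * W.α * D.Qβα)).det := by
  rw [discr, IsUnit.mul_iff, IsUnit.mul_iff, and_assoc]

theorem exists_discr_ne_zero {W : RepSpace k d₁ d₂ d₃}
    (h : HasRanks b₁ b c (Matrix.toLin' W.α) (Matrix.toLin' W.β)) :
    ∃ D : MinorChoice k d₁ d₂ d₃ (b₁ + c) b c, D.discr W ≠ 0 := by
  obtain ⟨Pα, Qα, hα⟩ := exists_mul_mul_eq_one h.finrank_range_fst
  obtain ⟨Pβ, Qβ, hβ⟩ := exists_mul_mul_eq_one h.finrank_range_snd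
  obtain ⟨Pβα, Qβα, hβα⟩ := exists_mul_mul_eq_one (M := W.β * W.α)
    ((Matrix.toLin'_mul W.β W.α).symm ▸ h.finrank_range_comp)
  exact ⟨⟨Pα, Qα, Pβ, Qβ, Pβα, Qβα⟩, by simp [discr, hα, hβ, hβα]⟩

variable {D : MinorChoice A d₁ d₂ d₃ r b c} {P P' : IncidencePoint A d₁ d₂ d₃ r r₂ c}

theorem R₁_eq_range (h : IsUnit (D.discr P.V)) :
    P.F.R₁.sub = LinearMap.range (Matrix.toLin' P.V.α) :=
  P.F.R₁.eq_of_le_of_map_eq_top _ P.range_le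
    (mapsOnto_range_of_isUnit_det (isUnit_discr_iff.1 h).1)

theorem R_eq_range (h : IsUnit (D.discr P.V)) :
    P.R.sub = LinearMap.range (Matrix.toLin' P.V.β ∘ₗ Matrix.toLin' P.V.α) := by
  have range_le : LinearMap.range (Matrix.toLin' P.V.β ∘ₗ Matrix.toLin' P.V.α) ≤ P.R.sub := by
    rw [LinearMap.range_comp]
    exact (Submodule.map_mono (P.range_le.trans P.F.le)).trans P.map_le
  have mapsOnto := mapsOnto_range_of_isUnit_det (isUnit_discr_iff.1 h).2.2
  rw [Matrix.toLin'_mul] at mapsOnto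
  exact P.R.eq_of_le_of_map_eq_top _ range_le mapsOnto

theorem R₂_eq_comap (hd₂ : d₂ = r₂ + b) (h : IsUnit (D.discr P.V)) :
    P.F.R₂.sub = P.R.sub.comap (Matrix.toLin' P.V.β) :=
  P.F.R₂.eq_comap hd₂ P.R P.map_le _ (mapsOnto_range_of_isUnit_det (isUnit_discr_iff.1 h).2.1)

theorem incidencePoint_ext (hd₂ : d₂ = r₂ + b) (h : IsUnit (D.discr P.V)) (hV : P.V = P'.V) :
    P = P' := by
  have h' : IsUnit (D.discr P'.V) := hV ▸ h
  have R_eq : P.R.sub = P'.R.sub := by rw [R_eq_range h, R_eq_range h', hV]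
  exact IncidencePoint.ext_of_eq hV (by rw [R₁_eq_range h, R₁_eq_range h', hV])
    (by rw [R₂_eq_comap hd₂ h, R₂_eq_comap hd₂ h', R_eq, hV]) R_eq

theorem hasRanks (hd₂ : d₂ = r₂ + b) {D : MinorChoice k d₁ d₂ d₃ (b₁ + c) b c}
    {P : IncidencePoint k d₁ d₂ d₃ (b₁ + c) r₂ c} (h : D.discr P.V ≠ 0) :
    HasRanks b₁ b c (Matrix.toLin' P.V.α) (Matrix.toLin' P.V.β) := by
  have finrank_comp := P.R.finrank_sub
  rw [R_eq_range h.isUnit] at finrank_comp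
  refine ⟨R₁_eq_range h.isUnit ▸ P.F.R₁.finrank_sub, ?_, finrank_comp⟩
  have finrank_comap := P.F.R₂.finrank_sub
  rw [R₂_eq_comap hd₂ h.isUnit, R_eq_range h.isUnit] at finrank_comap
  have := finrank_comap_range_comp_add (Matrix.toLin' P.V.α) (Matrix.toLin' P.V.β)
  rw [finrank_comap, finrank_comp, Module.finrank_fin_fun] at this
  omega

end MinorChoice

/-! ### The projection to the orbit closure -/

namespace RepSpace

variable {k : Type u} [Field k] {d₁ d₂ d₃ : ℕ} {A B : Type u} [CommRing A] [CommRing B]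

/-- The evaluation of polynomial functions on `Rep(Q, d)` at a pair of matrices over a ring `A`,
where `κ : k → A` transports the coefficients. -/
def evalHom (κ : k →+* A) (W : RepSpace A d₁ d₂ d₃) : MvPolynomial (Coord d₁ d₂ d₃) k →+* A :=
  MvPolynomial.eval₂Hom κ W.coords

theorem comp_evalHom (f : A →+* B) (κ : k →+* A) (W : RepSpace A d₁ d₂ d₃) :
    f.comp (W.evalHom κ) = (W.map f).evalHom (f.comp κ) :=
  (comp_evalEquiv f (κ, W.coords)).trans (by rw [evalHom, coords_map]; rfl)

theorem evalHom_injective {κ κ' : k →+* A} {W W' : RepSpace A d₁ d₂ d₃}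
    (h : W.evalHom κ = W'.evalHom κ') : κ = κ' ∧ W = W' :=
  (Prod.ext_iff.1 (evalEquiv.injective (a₁ := (κ, W.coords)) (a₂ := (κ', W'.coords)) h)).imp_right
    (coordsEquiv.injective ·)

variable (k d₁ d₂ d₃) in
/-- The pair of matrices whose entries are the coordinate functions on `Rep(Q, d)`. -/
def generic : RepSpace (MvPolynomial (Coord d₁ d₂ d₃) k) d₁ d₂ d₃ :=
  coordsEquiv.symm MvPolynomial.X

theorem map_generic (κ : k →+* A) (W : RepSpace A d₁ d₂ d₃) :
    (generic k d₁ d₂ d₃).map (W.evalHom κ) = W :=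
  RepSpace.ext (Matrix.ext fun _ _ => MvPolynomial.eval₂Hom_X' _ _ _)
    (Matrix.ext fun _ _ => MvPolynomial.eval₂Hom_X' _ _ _)

end RepSpace

section OrbitClosure

variable {k : Type u} [Field k] {d₁ d₂ d₃ : ℕ} {V : RepSpace k d₁ d₂ d₃}

/-- The product of the chosen minors, as a polynomial function on `Rep(Q, d)`. -/
def MinorChoice.poly {r b c : ℕ} (D : MinorChoice k d₁ d₂ d₃ r b c) :
    MvPolynomial (Coord d₁ d₂ d₃) k :=
  (D.map MvPolynomial.C).discr (.generic k d₁ d₂ d₃)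

theorem MinorChoice.evalHom_poly {r b c : ℕ} (D : MinorChoice k d₁ d₂ d₃ r b c) {A : Type u}
    [CommRing A] (κ : k →+* A) (W : RepSpace A d₁ d₂ d₃) :
    W.evalHom κ D.poly = (D.map κ).discr W := by
  have evalHom_comp_C : W.evalHom κ ∘ MvPolynomial.C = κ :=
    funext fun a => MvPolynomial.eval₂Hom_C _ _ a
  rw [poly, ← discr_map, RepSpace.map_generic]
  simp only [MinorChoice.map, Matrix.map_map, evalHom_comp_C]

theorem mem_orbitIdeal_iff {f : MvPolynomial (Coord d₁ d₂ d₃) k} :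
    f ∈ orbitIdeal V ↔ ∀ W ∈ V.orbit, W.evalHom (RingHom.id k) f = 0 := by
  rw [orbitIdeal, MvPolynomial.mem_vanishingIdeal_iff]
  exact Set.forall_mem_image

instance isReduced_orbitClosure : IsReduced (orbitClosure V) := by
  have isRadical : (orbitIdeal V).IsRadical := by
    rintro f ⟨n, hn⟩
    rw [mem_orbitIdeal_iff] at hn ⊢
    exact fun W hW => eq_zero_of_pow_eq_zero (map_pow (W.evalHom _) f n ▸ hn W hW)
  have := (Ideal.isRadical_iff_quotient_reduced _).1 isRadical
  exact inferInstanceAs (IsReduced (Spec (.of (MvPolynomial (Coord d₁ d₂ d₃) k ⧸ orbitIdeal V))))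

theorem exists_comp_orbitClosureι_eq {Z : Scheme.{u}} {a : Z ⟶ repScheme k d₁ d₂ d₃}
    (h : ∀ f ∈ orbitIdeal V, homSpecEquiv Z (.of (MvPolynomial (Coord d₁ d₂ d₃) k)) a f = 0) :
    ∃ q : Z ⟶ orbitClosure V, q ≫ orbitClosureι V = a := by
  let φ : CommRingCat.of (MvPolynomial (Coord d₁ d₂ d₃) k ⧸ orbitIdeal V) ⟶ Γ(Z, ⊤) :=
    CommRingCat.ofHom (Ideal.Quotient.lift _ (homSpecEquiv Z _ a).hom h)
  refine ⟨(homSpecEquiv Z _).symm φ,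
    (homSpecEquiv Z (.of (MvPolynomial (Coord d₁ d₂ d₃) k))).injective ?_⟩
  refine (homSpecEquiv_comp_specMap _ _).trans ?_
  rw [Equiv.apply_symm_apply]
  exact CommRingCat.hom_ext (Ideal.Quotient.lift_comp_mk _ _ h)

theorem orbitClosureι_comp_repBase :
    orbitClosureι V ≫ repBase k d₁ d₂ d₃ = orbitClosureStr V :=
  (Spec.map_comp _ _).symm

end OrbitClosure

theorem eq_zero_of_appTop_eq_zero {X Y : Scheme.{u}} [IsIntegral Y] [Nonempty X] (j : X ⟶ Y)
    [IsOpenImmersion j] {s : Γ(Y, ⊤)} (h : j.appTop s = 0) : s = 0 := by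
  rw [← basicOpen_eq_bot_iff]
  by_contra hne
  obtain ⟨_, hz, x, rfl⟩ := nonempty_preirreducible_inter (Y.basicOpen s).2
    j.isOpenEmbedding.isOpen_range ((Y.basicOpen s).ne_bot_iff_nonempty.1 hne)
    (Set.range_nonempty j)
  have mem_preimage : x ∈ j ⁻¹ᵁ Y.basicOpen s := hz
  rw [Scheme.preimage_basicOpen_top, h, Scheme.basicOpen_zero] at mem_preimage
  exact mem_preimage

section Factorization

variable {k : Type u} [Field k] {d₁ d₂ d₃ a₁ a₂ a₃ b₁ b₂ c r₂ m e : ℕ}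
  {V : RepSpace k d₁ d₂ d₃}

theorem exists_incidencePoint_of_mem_orbit
    (hV : V.toQRep.Isomorphic (QRep.ofMultiplicities k a₁ a₂ a₃ b₁ b₂ c)) (hd₂ : d₂ = r₂ + b₂)
    {W : RepSpace k d₁ d₂ d₃} (hW : W ∈ V.orbit) :
    ∃ P : IncidencePoint k d₁ d₂ d₃ (b₁ + c) r₂ c, P.V = W :=
  ((RepSpace.mem_orbit_iff_hasRanks hV).1 hW).exists_incidencePoint hd₂

theorem eval_evalHom_genericPoint {r₁ b : ℕ} (w : ChartIndex d₂ d₃ r₁ m r₂ b c e)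
    (y : ChartCoord d₁ d₃ r₁ m r₂ b c e → k) (f : MvPolynomial (Coord d₁ d₂ d₃) k) :
    MvPolynomial.eval y ((w.genericPoint k d₁).2.V.evalHom MvPolynomial.C f) =
      (w.incidencePoint (ChartPoint.coordsEquiv.symm y)).V.evalHom (RingHom.id k) f := by
  have map_eq : (w.genericPoint k d₁).2.V.map (MvPolynomial.eval y) =
      (w.incidencePoint (ChartPoint.coordsEquiv.symm y)).V := by
    have eval_comp_X : MvPolynomial.eval y ∘ MvPolynomial.X = y :=
      funext fun i => MvPolynomial.eval_X i
    refine congrArg IncidencePoint.V ((w.incidencePoint_map _ _).trans ?_)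
    rw [← ChartPoint.coordsEquiv_symm_comp, eval_comp_X]
  have comp_C : (MvPolynomial.eval y).comp MvPolynomial.C = RingHom.id k :=
    RingHom.ext fun a => MvPolynomial.eval_C a
  rw [← RingHom.comp_apply, RepSpace.comp_evalHom, map_eq, comp_C]

theorem evalHom_genericPoint_eq_zero [Infinite k]
    (hV : V.toQRep.Isomorphic (QRep.ofMultiplicities k a₁ a₂ a₃ b₁ b₂ c)) (hd₂ : d₂ = r₂ + b₂)
    {w : ChartIndex d₂ d₃ (b₁ + c) m r₂ b₂ c e}
    {x₀ : ChartPoint k d₁ d₃ (b₁ + c) m r₂ b₂ c e} (hx₀ : (w.incidencePoint x₀).V ∈ V.orbit)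
    {f : MvPolynomial (Coord d₁ d₂ d₃) k} (hf : f ∈ orbitIdeal V) :
    (w.genericPoint k d₁).2.V.evalHom MvPolynomial.C f = 0 := by
  obtain ⟨D, hD⟩ :=
    MinorChoice.exists_discr_ne_zero ((RepSpace.mem_orbit_iff_hasRanks hV).1 hx₀)
  -- A point where the minors do not vanish lies over the orbit, so `f` times the minors is zero.
  have evalHom_mul_poly_eq_zero : (w.genericPoint k d₁).2.V.evalHom MvPolynomial.C
      (f * D.poly) = 0 := by
    refine MvPolynomial.funext fun y => ?_
    rw [eval_evalHom_genericPoint, map_mul, map_zero, D.evalHom_poly]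
    by_cases h : D.discr (w.incidencePoint (ChartPoint.coordsEquiv.symm y)).V = 0
    · exact mul_eq_zero_of_right _ h
    · exact mul_eq_zero_of_left (mem_orbitIdeal_iff.1 hf _
        ((RepSpace.mem_orbit_iff_hasRanks hV).2 (MinorChoice.hasRanks hd₂ h))) _
  rw [map_mul] at evalHom_mul_poly_eq_zero
  refine (mul_eq_zero.1 evalHom_mul_poly_eq_zero).resolve_right fun h => hD ?_
  have eval_eq := eval_evalHom_genericPoint w (ChartPoint.coordsEquiv x₀) D.poly
  rw [h, map_zero, Equiv.symm_apply_apply, D.evalHom_poly] at eval_eq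
  exact eval_eq.symm

theorem exists_incidencePoint_mem_orbit
    (hV : V.toQRep.Isomorphic (QRep.ofMultiplicities k a₁ a₂ a₃ b₁ b₂ c)) (hd₂ : d₂ = r₂ + b₂)
    (hr₂ : r₂ = (b₁ + c) + m) (hd₃ : d₃ = c + e) :
    ∃ (w : ChartIndex d₂ d₃ (b₁ + c) m r₂ b₂ c e)
      (x : ChartPoint k d₁ d₃ (b₁ + c) m r₂ b₂ c e), (w.incidencePoint x).V ∈ V.orbit := by
  obtain ⟨P, hP⟩ := exists_incidencePoint_of_mem_orbit hV hd₂ (RepSpace.mem_orbit_self V)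
  obtain ⟨f, hf, w, hw⟩ := P.exists_notMem_forall_eq_incidencePoint hd₂ hr₂ hd₃ ⊥
  obtain ⟨x, hx⟩ := hw k (RingHom.id k) (isUnit_iff_ne_zero.2 hf)
  exact ⟨w, x, by rw [hx, P.map_id, hP]; exact RepSpace.mem_orbit_self V⟩

theorem exists_comp_orbitClosureι_eq_toRep [Infinite k]
    (hV : V.toQRep.Isomorphic (QRep.ofMultiplicities k a₁ a₂ a₃ b₁ b₂ c)) (hd₂ : d₂ = r₂ + b₂)
    (hr₂ : r₂ = (b₁ + c) + m) (hd₃ : d₃ = c + e) :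
    ∃ q : incidenceScheme k d₁ hd₂ hr₂ hd₃ ⟶ orbitClosure V,
      q ≫ orbitClosureι V = toRep (incidenceSchemeIso k d₁ hd₂ hr₂ hd₃) := by
  obtain ⟨w, x₀, hx₀⟩ := exists_incidencePoint_mem_orbit hV hd₂ hr₂ hd₃
  refine exists_comp_orbitClosureι_eq fun f hf =>
    eq_zero_of_appTop_eq_zero (incidenceChart k d₁ hd₂ hr₂ hd₃ w) ?_
  let S := CommRingCat.of (MvPolynomial (Coord d₁ d₂ d₃) k)
  have pullback_eq := (homSpecEquiv_comp (A := S) (incidenceChart k d₁ hd₂ hr₂ hd₃ w)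
    (toRep (incidenceSchemeIso k d₁ hd₂ hr₂ hd₃))).symm.trans
      (congrArg (homSpecEquiv _ S) (comp_toRep _ _))
  rw [incidencePoints_incidenceChart, repPoints_symm_apply] at pullback_eq
  refine (ConcreteCategory.congr_hom (pullback_eq.trans (homSpecEquiv_specMap _)) f).trans ?_
  exact (congrArg (Scheme.ΓSpecIso _).inv.hom
    (evalHom_genericPoint_eq_zero hV hd₂ hx₀ hf)).trans (RingHom.map_zero _)

end Factorization

/-! ### The projection is a resolution of singularities -/

section Resolution

variable {k : Type u} [Field k] {d₁ d₂ d₃ a₁ a₂ a₃ b₁ b₂ b r₁ r₂ c : ℕ} {Z : Scheme.{u}}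
  {η : affinePoints Z ≅ incidenceFunctor k d₁ d₂ d₃ r₁ r₂ c} {V : RepSpace k d₁ d₂ d₃}
  {q : Z ⟶ orbitClosure V}

/-- The open subset of the orbit closure where a polynomial function does not vanish. -/
def nonvanishing (V : RepSpace k d₁ d₂ d₃) (f : MvPolynomial (Coord d₁ d₂ d₃) k) :
    (orbitClosure V).Opens :=
  PrimeSpectrum.basicOpen (Ideal.Quotient.mk (orbitIdeal V) f)

section

variable (hq : q ≫ orbitClosureι V = toRep η)
include hq

theorem isFirstProjection_of_comp_eq : IsFirstProjection (incidenceVarietyStr η) q := by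
  intro A _ _ x
  rw [hq, comp_toRep, incidencePoints_fst]
  rfl

theorem comp_orbitClosureι_eq {A : CommRingCat.{u}} (x : Spec A ⟶ Z) :
    (x ≫ q) ≫ orbitClosureι V = Spec.map (CommRingCat.ofHom
      ((incidencePoints η A x).2.V.evalHom (incidencePoints η A x).1)) := by
  rw [Category.assoc, hq, comp_toRep]
  rfl

theorem mem_nonvanishing_iff {A : CommRingCat.{u}} (x : Spec A ⟶ Z) (p : Spec A)
    (f : MvPolynomial (Coord d₁ d₂ d₃) k) :
    (x ≫ q) p ∈ nonvanishing V f ↔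
      (incidencePoints η A x).2.V.evalHom (incidencePoints η A x).1 f ∉ p.asIdeal := by
  have apply_eq : orbitClosureι V ((x ≫ q) p) = Spec.map (CommRingCat.ofHom
      ((incidencePoints η A x).2.V.evalHom (incidencePoints η A x).1)) p := by
    rw [← comp_orbitClosureι_eq hq]
    rfl
  exact not_congr (iff_of_eq (congrArg (f ∈ PrimeSpectrum.asIdeal ·) apply_eq))

theorem isProper_of_comp_eq [CompactSpace Z] [LocallyOfFiniteType (toBase η)] : IsProper q := by
  have : IsProper (q ≫ orbitClosureι V) := hq ▸ isProper_toRep η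
  have : IsSeparated (orbitClosureι V) := inferInstanceAs (IsSeparated (Spec.map _))
  exact .of_comp q (orbitClosureι V)

theorem exists_forall_mem_nonvanishing_iff (P : IncidencePoint k d₁ d₂ d₃ r₁ r₂ c) :
    ∃ z : Z, ∀ f, q z ∈ nonvanishing V f ↔ P.V.evalHom (RingHom.id k) f ≠ 0 := by
  let x := (incidencePoints η (.of k)).symm (RingHom.id k, P)
  let pt : Spec (.of k) := (⊥ : PrimeSpectrum k)
  refine ⟨x pt, fun f => (mem_nonvanishing_iff hq x pt f).trans ?_⟩
  rw [Equiv.apply_symm_apply]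
  exact not_congr Ideal.mem_bot

theorem surjective_of_comp_eq [UniversallyClosed q]
    (horbit : ∀ W ∈ V.orbit, ∃ P : IncidencePoint k d₁ d₂ d₃ r₁ r₂ c, P.V = W) :
    Surjective q := by
  obtain ⟨J, hJ⟩ := (PrimeSpectrum.isClosed_iff_zeroLocus _).1 q.isClosedMap.isClosed_range
  -- A function vanishing on the image vanishes on the orbit, hence is zero on its closure.
  have eq_zero : ∀ g ∈ J, g = 0 := by
    intro g hg
    obtain ⟨f, rfl⟩ := Ideal.Quotient.mk_surjective g
    rw [Ideal.Quotient.eq_zero_iff_mem, mem_orbitIdeal_iff]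
    rintro W hW
    obtain ⟨P, rfl⟩ := horbit W hW
    obtain ⟨z, hz⟩ := exists_forall_mem_nonvanishing_iff hq P
    by_contra h
    have mem_zeroLocus : q z ∈ PrimeSpectrum.zeroLocus J := hJ ▸ Set.mem_range_self z
    exact (hz f).2 h (mem_zeroLocus hg)
  refine ⟨fun y => ?_⟩
  change y ∈ Set.range q
  rw [hJ]
  exact fun g hg => eq_zero g hg ▸ Submodule.zero_mem _

theorem isUnit_evalHom_of_forall_mem_nonvanishing {A : CommRingCat.{u}} {x : Spec A ⟶ Z}
    {f : MvPolynomial (Coord d₁ d₂ d₃) k} (h : ∀ p, (x ≫ q) p ∈ nonvanishing V f) :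
    IsUnit ((incidencePoints η A x).2.V.evalHom (incidencePoints η A x).1 f) := by
  by_contra hf
  obtain ⟨M, hM, hmem⟩ := exists_max_ideal_of_mem_nonunits hf
  exact (mem_nonvanishing_iff hq x ⟨M, hM.isPrime⟩ f).1 (h _) hmem

theorem eq_of_comp_eq_of_forall_mem_nonvanishing (hd₂ : d₂ = r₂ + b)
    {D : MinorChoice k d₁ d₂ d₃ r₁ b c} {A : CommRingCat.{u}} {x y : Spec A ⟶ Z}
    (hxy : x ≫ q = y ≫ q) (h : ∀ p, (x ≫ q) p ∈ nonvanishing V D.poly) : x = y := by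
  have specMap_eq := (comp_orbitClosureι_eq hq x).symm.trans
    ((congrArg (· ≫ orbitClosureι V) hxy).trans (comp_orbitClosureι_eq hq y))
  obtain ⟨hκ, hV⟩ := RepSpace.evalHom_injective
    (congrArg CommRingCat.Hom.hom (Spec.map_injective specMap_eq))
  have isUnit := isUnit_evalHom_of_forall_mem_nonvanishing hq h
  rw [D.evalHom_poly] at isUnit
  exact (incidencePoints η A).injective (Prod.ext hκ (MinorChoice.incidencePoint_ext hd₂ isUnit hV))

theorem mono_morphismRestrict (hd₂ : d₂ = r₂ + b) (D : MinorChoice k d₁ d₂ d₃ r₁ b c) :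
    Mono (q ∣_ nonvanishing V D.poly) := by
  set U := nonvanishing V D.poly
  have comp_ι_comp {A : CommRingCat.{u}} (a : Spec A ⟶ (q ⁻¹ᵁ U : Z.Opens)) :
      (a ≫ (q ⁻¹ᵁ U).ι) ≫ q = (a ≫ q ∣_ U) ≫ U.ι := by
    rw [Category.assoc, Category.assoc, morphismRestrict_ι]
  refine ⟨fun f g hfg => hom_ext_of_affinePoints fun A x => ?_⟩
  rw [← cancel_mono (q ⁻¹ᵁ U).ι]
  refine eq_of_comp_eq_of_forall_mem_nonvanishing hq hd₂ (D := D) ?_ fun p => ?_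
  · rw [comp_ι_comp, comp_ι_comp, Category.assoc x f, Category.assoc x g, hfg]
  · rw [comp_ι_comp, Scheme.Hom.comp_apply]
    exact (((x ≫ f) ≫ q ∣_ U) p).2

theorem isIso_morphismRestrict [IsProper q] [Surjective q] (hd₂ : d₂ = r₂ + b)
    (D : MinorChoice k d₁ d₂ d₃ r₁ b c) : IsIso (q ∣_ nonvanishing V D.poly) := by
  have := mono_morphismRestrict hq hd₂ D
  have : IsClosedImmersion (q ∣_ nonvanishing V D.poly) :=
    (IsClosedImmersion.iff_isProper_and_mono _).2 ⟨inferInstance, this⟩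
  have : Surjective (q ∣_ nonvanishing V D.poly) := IsZariskiLocalAtTarget.restrict ‹_› _
  exact isIso_of_isClosedImmersion_of_surjective _

end

theorem isResolutionOfSingularities_of_comp_eq
    {η : affinePoints Z ≅ incidenceFunctor k d₁ d₂ d₃ (b₁ + c) r₂ c} [IsIntegral Z]
    [CompactSpace Z] [Smooth (toBase η)]
    (hV : V.toQRep.Isomorphic (QRep.ofMultiplicities k a₁ a₂ a₃ b₁ b₂ c)) (hd₂ : d₂ = r₂ + b₂)
    (hq : q ≫ orbitClosureι V = toRep η) :
    IsResolutionOfSingularities (toBase η) (orbitClosureStr V) q where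
  comp_eq := by rw [← orbitClosureι_comp_repBase, ← Category.assoc, hq, toBase]
  integral := inferInstance
  smooth := inferInstance
  proper := isProper_of_comp_eq hq
  birational := by
    have := isProper_of_comp_eq hq
    have := surjective_of_comp_eq hq fun W => exists_incidencePoint_of_mem_orbit hV hd₂
    obtain ⟨D, hD⟩ := MinorChoice.exists_discr_ne_zero
      ((RepSpace.mem_orbit_iff_hasRanks hV).1 V.mem_orbit_self)
    obtain ⟨P, hP⟩ := exists_incidencePoint_of_mem_orbit hV hd₂ V.mem_orbit_self
    obtain ⟨z, hz⟩ := exists_forall_mem_nonvanishing_iff hq P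
    have hz : q z ∈ nonvanishing V D.poly := (hz _).2 (by rw [hP, D.evalHom_poly]; exact hD)
    have : PreirreducibleSpace (orbitClosure V) :=
      ⟨Set.image_univ_of_surjective q.surjective ▸
        PreirreducibleSpace.isPreirreducible_univ.image q q.continuous.continuousOn⟩
    exact ⟨nonvanishing V D.poly, (nonvanishing V D.poly).2.dense ⟨_, hz⟩,
      (q ⁻¹ᵁ nonvanishing V D.poly).2.dense ⟨_, hz⟩, isIso_morphismRestrict hq hd₂ D⟩

end Resolution

end EquiA3

end

theorem mainTheorem5_general {k : Type u} [Field k] [Infinite k]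
    (d₁ d₂ d₃ a₁ a₂ a₃ b₁ b₂ c : ℕ) (V : EquiA3.RepSpace k d₁ d₂ d₃)
    (hV : V.toQRep.Isomorphic (EquiA3.QRep.ofMultiplicities k a₁ a₂ a₃ b₁ b₂ c)) :
    ∃ (Z : Scheme.{u}) (s : Z ⟶ Spec (CommRingCat.of k))
      (e : EquiA3.IncidenceVarietyStr s d₁ d₂ d₃ (b₁ + c) (d₂ - b₂) c)
      (q : Z ⟶ EquiA3.orbitClosure V),
      EquiA3.IsFirstProjection e q ∧
        EquiA3.IsResolutionOfSingularities s (EquiA3.orbitClosureStr V) q := by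
  obtain ⟨-, dim₂, dim₃⟩ := EquiA3.RepSpace.dim_eq_of_isomorphic hV
  have hd₂ : d₂ = (d₂ - b₂) + b₂ := by omega
  have hr₂ : d₂ - b₂ = (b₁ + c) + a₂ := by omega
  have hd₃ : d₃ = c + (a₃ + b₂) := by omega
  obtain ⟨q, hq⟩ := EquiA3.exists_comp_orbitClosureι_eq_toRep hV hd₂ hr₂ hd₃
  exact ⟨EquiA3.incidenceScheme k d₁ hd₂ hr₂ hd₃, _, EquiA3.incidenceVarietyStr _, q,
    EquiA3.isFirstProjection_of_comp_eq hq,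
    EquiA3.isResolutionOfSingularities_of_comp_eq hV hd₂ hq⟩

theorem mainTheorem5 {k : Type u} [Field k] [CharZero k]
    (d₁ d₂ d₃ a₁ a₂ a₃ b₁ b₂ c : ℕ) (V : EquiA3.RepSpace k d₁ d₂ d₃)
    (hV : V.toQRep.Isomorphic (EquiA3.QRep.ofMultiplicities k a₁ a₂ a₃ b₁ b₂ c)) :
    ∃ (Z : Scheme.{u}) (s : Z ⟶ Spec (CommRingCat.of k))
      (e : EquiA3.IncidenceVarietyStr s d₁ d₂ d₃ (b₁ + c) (d₂ - b₂) c)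
      (q : Z ⟶ EquiA3.orbitClosure V),
      EquiA3.IsFirstProjection e q ∧
        EquiA3.IsResolutionOfSingularities s (EquiA3.orbitClosureStr V) q := by
  exact mainTheorem5_general d₁ d₂ d₃ a₁ a₂ a₃ b₁ b₂ c V hV
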